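/- Let $G=G_1\times\cdots\times G_n$ be a product of locally compact $\sigma$-compact Hausdorff topological groups, and let $\Gamma<G$ be an irreducible uniform lattice, i.e. a discrete subgroup such that $G/\Gamma$ is compact and the projection of $\Gamma$ to each factor $G_i$ is dense. Let $X$ be a non-empty proper CAT(0) space, and let $\Gamma$ act on $X$ by isometries without global fixed point (no $x\in X$ is fixed by all of $\Gamma$). Let $\partial X$ be the boundary at infinity of $X$ (geodesic rays up to bounded distance) with the cone topology and the induced $\Gamma$-action. Then there is a non-empty closed $\Gamma$-invariant set $\mathscr{C}\subseteq\partial X$ on which the $\Gamma$-action extends continuously to a $G$-action: there is an action of $G$ on $\mathscr{C}$ such that the map $G\times\mathscr{C}\to\mathscr{C}$ is continuous and every $\gamma\in\Gamma$ acts on $\mathscr{C}$ as it does on $\partial X$. Moreover, for some $i\in\{1,\ldots,n\}$ this action factors through the projection $G\to G_i$, i.e. it is the composition of this projection with a continuous action of $G_i$ on $\mathscr{C}$. -/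

import Mathlib

open scoped NNReal

namespace CAT0

/-- `σ`, restricted to `[0, d(x,y)]`, is a geodesic segment from `x` to `y`
(only the values of `σ` on that interval matter). -/
def IsGeodesicSegment {X : Type*} [MetricSpace X] (σ : ℝ → X) (x y : X) : Prop :=
  σ 0 = x ∧ σ (dist x y) = y ∧
    ∀ s ∈ Set.Icc 0 (dist x y), ∀ t ∈ Set.Icc 0 (dist x y), dist (σ s) (σ t) = |s - t|

/-- A CAT(0) space: a geodesic space in which the midpoint of every geodesic segment satisfies
the Bruhat-Tits "courbure négative" inequality. -/
structure IsCAT0 (X : Type*) [MetricSpace X] : Prop where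
  exists_geodesic : ∀ x y : X, ∃ σ : ℝ → X, IsGeodesicSegment σ x y
  cn : ∀ (x c c' : X) (σ : ℝ → X), IsGeodesicSegment σ c c' →
    2 * dist (σ (dist c c' / 2)) x ^ 2 ≤
      dist c' x ^ 2 + dist c x ^ 2 - (1 / 2) * dist c' c ^ 2

/-- A geodesic ray: an isometric map `[0, ∞) → X`. -/
structure Ray (X : Type*) [MetricSpace X] where
  toFun : ℝ≥0 → X
  isometry : Isometry toFun

/-- Two rays are asymptotic if they remain at bounded distance from each other. -/
def Asymptotic {X : Type*} [MetricSpace X] (c c' : Ray X) : Prop :=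
  ∃ K : ℝ, ∀ t : ℝ≥0, dist (c.toFun t) (c'.toFun t) ≤ K

/-- Being asymptotic is an equivalence relation. -/
def raySetoid (X : Type*) [MetricSpace X] : Setoid (Ray X) where
  r := Asymptotic
  iseqv :=
    { refl := fun _ => ⟨0, fun _ => (dist_self _).le⟩
      symm := fun ⟨K, hK⟩ => ⟨K, fun t => by rw [dist_comm]; exact hK t⟩
      trans := fun ⟨K, hK⟩ ⟨L, hL⟩ =>
        ⟨K + L, fun t => (dist_triangle _ _ _).trans (add_le_add (hK t) (hL t))⟩ }

/-- The boundary at infinity `∂X`. -/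
def Boundary (X : Type*) [MetricSpace X] : Type _ := Quotient (raySetoid X)

/-- The point at infinity of a ray. -/
def Ray.endpoint {X : Type*} [MetricSpace X] (c : Ray X) : Boundary X :=
  Quotient.mk (raySetoid X) c

/-- The standard cone neighbourhood `U(c, r, ε)` in `∂X`: the points at infinity of those rays
that start at the origin of `c` and pass at time `r` at distance less than `ε` from `c(r)`. -/
def coneNhd {X : Type*} [MetricSpace X] (c : Ray X) (r : ℝ≥0) (ε : ℝ) : Set (Boundary X) :=
  {ξ | ∃ c' : Ray X, c'.endpoint = ξ ∧ c'.toFun 0 = c.toFun 0 ∧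
    dist (c'.toFun r) (c.toFun r) < ε}

/-- The cone topology on `∂X`, generated by the sets `U(c, r, ε)`. In a complete CAT(0) space,
those with `c` starting at a fixed basepoint are a basis of a topology that does not depend on
the basepoint; hence all basepoints are allowed here. -/
instance coneTopology (X : Type*) [MetricSpace X] : TopologicalSpace (Boundary X) :=
  TopologicalSpace.generateFrom
    {U | ∃ (c : Ray X) (r : ℝ≥0) (ε : ℝ), 0 < ε ∧ U = coneNhd c r ε}

/-- The translate of a ray by an isometry. -/
def Ray.smul {M X : Type*} [MetricSpace X] [Group M] [MulAction M X] [IsIsometricSMul M X]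
    (g : M) (c : Ray X) : Ray X where
  toFun t := g • c.toFun t
  isometry := (isometry_smul X g).comp c.isometry

/-- The action on `∂X` induced by an action on `X` by isometries. -/
instance boundaryMulAction {M X : Type*} [MetricSpace X] [Group M] [MulAction M X]
    [IsIsometricSMul M X] : MulAction M (Boundary X) where
  smul g := Quotient.map (Ray.smul g) fun _ _ ⟨K, hK⟩ =>
    ⟨K, fun t => (dist_smul g _ _).trans_le (hK t)⟩
  one_smul ξ := by
    induction ξ using Quotient.inductionOn with
    | _ c => exact Quotient.sound ⟨0, fun t => by simp [Ray.smul]⟩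
  mul_smul g h ξ := by
    induction ξ using Quotient.inductionOn with
    | _ c => exact Quotient.sound ⟨0, fun t => by simp [Ray.smul, mul_smul]⟩

/-- A uniform lattice: a discrete cocompact subgroup. -/
structure IsUniformLattice {G : Type*} [Group G] [TopologicalSpace G] (Γ : Subgroup G) :
    Prop where
  discrete : DiscreteTopology Γ
  cocompact : CompactSpace (G ⧸ Γ)

/-- A subgroup of a product is irreducible if its projection to each factor is dense. -/
def IsIrreducible {n : ℕ} {G : Fin n → Type*} [∀ i, Group (G i)]
    [∀ i, TopologicalSpace (G i)] (Γ : Subgroup (∀ i, G i)) : Prop :=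
  ∀ i, Dense ((fun g : ∀ j, G j => g i) '' (Γ : Set (∀ j, G j)))

end CAT0

/-! If `Γ` fixes a point at infinity, that point alone serves as `C`, with the trivial action.
Otherwise everything rests on a dichotomy for a single factor `H = G j`, with projection `p` and
inclusion `ι` (`IsSetup.invariant_or_boundary_action`). The objects are continuous `Γ`-equivariant
maps `f : G → X`, on which `H` acts by right translation. Only maps whose displacement under right
translation by each element of `ker p` is bounded by that of a fixed map `f₀` are allowed. A stable
set is a non-empty set of such maps that is uniformly closed, convex, and preserved by translation
and by averaging along `H`.

Zorn's lemma gives a minimal stable set `M`. Distances between maps are measured in mean square over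
`Γ \ G`, by integration against a weight. The mean square distance from `f₀` to the members of a
chain of stable sets stays bounded: otherwise near-projections of `f₀` would go to infinity with
bounded displacement, and their barycenters would produce a `Γ`-fixed point at infinity
(`IsSetup.exists_fixed_boundary`). Hence near-minimizers along a chain are Cauchy in mean square.
Averaging along `H` turns this into uniform convergence (`IsSetup.exists_mollify_close`), and the
limit belongs to every member of the chain.

Minimality forces the mean square displacement by each `k ∈ ker p` to be constant on `M`. The
equality case of convexity then makes `d(f, f')` invariant under `ker p`; being also `Γ`-invariant,
it is constant because `p(Γ)` is dense (`IsSetup.dist_eq_dist_one`). So `f ↦ f 1` identifies `M`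
with a closed convex subset of `X` carrying an isometric `H`-action at bounded distance from the
action of `Γ`. If this subset is bounded, `M` is a single `H`-invariant map; if not, `H` acts
continuously on its boundary, which is the required `C`.

To exclude the invariant map, start from an `f₀` that is independent of as many factors as possible.
It depends on some factor `j`, since a constant equivariant map would give a fixed point in `X`. An
invariant map for `G j` would still be independent of the earlier factors, by the displacement
bound, against maximality. -/

namespace CAT0

/-! ### Midpoints and the quadruple inequality. -/

section Midpoint

variable {X : Type*} [MetricSpace X]

/-- A midpoint of two points of a CAT(0) space. -/
noncomputable def IsCAT0.mid (hX : IsCAT0 X) (x y : X) : X :=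
  (hX.exists_geodesic x y).choose (dist x y / 2)

theorem IsCAT0.cn_mid (hX : IsCAT0 X) (a b x : X) :
    dist (hX.mid a b) x ^ 2 ≤ (dist a x ^ 2 + dist b x ^ 2) / 2 - dist a b ^ 2 / 4 := by
  have h := hX.cn x a b _ (hX.exists_geodesic a b).choose_spec
  rw [dist_comm b a] at h
  have e : dist (hX.mid a b) x =
    dist ((hX.exists_geodesic a b).choose (dist a b / 2)) x := rfl
  rw [e]
  linarith

theorem IsCAT0.dist_mid_left (hX : IsCAT0 X) (a b : X) : dist (hX.mid a b) a = dist a b / 2 := by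
  obtain ⟨h0, -, h⟩ := (hX.exists_geodesic a b).choose_spec
  have hd : 0 ≤ dist a b := dist_nonneg
  have := h (dist a b / 2) ⟨by linarith, by linarith⟩ 0 ⟨le_rfl, hd⟩
  rw [h0, sub_zero, abs_of_nonneg (by linarith)] at this
  exact this

theorem IsCAT0.dist_mid_right (hX : IsCAT0 X) (a b : X) : dist (hX.mid a b) b = dist a b / 2 := by
  obtain ⟨-, h1, h⟩ := (hX.exists_geodesic a b).choose_spec
  have hd : 0 ≤ dist a b := dist_nonneg
  have := h (dist a b / 2) ⟨by linarith, by linarith⟩ (dist a b) ⟨hd, le_rfl⟩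
  rw [h1, abs_of_nonpos (by linarith)] at this
  rw [IsCAT0.mid, this]
  ring

theorem IsCAT0.eq_mid (hX : IsCAT0 X) {a b m : X} (ha : dist m a ≤ dist a b / 2) (hb : dist m b ≤ dist a b / 2) :
    m = hX.mid a b := by
  have h := hX.cn_mid a b m
  rw [dist_comm a m, dist_comm b m] at h
  have h1 : dist m a ^ 2 ≤ (dist a b / 2) ^ 2 := pow_le_pow_left₀ dist_nonneg ha 2
  have h2 : dist m b ^ 2 ≤ (dist a b / 2) ^ 2 := pow_le_pow_left₀ dist_nonneg hb 2
  have h3 : dist (hX.mid a b) m ^ 2 ≤ 0 := by nlinarith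
  have h4 : dist (hX.mid a b) m = 0 := by
    have := sq_nonneg (dist (hX.mid a b) m)
    exact pow_eq_zero_iff (two_ne_zero) |>.1 (le_antisymm h3 this)
  exact (dist_eq_zero.1 h4).symm

theorem IsCAT0.mid_comm (hX : IsCAT0 X) (a b : X) : hX.mid a b = hX.mid b a := by
  apply hX.eq_mid
  · rw [hX.dist_mid_right, dist_comm]
  · rw [hX.dist_mid_left, dist_comm]

theorem IsCAT0.mid_self (hX : IsCAT0 X) (a : X) : hX.mid a a = a := by
  symm; apply hX.eq_mid <;> simp

/-- Apply the CN inequality at the midpoint of `a b'` seen from `mid a b`, and bound the remaining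
distance from `b'` to `mid a b` by CN again. -/
theorem IsCAT0.dist_mid_mid_left (hX : IsCAT0 X) (a b b' : X) :
    dist (hX.mid a b) (hX.mid a b') ≤ dist b b' / 2 := by
  have h1 := hX.cn_mid a b' (hX.mid a b)
  have h2 := hX.cn_mid a b b'
  have h3 := hX.dist_mid_left a b
  rw [dist_comm (hX.mid a b'), dist_comm a (hX.mid a b), dist_comm b' (hX.mid a b), h3] at h1
  have h4 : dist (hX.mid a b) (hX.mid a b') ^ 2 ≤ (dist b b' / 2) ^ 2 := by nlinarith
  exact le_of_sq_le_sq h4 (by positivity)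

theorem IsCAT0.dist_mid_mid (hX : IsCAT0 X) (a b a' b' : X) :
    dist (hX.mid a b) (hX.mid a' b') ≤ (dist a a' + dist b b') / 2 := by
  have h1 := hX.dist_mid_mid_left a b b'
  have h2 := hX.dist_mid_mid_left b' a a'
  rw [hX.mid_comm b' a, hX.mid_comm b' a'] at h2
  linarith [dist_triangle (hX.mid a b) (hX.mid a b') (hX.mid a' b')]

theorem IsCAT0.smul_mid (hX : IsCAT0 X) {M : Type*} [Group M] [MulAction M X] [IsIsometricSMul M X] (g : M)
    (a b : X) : g • hX.mid a b = hX.mid (g • a) (g • b) := by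
  apply hX.eq_mid
  · rw [dist_smul, dist_smul, hX.dist_mid_left]
  · rw [dist_smul, dist_smul, hX.dist_mid_right]

theorem IsCAT0.continuous_mid (hX : IsCAT0 X) : Continuous fun q : X × X => hX.mid q.1 q.2 := by
  have : LipschitzWith 1 fun q : X × X => hX.mid q.1 q.2 := by
    apply LipschitzWith.of_dist_le_mul
    intro q q'
    have := hX.dist_mid_mid q.1 q.2 q'.1 q'.2
    have h1 : dist q.1 q'.1 ≤ dist q q' := le_max_left _ _
    have h2 : dist q.2 q'.2 ≤ dist q q' := le_max_right _ _
    simp only [NNReal.coe_one, one_mul]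
    linarith
  exact this.continuous

/-- The quadrilateral inequality with squared side lengths. -/
theorem IsCAT0.quadruple_sq (hX : IsCAT0 X) (x y b b' : X) :
    dist x b' ^ 2 + dist y b ^ 2 ≤
      dist x b ^ 2 + dist y b' ^ 2 + (dist x y ^ 2 + dist b b' ^ 2) := by
  -- The diagonal `y b` is compared with the path through the midpoint of the other diagonal, using
  -- `(s + t)² ≤ 2s² + 2t²`.
  have h1 := hX.cn_mid x b' y
  have h2 := hX.cn_mid x b' b
  have h3 := dist_triangle y (hX.mid x b') b
  rw [dist_comm y (hX.mid x b')] at h3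
  rw [dist_comm b' y] at h1
  rw [dist_comm b' b] at h2
  have h4 : dist y b ^ 2 ≤ (dist (hX.mid x b') y + dist (hX.mid x b') b) ^ 2 :=
    pow_le_pow_left₀ dist_nonneg h3 2
  have h5 := sq_nonneg (dist (hX.mid x b') y - dist (hX.mid x b') b)
  nlinarith [h5]

/-- Two points can be joined by a chain of `n` steps of equal length. -/
theorem IsCAT0.exists_chain (hX : IsCAT0 X) (x y : X) (n : ℕ) (hn : 0 < n) : ∃ z : ℕ → X, z 0 = x ∧ z n = y ∧
    ∀ i < n, dist (z i) (z (i + 1)) = dist x y / n := by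
  obtain ⟨σ, h0, h1, h⟩ := hX.exists_geodesic x y
  have hn' : (0 : ℝ) < n := by exact_mod_cast hn
  have hd : 0 ≤ dist x y := dist_nonneg
  refine ⟨fun i => σ (i * (dist x y / n)), by simp [h0], ?_, ?_⟩
  · simp only
    rw [mul_div_cancel₀ _ hn'.ne', h1]
  · intro i hi
    have hmem : ∀ k : ℕ, k ≤ n → (k : ℝ) * (dist x y / n) ∈ Set.Icc 0 (dist x y) := by
      intro k hk
      refine ⟨by positivity, ?_⟩
      rw [mul_div_assoc', div_le_iff₀ hn', mul_comm]
      exact mul_le_mul_of_nonneg_left (by exact_mod_cast hk) hd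
    simp only
    rw [h _ (hmem i hi.le) _ (hmem (i + 1) hi), Nat.cast_add, Nat.cast_one, abs_sub_comm,
      abs_of_nonneg]
    · ring
    · have : 0 ≤ dist x y / n := by positivity
      nlinarith

/-- Cut the two sides into `n` and `m` equal steps and add `quadruple_sq` over the `n * m` small
cells. The left-hand sides are second differences and telescope. -/
theorem IsCAT0.quadruple_nat (hX : IsCAT0 X) (x y b b' : X) (n m : ℕ) (hn : 0 < n) (hm : 0 < m) :
    dist x b' ^ 2 + dist y b ^ 2 - dist x b ^ 2 - dist y b' ^ 2 ≤
      m / n * dist x y ^ 2 + n / m * dist b b' ^ 2 := by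
  obtain ⟨z, z0, zn, hz⟩ := hX.exists_chain x y n hn
  obtain ⟨v, v0, vm, hv⟩ := hX.exists_chain b b' m hm
  have hn' : (0 : ℝ) < n := by exact_mod_cast hn
  have hm' : (0 : ℝ) < m := by exact_mod_cast hm
  set D : ℕ → ℕ → ℝ := fun i j => dist (z i) (v j) ^ 2 with hD
  have key : ∑ i ∈ Finset.range n, ∑ j ∈ Finset.range m,
      ((D i (j + 1) - D i j) - (D (i + 1) (j + 1) - D (i + 1) j)) =
      dist x b' ^ 2 + dist y b ^ 2 - dist x b ^ 2 - dist y b' ^ 2 := by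
    have h1 : ∀ i, ∑ j ∈ Finset.range m,
      ((D i (j + 1) - D i j) - (D (i + 1) (j + 1) - D (i + 1) j)) =
        (D i m - D i 0) - (D (i + 1) m - D (i + 1) 0) := by
      intro i
      rw [Finset.sum_sub_distrib, Finset.sum_range_sub, Finset.sum_range_sub]
    simp only [h1]
    rw [Finset.sum_range_sub' (fun i => D i m - D i 0)]
    simp only [hD, z0, zn, v0, vm]
    ring
  rw [← key]
  calc _ ≤ ∑ i ∈ Finset.range n, ∑ j ∈ Finset.range m,
        ((dist x y / n) ^ 2 + (dist b b' / m) ^ 2) := by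
        apply Finset.sum_le_sum
        intro i hi
        apply Finset.sum_le_sum
        intro j hj
        have h := hX.quadruple_sq (z i) (z (i + 1)) (v j) (v (j + 1))
        rw [hz i (Finset.mem_range.1 hi), hv j (Finset.mem_range.1 hj)] at h
        simp only [hD]
        linarith
    _ = _ := by
        simp only [Finset.sum_const, Finset.card_range, nsmul_eq_mul]
        field_simp

/-- Reshetnyak's quadruple inequality. -/
theorem IsCAT0.quadruple (hX : IsCAT0 X) (x y b b' : X) :
    dist x b' ^ 2 + dist y b ^ 2 ≤
      dist x b ^ 2 + dist y b' ^ 2 + 2 * (dist x y * dist b b') := by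
  rcases eq_or_ne x y with rfl | hxy
  · simp [add_comm]
  rcases eq_or_ne b b' with rfl | hb
  · simp
  have hα : 0 < dist x y := dist_pos.2 hxy
  have hβ : 0 < dist b b' := dist_pos.2 hb
  set α := dist x y
  set β := dist b b'
  set Q := dist x b' ^ 2 + dist y b ^ 2 - dist x b ^ 2 - dist y b' ^ 2 with hQ
  -- With `m / (n + 1)` close to `β / α`, both terms of `quadruple_nat` approach `α * β`; the last
  -- term is the rounding error of the ceiling.
  have main : ∀ n : ℕ, Q ≤ 2 * (α * β) + α ^ 2 * (1 / ((n : ℝ) + 1)) := by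
    intro n
    have hn : (0 : ℝ) < (n : ℝ) + 1 := by positivity
    set m := ⌈((n : ℝ) + 1) * β / α⌉₊ with hm
    have hm0 : 0 < m := Nat.ceil_pos.2 (by positivity)
    have hm0' : (0 : ℝ) < m := by exact_mod_cast hm0
    have h1 : ((n : ℝ) + 1) * β / α ≤ m := Nat.le_ceil _
    have h2 : (m : ℝ) < ((n : ℝ) + 1) * β / α + 1 := Nat.ceil_lt_add_one (by positivity)
    have h := hX.quadruple_nat x y b b' (n + 1) m n.succ_pos hm0
    push_cast at h
    have e1 : (m : ℝ) / (n + 1) * α ^ 2 ≤ α * β + α ^ 2 * (1 / ((n : ℝ) + 1)) := by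
      have : (m : ℝ) / (n + 1) ≤ β / α + 1 / ((n : ℝ) + 1) := by
        rw [div_le_iff₀ hn]
        calc (m : ℝ) ≤ ((n : ℝ) + 1) * β / α + 1 := h2.le
          _ = _ := by field_simp
      calc _ ≤ (β / α + 1 / ((n : ℝ) + 1)) * α ^ 2 :=
            mul_le_mul_of_nonneg_right this (by positivity)
        _ = _ := by field_simp
    have e2 : ((n : ℝ) + 1) / m * β ^ 2 ≤ α * β := by
      have : ((n : ℝ) + 1) / m ≤ α / β := by
        rw [div_le_div_iff₀ hm0' hβ]
        rw [div_le_iff₀ hα] at h1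
        linarith
      calc _ ≤ α / β * β ^ 2 := mul_le_mul_of_nonneg_right this (by positivity)
        _ = _ := by field_simp
    linarith
  have lim : Filter.Tendsto (fun n : ℕ => 2 * (α * β) + α ^ 2 * (1 / ((n : ℝ) + 1)))
      Filter.atTop (nhds (2 * (α * β) + α ^ 2 * 0)) :=
    (tendsto_one_div_add_atTop_nhds_zero_nat.const_mul _).const_add _
  have := ge_of_tendsto' lim main
  linarith

/-- CN three times and the quadruple inequality. The subtracted square is what matters: equality in
convexity forces `d(a, b) = d(a', b')`, which drives the rigidity of minimal sets. -/
theorem IsCAT0.sq_dist_mid_mid (hX : IsCAT0 X) (a b a' b' : X) :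
    dist (hX.mid a b) (hX.mid a' b') ^ 2 ≤
      (dist a a' ^ 2 + dist b b' ^ 2) / 2 - (dist a b - dist a' b') ^ 2 / 4 := by
  have h1 := hX.cn_mid a' b' (hX.mid a b)
  have h2 := hX.cn_mid a b a'
  have h3 := hX.cn_mid a b b'
  have h4 := hX.quadruple a b a' b'
  rw [dist_comm (hX.mid a' b'), dist_comm a', dist_comm b'] at h1
  nlinarith

end Midpoint

/-! ### Geodesic rays and the boundary at infinity. -/

section Rays

open Filter Topology

/-- A continuous midpoint-convex function on an interval is bounded by its values at the ends. -/
theorem le_max_of_midpoint_convex {ψ : ℝ → ℝ} {a b : ℝ}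
    (hc : ContinuousOn ψ (Set.Icc a b))
    (hm : ∀ s ∈ Set.Icc a b, ∀ t ∈ Set.Icc a b, ψ ((s + t) / 2) ≤ (ψ s + ψ t) / 2)
    {t : ℝ} (ht : t ∈ Set.Icc a b) : ψ t ≤ max (ψ a) (ψ b) := by
  have hab : a ≤ b := ht.1.trans ht.2
  obtain ⟨t₁, ht₁, hmax⟩ := isCompact_Icc.exists_isMaxOn ⟨t, ht⟩ hc
  have hmax' : ∀ s ∈ Set.Icc a b, ψ s ≤ ψ t₁ := fun s hs => hmax hs
  set T := Set.Icc a b ∩ ψ ⁻¹' {ψ t₁}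
  have hT : IsCompact T :=
    isCompact_Icc.of_isClosed_subset (hc.preimage_isClosed_of_isClosed isClosed_Icc
      isClosed_singleton) Set.inter_subset_left
  -- Take the leftmost maximum point. If it were not an end, convexity on a symmetric interval
  -- around it would give a maximum point further left.
  obtain ⟨t₀, ht₀, hleast⟩ := hT.exists_isLeast ⟨t₁, ht₁, rfl⟩
  have e0 : ψ t₀ = ψ t₁ := ht₀.2
  refine (hmax' t ht).trans ?_
  rw [← e0]
  by_contra! hcon
  have ha : a < t₀ := lt_of_le_of_ne ht₀.1.1 (by rintro rfl; exact absurd (le_max_left _ _) hcon.not_ge)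
  have hb : t₀ < b := lt_of_le_of_ne ht₀.1.2 (by rintro rfl; exact absurd (le_max_right _ _) hcon.not_ge)
  set s := min (t₀ - a) (b - t₀)
  have hs : 0 < s := lt_min (by linarith) (by linarith)
  have hs1 : s ≤ t₀ - a := min_le_left _ _
  have hs2 : s ≤ b - t₀ := min_le_right _ _
  have m1 : t₀ - s ∈ Set.Icc a b := ⟨by linarith, by linarith⟩
  have m2 : t₀ + s ∈ Set.Icc a b := ⟨by linarith, by linarith⟩
  have h := hm _ m1 _ m2
  rw [show (t₀ - s + (t₀ + s)) / 2 = t₀ by ring] at h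
  have h2 := hmax' _ m2
  have h1 := hmax' _ m1
  have h3 : ψ (t₀ - s) = ψ t₁ := by linarith
  have := hleast ⟨m1, h3⟩
  linarith

variable {X : Type*} [MetricSpace X]

theorem Ray.dist_eq (c : Ray X) (s t : ℝ≥0) : dist (c.toFun s) (c.toFun t) = |(s : ℝ) - t| := by
  rw [c.isometry.dist_eq, NNReal.dist_eq]

theorem endpoint_eq_iff {c c' : Ray X} : c.endpoint = c'.endpoint ↔ Asymptotic c c' :=
  ⟨fun h => Quotient.exact h, fun h => Quotient.sound h⟩

theorem exists_rep (ξ : Boundary X) : ∃ c : Ray X, c.endpoint = ξ :=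
  Quotient.exists_rep ξ

theorem smul_endpoint {M : Type*} [Group M] [MulAction M X] [IsIsometricSMul M X] (g : M)
    (c : Ray X) : g • c.endpoint = (c.smul g).endpoint := rfl

theorem IsCAT0.mid_of_dist (hX : IsCAT0 X) {σ : ℝ → X} {S : Set ℝ}
    (h : ∀ s ∈ S, ∀ t ∈ S, dist (σ s) (σ t) = |s - t|) {s t : ℝ} (hs : s ∈ S) (ht : t ∈ S)
    (hst : (s + t) / 2 ∈ S) : σ ((s + t) / 2) = hX.mid (σ s) (σ t) := by
  apply hX.eq_mid
  · rw [h _ hst _ hs, h _ hs _ ht, show (s + t) / 2 - s = -((s - t) / 2) by ring, abs_neg, abs_div]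
    norm_num
  · rw [h _ hst _ ht, h _ hs _ ht, show (s + t) / 2 - t = (s - t) / 2 by ring, abs_div]
    norm_num

theorem IsCAT0.ray_mid (hX : IsCAT0 X) (c : Ray X) (t : ℝ≥0) :
    c.toFun t = hX.mid (c.toFun 0) (c.toFun (2 * t)) := by
  apply hX.eq_mid
  · rw [c.dist_eq, c.dist_eq]; simp
  · have ht : (0 : ℝ) ≤ t := t.2
    rw [c.dist_eq, c.dist_eq]; push_cast
    rw [zero_sub, abs_neg, abs_of_nonneg (by linarith : (0 : ℝ) ≤ 2 * t), abs_of_nonpos] <;>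
      linarith

/-- Convexity of the distance between rays, in the form needed: halving the time at least halves the
excess over the initial distance. A bounded excess is thus non-positive, and rays with a common
origin that are moderately far apart late are close early. -/
theorem IsCAT0.dist_ray_sub_le (hX : IsCAT0 X) (c c' : Ray X) (t : ℝ≥0) (n : ℕ) :
    dist (c.toFun t) (c'.toFun t) - dist (c.toFun 0) (c'.toFun 0) ≤
      (1 / 2) ^ n * (dist (c.toFun (2 ^ n * t)) (c'.toFun (2 ^ n * t))
        - dist (c.toFun 0) (c'.toFun 0)) := by
  induction n with
  | zero => simp
  | succ n ih =>
    refine ih.trans ?_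
    have h := hX.dist_mid_mid (c.toFun 0) (c.toFun (2 * (2 ^ n * t))) (c'.toFun 0)
      (c'.toFun (2 * (2 ^ n * t)))
    rw [← hX.ray_mid, ← hX.ray_mid] at h
    rw [pow_succ, pow_succ, mul_assoc, show (2 : ℝ≥0) ^ n * 2 * t = 2 * (2 ^ n * t) by ring]
    apply mul_le_mul_of_nonneg_left _ (by positivity)
    linarith

theorem IsCAT0.dist_le_of_asymptotic (hX : IsCAT0 X) {c c' : Ray X} (h : Asymptotic c c')
    (t : ℝ≥0) : dist (c.toFun t) (c'.toFun t) ≤ dist (c.toFun 0) (c'.toFun 0) := by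
  obtain ⟨K, hK⟩ := h
  have lim : Tendsto (fun n : ℕ => (1 / 2 : ℝ) ^ n * K) atTop (𝓝 (0 * K)) :=
    (tendsto_pow_atTop_nhds_zero_of_lt_one (by norm_num) (by norm_num)).mul_const _
  have : dist (c.toFun t) (c'.toFun t) - dist (c.toFun 0) (c'.toFun 0) ≤ 0 * K := by
    apply ge_of_tendsto' lim
    intro n
    refine (hX.dist_ray_sub_le c c' t n).trans ?_
    apply mul_le_mul_of_nonneg_left _ (by positivity)
    linarith [hK (2 ^ n * t), dist_nonneg (x := c.toFun 0) (y := c'.toFun 0)]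
  linarith

theorem Ray.ext_toFun {c c' : Ray X} (h : ∀ t, c.toFun t = c'.toFun t) : c = c' := by
  cases c; cases c'; congr; exact funext h

theorem IsCAT0.ray_unique (hX : IsCAT0 X) {c c' : Ray X} (h : c.endpoint = c'.endpoint)
    (h0 : c.toFun 0 = c'.toFun 0) : c = c' := by
  apply Ray.ext_toFun
  intro t
  have := hX.dist_le_of_asymptotic (endpoint_eq_iff.1 h) t
  rw [h0, dist_self] at this
  exact dist_le_zero.1 this

/-- Rays from one point stay close up to time `r` if they are not far apart much later. -/
theorem IsCAT0.dist_ray_le (hX : IsCAT0 X) {c c' : Ray X} (h0 : c.toFun 0 = c'.toFun 0)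
    (r : ℝ≥0) (n : ℕ) : dist (c.toFun r) (c'.toFun r) ≤
      (1 / 2) ^ n * dist (c.toFun (2 ^ n * r)) (c'.toFun (2 ^ n * r)) := by
  have := hX.dist_ray_sub_le c c' r n
  rw [h0, dist_self, sub_zero, sub_zero] at this
  exact this

/-- Limits of longer and longer geodesic segments are rays. -/
theorem exists_limit_ray [ProperSpace X] (σ : ℕ → ℝ → X) (L : ℕ → ℝ) (hL : Tendsto L atTop atTop)
    (hσ : ∀ n, ∀ s ∈ Set.Icc 0 (L n), ∀ t ∈ Set.Icc 0 (L n), dist (σ n s) (σ n t) = |s - t|)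
    (x : X) (h0 : ∀ n, σ n 0 = x) :
    ∃ c : Ray X, c.toFun 0 = x ∧
      ∀ t : ℝ≥0, Tendsto (fun n => σ n t) (hyperfilter ℕ : Filter ℕ) (𝓝 (c.toFun t)) := by
  -- A single ultrafilter gives limits for all times at once, replacing a diagonal argument; closed
  -- balls are compact.
  have hU : (hyperfilter ℕ : Filter ℕ) ≤ atTop := Nat.hyperfilter_le_atTop
  have ev : ∀ t : ℝ, ∀ᶠ n in (hyperfilter ℕ : Filter ℕ), t ≤ L n := fun t =>
    hU (hL.eventually_ge_atTop t)
  have lim : ∀ t : ℝ≥0, ∃ y, Tendsto (fun n => σ n t) (hyperfilter ℕ : Filter ℕ) (𝓝 y) := by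
    intro t
    have hmem : ∀ᶠ n in (hyperfilter ℕ : Filter ℕ), σ n t ∈ Metric.closedBall x t := by
      filter_upwards [ev t] with n hn
      rw [Metric.mem_closedBall, ← h0 n, hσ n t ⟨t.2, hn⟩ 0 ⟨le_rfl, t.2.trans hn⟩]
      simp
    obtain ⟨y, -, hy⟩ := (isCompact_closedBall x (t : ℝ)).ultrafilter_le_nhds
      ((hyperfilter ℕ).map fun n => σ n t) (le_principal_iff.2 hmem)
    exact ⟨y, hy⟩
  choose c hc using lim
  have hiso : Isometry c := by
    apply Isometry.of_dist_eq
    intro s t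
    have h1 := (hc s).dist (hc t)
    refine tendsto_nhds_unique h1 (tendsto_const_nhds.congr' ?_)
    filter_upwards [ev s, ev t] with n hs ht
    rw [hσ n s ⟨s.2, hs⟩ t ⟨t.2, ht⟩, NNReal.dist_eq]
  refine ⟨⟨c, hiso⟩, ?_, hc⟩
  refine tendsto_nhds_unique (hc 0) (tendsto_const_nhds.congr fun n => ?_)
  simp [h0]

/-- A subset closed under midpoints. -/
def IsCAT0.MidClosed (hX : IsCAT0 X) (A : Set X) : Prop := ∀ a ∈ A, ∀ b ∈ A, hX.mid a b ∈ A

theorem IsCAT0.dist_geodesics_le (hX : IsCAT0 X) {σ τ : ℝ → X} {L : ℝ}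
    (hσ : ∀ s ∈ Set.Icc 0 L, ∀ t ∈ Set.Icc 0 L, dist (σ s) (σ t) = |s - t|)
    (hτ : ∀ s ∈ Set.Icc 0 L, ∀ t ∈ Set.Icc 0 L, dist (τ s) (τ t) = |s - t|)
    {t : ℝ} (ht : t ∈ Set.Icc 0 L) :
    dist (σ t) (τ t) ≤ max (dist (σ 0) (τ 0)) (dist (σ L) (τ L)) := by
  have cont : ∀ {σ : ℝ → X}, (∀ s ∈ Set.Icc 0 L, ∀ t ∈ Set.Icc 0 L, dist (σ s) (σ t) = |s - t|) →
      ContinuousOn σ (Set.Icc 0 L) := fun h =>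
    (LipschitzOnWith.of_dist_le_mul (K := 1) fun s hs t ht => by
      rw [h s hs t ht, NNReal.coe_one, one_mul, Real.dist_eq]).continuousOn
  refine le_max_of_midpoint_convex (ψ := fun t => dist (σ t) (τ t))
    (continuous_dist.comp_continuousOn ((cont hσ).prodMk (cont hτ))) ?_ ht
  intro s hs t ht
  have hst : (s + t) / 2 ∈ Set.Icc 0 L := ⟨by linarith [hs.1, ht.1], by linarith [hs.2, ht.2]⟩
  rw [hX.mid_of_dist hσ hs ht hst, hX.mid_of_dist hτ hs ht hst]
  exact hX.dist_mid_mid _ _ _ _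

/-- The distance to `A` is midpoint-convex along the segment and vanishes at both ends. -/
theorem IsCAT0.geodesic_mem (hX : IsCAT0 X) {A : Set X} (hA : IsClosed A) (hm : hX.MidClosed A)
    {σ : ℝ → X} {L : ℝ}
    (hσ : ∀ s ∈ Set.Icc 0 L, ∀ t ∈ Set.Icc 0 L, dist (σ s) (σ t) = |s - t|)
    (h0 : σ 0 ∈ A) (h1 : σ L ∈ A) {t : ℝ} (ht : t ∈ Set.Icc 0 L) : σ t ∈ A := by
  have hne : A.Nonempty := ⟨_, h0⟩
  have cont : ContinuousOn σ (Set.Icc 0 L) :=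
    (LipschitzOnWith.of_dist_le_mul (K := 1) fun s hs t ht => by
      rw [hσ s hs t ht, NNReal.coe_one, one_mul, Real.dist_eq]).continuousOn
  have key := le_max_of_midpoint_convex (ψ := fun t => Metric.infDist (σ t) A)
    ((Metric.continuous_infDist_pt A).comp_continuousOn cont) ?_ ht
  · simp only [Metric.infDist_zero_of_mem h0, Metric.infDist_zero_of_mem h1, max_self] at key
    exact (hA.mem_iff_infDist_zero hne).2 (le_antisymm key Metric.infDist_nonneg)
  · intro s hs t ht
    have hst : (s + t) / 2 ∈ Set.Icc 0 L := ⟨by linarith [hs.1, ht.1], by linarith [hs.2, ht.2]⟩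
    rw [hX.mid_of_dist hσ hs ht hst]
    apply le_of_forall_pos_le_add
    intro ε hε
    obtain ⟨a, ha, ha'⟩ := (Metric.infDist_lt_iff hne).1 (lt_add_of_pos_right
      (Metric.infDist (σ s) A) hε)
    obtain ⟨b, hb, hb'⟩ := (Metric.infDist_lt_iff hne).1 (lt_add_of_pos_right
      (Metric.infDist (σ t) A) hε)
    have := Metric.infDist_le_dist_of_mem (x := hX.mid (σ s) (σ t)) (hm a ha b hb)
    have := hX.dist_mid_mid (σ s) (σ t) a b
    linarith

/-- An unbounded closed convex subset of a proper CAT(0) space contains a ray. -/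
theorem IsCAT0.exists_ray_of_unbounded [ProperSpace X] (hX : IsCAT0 X) {A : Set X}
    (hA : IsClosed A) (hm : hX.MidClosed A) {x : X} (hx : x ∈ A)
    (hu : ¬ Bornology.IsBounded A) : ∃ c : Ray X, ∀ t, c.toFun t ∈ A := by
  have h1 : ∀ n : ℕ, ∃ a ∈ A, (n : ℝ) ≤ dist x a := by
    intro n
    by_contra! hcon
    refine hu (Metric.isBounded_closedBall (x := x) (r := n) |>.subset fun a ha => ?_)
    rw [Metric.mem_closedBall, dist_comm]
    exact (hcon a ha).le
  choose a haA ha using h1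
  choose σ hσ using fun n => hX.exists_geodesic x (a n)
  have hL : Tendsto (fun n => dist x (a n)) atTop atTop :=
    tendsto_atTop_mono ha tendsto_natCast_atTop_atTop
  obtain ⟨c, -, hc⟩ := exists_limit_ray σ _ hL (fun n => (hσ n).2.2) x fun n => (hσ n).1
  refine ⟨c, fun t => hA.mem_of_tendsto (hc t) ?_⟩
  filter_upwards [Nat.hyperfilter_le_atTop (hL.eventually_ge_atTop (t : ℝ))] with n hn
  refine hX.geodesic_mem hA hm (hσ n).2.2 ?_ ?_ ⟨t.2, hn⟩
  · rw [(hσ n).1]; exact hx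
  · rw [(hσ n).2.1]; exact haA n

/-- From every point of a closed convex set there is a ray inside the set asymptotic to a given
ray of the set. -/
theorem IsCAT0.exists_asymptotic_ray [ProperSpace X] (hX : IsCAT0 X) {A : Set X}
    (hA : IsClosed A) (hm : hX.MidClosed A) (c : Ray X) (hc : ∀ t, c.toFun t ∈ A) {x : X}
    (hx : x ∈ A) :
    ∃ c' : Ray X, c'.toFun 0 = x ∧ c'.endpoint = c.endpoint ∧ ∀ t, c'.toFun t ∈ A := by
  choose σ hσ using fun n : ℕ => hX.exists_geodesic x (c.toFun n)
  set D := dist x (c.toFun 0) with hD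
  have hL1 : ∀ n : ℕ, |dist x (c.toFun n) - n| ≤ D := by
    intro n
    have h := c.dist_eq 0 n
    rw [NNReal.coe_zero, zero_sub, abs_neg, NNReal.coe_natCast, Nat.abs_cast] at h
    rw [abs_le]
    constructor
    · linarith [dist_triangle (c.toFun 0) x (c.toFun n), dist_comm x (c.toFun 0)]
    · linarith [dist_triangle x (c.toFun 0) (c.toFun n)]
  have hL : Tendsto (fun n : ℕ => dist x (c.toFun n)) atTop atTop := by
    apply tendsto_atTop_mono (f := fun n : ℕ => (n : ℝ) - D)
    · intro n; linarith [(abs_le.1 (hL1 n)).1]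
    · exact tendsto_atTop_add_const_right _ _ tendsto_natCast_atTop_atTop
  obtain ⟨c', hc0, hc'⟩ := exists_limit_ray σ _ hL (fun n => (hσ n).2.2) x fun n => (hσ n).1
  refine ⟨c', hc0, ?_, fun t => ?_⟩
  · rw [endpoint_eq_iff]
    refine ⟨3 * D, fun t => ?_⟩
    refine le_of_tendsto ((hc' t).dist tendsto_const_nhds) ?_
    have ev : ∀ᶠ n : ℕ in atTop, (t : ℝ) + D ≤ n :=
      tendsto_natCast_atTop_atTop.eventually_ge_atTop _
    filter_upwards [Nat.hyperfilter_le_atTop ev] with n hn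
    set ℓ := dist x (c.toFun n) with hℓ
    obtain ⟨g1, g2⟩ := abs_le.1 (hL1 n)
    have hD0 : 0 ≤ D := dist_nonneg
    have ht0 : (0 : ℝ) ≤ t := t.2
    -- Early times are settled by the triangle inequality; for `D ≤ t` the time `n - t` does not
    -- exceed `m` below, so both reversed segments are defined there.
    rcases le_total (t : ℝ) D with htD | htD
    · have a1 := hL1 n
      have a2 : dist (σ n t) x = t := by
        have := (hσ n).2.2 t ⟨ht0, by linarith⟩ 0 ⟨le_rfl, dist_nonneg⟩
        rw [(hσ n).1, sub_zero, abs_of_nonneg ht0] at this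
        exact this
      have a3 : dist (c.toFun 0) (c.toFun t) = t := by
        rw [c.dist_eq]; simp
      linarith [dist_triangle4 (σ n t) x (c.toFun 0) (c.toFun t)]
    set m := min ℓ n with hmdef
    have hmℓ : m ≤ ℓ := min_le_left _ _
    have hmn : m ≤ n := min_le_right _ _
    have hm1 : (n : ℝ) - D ≤ m := le_min (by linarith) (by linarith)
    have hm2 : ℓ - D ≤ m := le_min (by linarith) (by linarith)
    let cr : ℝ → X := fun s => c.toFun s.toNNReal
    have hcr : ∀ s t, 0 ≤ s → 0 ≤ t → dist (cr s) (cr t) = |s - t| := by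
      intro s t hs ht
      simp only [cr]
      rw [c.dist_eq, Real.coe_toNNReal _ hs, Real.coe_toNNReal _ ht]
    have hσn := (hσ n).2.2
    -- Both segments are run backwards from their common end `c n`. Their lengths `ℓ` and `n` differ
    -- by at most `D`, so after time `m` they are within `2 * D`; the shift in parametrization costs
    -- another `D`.
    have key := hX.dist_geodesics_le (σ := fun s => σ n (ℓ - s)) (τ := fun s => cr (n - s))
      (L := m) (t := n - t) ?_ ?_ ⟨by linarith, by linarith⟩
    · simp only [sub_zero] at key
      rw [(hσ n).2.1] at key
      have e0 : cr n = c.toFun n := by simp only [cr]; congr; exact Real.toNNReal_natCast n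
      rw [e0, dist_self] at key
      have e1 : cr ((n : ℝ) - (n - t)) = c.toFun t := by
        simp only [cr]
        rw [show (n : ℝ) - (n - t) = t by ring, Real.toNNReal_coe]
      rw [e1] at key
      have k1 : dist (σ n (ℓ - m)) (cr (n - m)) ≤ 2 * D := by
        have a1 : dist (σ n (ℓ - m)) x = ℓ - m := by
          have := hσn (ℓ - m) ⟨by linarith, by linarith⟩ 0 ⟨le_rfl, dist_nonneg⟩
          rw [(hσ n).1, sub_zero, abs_of_nonneg (by linarith)] at this
          exact this
        have a2 : dist (c.toFun 0) (cr (n - m)) = n - m := by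
          have := hcr 0 (n - m) le_rfl (by linarith)
          rw [zero_sub, abs_neg, abs_of_nonneg (by linarith)] at this
          simpa [cr] using this
        have a3 := dist_triangle4 (σ n (ℓ - m)) x (c.toFun 0) (cr (n - m))
        have a4 : (ℓ - m) + (n - m) ≤ D := by
          rcases min_choice ℓ (n : ℝ) with h | h <;> rw [← hmdef] at h <;> linarith
        linarith
      have k2 : dist (σ n t) (σ n (ℓ - (n - t))) ≤ D := by
        rw [hσn t ⟨ht0, by linarith⟩ _ ⟨by linarith, by linarith⟩,
          show (t : ℝ) - (ℓ - (n - t)) = -(ℓ - n) by ring, abs_neg]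
        exact hL1 n
      have k3 := dist_triangle (σ n t) (σ n (ℓ - (n - t))) (c.toFun t)
      have k4 := key.trans (max_le (by linarith) k1)
      linarith
    · intro s hs t ht
      rw [hσn _ ⟨by linarith [hs.2], by linarith [hs.1]⟩ _ ⟨by linarith [ht.2], by linarith [ht.1]⟩,
        show ℓ - s - (ℓ - t) = -(s - t) by ring, abs_neg]
    · intro s hs t ht
      rw [hcr _ _ (by linarith [hs.2]) (by linarith [ht.2]),
        show (n : ℝ) - s - (n - t) = -(s - t) by ring, abs_neg]
  · refine hA.mem_of_tendsto (hc' t) ?_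
    filter_upwards [Nat.hyperfilter_le_atTop (hL.eventually_ge_atTop (t : ℝ))] with n hn
    refine hX.geodesic_mem hA hm (hσ n).2.2 ?_ ?_ ⟨t.2, hn⟩
    · rw [(hσ n).1]; exact hx
    · rw [(hσ n).2.1]; exact hc n

theorem IsCAT0.exists_ray_to [ProperSpace X] (hX : IsCAT0 X) (x : X) (ξ : Boundary X) :
    ∃ c : Ray X, c.toFun 0 = x ∧ c.endpoint = ξ := by
  obtain ⟨c, rfl⟩ := exists_rep ξ
  obtain ⟨c', h0, h1, -⟩ := hX.exists_asymptotic_ray isClosed_univ (fun _ _ _ _ => Set.mem_univ _)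
    c (fun _ => Set.mem_univ _) (Set.mem_univ x)
  exact ⟨c', h0, h1⟩

/-- A sequence going to infinity along which every group element has bounded displacement
accumulates at a fixed point at infinity. -/
theorem IsCAT0.exists_fixed_of_bounded_displacement [ProperSpace X] (hX : IsCAT0 X)
    {M : Type*} [Group M] [MulAction M X] [IsIsometricSMul M X] (x₀ : X) (x : ℕ → X)
    (hx : Tendsto (fun n => dist x₀ (x n)) atTop atTop)
    (hM : ∀ g : M, ∃ K, ∀ n, dist (g • x n) (x n) ≤ K) :
    ∃ ξ : Boundary X, ∀ g : M, g • ξ = ξ := by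
  choose σ hσ using fun n : ℕ => hX.exists_geodesic x₀ (x n)
  obtain ⟨c, -, hc⟩ := exists_limit_ray σ _ hx (fun n => (hσ n).2.2) x₀ fun n => (hσ n).1
  refine ⟨c.endpoint, fun g => ?_⟩
  obtain ⟨K, hK⟩ := hM g
  rw [smul_endpoint, endpoint_eq_iff]
  refine ⟨max (dist (g • x₀) x₀) K, fun t => ?_⟩
  refine le_of_tendsto (((hc t).const_smul g).dist (hc t)) ?_
  filter_upwards [Nat.hyperfilter_le_atTop (hx.eventually_ge_atTop (t : ℝ))] with n hn
  -- A segment and its translate by `g` have ends at bounded distance, so by convexity they stay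
  -- close all along, uniformly in `n`.
  refine (hX.dist_geodesics_le (σ := fun s => g • σ n s) (τ := σ n) ?_ (hσ n).2.2
    ⟨t.2, hn⟩).trans ?_
  · intro s hs t ht
    rw [dist_smul]; exact (hσ n).2.2 s hs t ht
  · simp only [(hσ n).1, (hσ n).2.1]
    exact max_le_max le_rfl (hK n)

theorem isOpen_coneNhd (c : Ray X) (r : ℝ≥0) {ε : ℝ} (hε : 0 < ε) : IsOpen (coneNhd c r ε) :=
  TopologicalSpace.isOpen_generateFrom_of_mem ⟨c, r, ε, hε, rfl⟩

theorem mem_coneNhd_self (c : Ray X) (r : ℝ≥0) {ε : ℝ} (hε : 0 < ε) :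
    c.endpoint ∈ coneNhd c r ε := ⟨c, rfl, rfl, by simpa using hε⟩

theorem IsCAT0.isClosed_singleton_boundary [ProperSpace X] [Nonempty X] (hX : IsCAT0 X)
    (ξ : Boundary X) : IsClosed ({ξ} : Set (Boundary X)) := by
  rw [← isOpen_compl_iff, isOpen_iff_forall_mem_open]
  intro η hη
  obtain ⟨x⟩ := ‹Nonempty X›
  obtain ⟨c, c0, rfl⟩ := hX.exists_ray_to x ξ
  obtain ⟨c', c0', rfl⟩ := hX.exists_ray_to x η
  have hne : ∃ r, c'.toFun r ≠ c.toFun r := by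
    by_contra! hcon
    exact hη (congrArg Ray.endpoint (Ray.ext_toFun hcon))
  obtain ⟨r, hr⟩ := hne
  have hpos := dist_pos.2 hr
  refine ⟨coneNhd c' r _, ?_, isOpen_coneNhd c' r hpos, mem_coneNhd_self c' r hpos⟩
  rintro _ ⟨c₁, rfl, h0, hd⟩ hc₁
  have := hX.ray_unique (c := c₁) (c' := c) hc₁ (by rw [h0, c0, c0'])
  subst this
  rw [dist_comm] at hd
  exact lt_irrefl _ hd

end Rays

/-! ### Boundary of a closed convex set and the induced action. -/

section BoundaryAction

open Filter Topology

variable {X : Type*} [MetricSpace X]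

/-- The points at infinity of the rays contained in `A`. -/
def boundaryOf (A : Set X) : Set (Boundary X) :=
  {ξ | ∃ c : Ray X, (∀ t, c.toFun t ∈ A) ∧ c.endpoint = ξ}

theorem IsCAT0.ray_mem_of_endpoint_mem [ProperSpace X] (hX : IsCAT0 X) {A : Set X}
    (hA : IsClosed A) (hm : hX.MidClosed A) {c : Ray X} (h : c.endpoint ∈ boundaryOf A)
    (h0 : c.toFun 0 ∈ A) (t : ℝ≥0) : c.toFun t ∈ A := by
  obtain ⟨c₁, h1, h2⟩ := h
  obtain ⟨c₂, g0, g1, g2⟩ := hX.exists_asymptotic_ray hA hm c₁ h1 h0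
  rw [hX.ray_unique (c := c) (c' := c₂) (by rw [g1, h2]) g0.symm]
  exact g2 t

theorem IsCAT0.isClosed_boundaryOf [ProperSpace X] (hX : IsCAT0 X) {A : Set X}
    (hA : IsClosed A) (hm : hX.MidClosed A) (hne : A.Nonempty) : IsClosed (boundaryOf A) := by
  rw [← isOpen_compl_iff, isOpen_iff_forall_mem_open]
  intro ξ hξ
  obtain ⟨x, hx⟩ := hne
  obtain ⟨c, c0, rfl⟩ := hX.exists_ray_to x ξ
  have hne : ∃ r, c.toFun r ∉ A := by
    by_contra! hcon
    exact hξ ⟨c, hcon, rfl⟩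
  obtain ⟨r, hr⟩ := hne
  obtain ⟨ε, hε, hball⟩ := Metric.isOpen_iff.1 hA.isOpen_compl _ hr
  refine ⟨coneNhd c r ε, ?_, isOpen_coneNhd c r hε, mem_coneNhd_self c r hε⟩
  rintro _ ⟨c₁, rfl, h0, hd⟩ hc₁
  exact hball hd (hX.ray_mem_of_endpoint_mem hA hm hc₁ (by rw [h0, c0]; exact hx) r)

variable {H M : Type*} [Group H] [MulAction H M] {e : M → X}

/-- `c'` is the translate by `h` of the ray `c` contained in the range of `e`. -/
def IsTranslate (e : M → X) (h : H) (c c' : Ray X) : Prop :=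
  ∀ t m, e m = c.toFun t → c'.toFun t = e (h • m)

/-- A point of the range may have several preimages under `e`; `hiso` makes `e (h • m)` depend only
on `e m`. -/
theorem exists_isTranslate
    (hiso : ∀ (h : H) (m m' : M), dist (e (h • m)) (e (h • m')) = dist (e m) (e m'))
    (h : H) {c : Ray X} (hc : ∀ t, c.toFun t ∈ Set.range e) :
    ∃ c' : Ray X, IsTranslate e h c c' ∧ ∀ t, c'.toFun t ∈ Set.range e := by
  choose m hm using hc
  refine ⟨⟨fun t => e (h • m t), Isometry.of_dist_eq fun s t => ?_⟩, ?_, fun t => ⟨_, rfl⟩⟩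
  · rw [hiso, hm, hm, c.isometry.dist_eq]
  · intro t m' hm'
    rw [← dist_le_zero]
    simp only
    rw [hiso, hm, hm', dist_self]

theorem IsTranslate.dist_eq
    (hiso : ∀ (h : H) (m m' : M), dist (e (h • m)) (e (h • m')) = dist (e m) (e m'))
    {h : H} {c₁ c₁' c₂ c₂' : Ray X} (h₁ : IsTranslate e h c₁ c₁') (h₂ : IsTranslate e h c₂ c₂')
    (hc₁ : ∀ t, c₁.toFun t ∈ Set.range e) (hc₂ : ∀ t, c₂.toFun t ∈ Set.range e) (t : ℝ≥0) :
    dist (c₁'.toFun t) (c₂'.toFun t) = dist (c₁.toFun t) (c₂.toFun t) := by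
  obtain ⟨m₁, hm₁⟩ := hc₁ t
  obtain ⟨m₂, hm₂⟩ := hc₂ t
  rw [h₁ t m₁ hm₁, h₂ t m₂ hm₂, hiso, hm₁, hm₂]

theorem IsTranslate.endpoint_eq
    (hiso : ∀ (h : H) (m m' : M), dist (e (h • m)) (e (h • m')) = dist (e m) (e m'))
    {h : H} {c₁ c₁' c₂ c₂' : Ray X} (h₁ : IsTranslate e h c₁ c₁') (h₂ : IsTranslate e h c₂ c₂')
    (hc₁ : ∀ t, c₁.toFun t ∈ Set.range e) (hc₂ : ∀ t, c₂.toFun t ∈ Set.range e)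
    (he : c₁.endpoint = c₂.endpoint) : c₁'.endpoint = c₂'.endpoint := by
  rw [endpoint_eq_iff] at he ⊢
  obtain ⟨K, hK⟩ := he
  exact ⟨K, fun t => (h₁.dist_eq hiso h₂ hc₁ hc₂ t).trans_le (hK t)⟩

theorem exists_translate_boundary
    (hiso : ∀ (h : H) (m m' : M), dist (e (h • m)) (e (h • m')) = dist (e m) (e m'))
    (h : H) (ξ : boundaryOf (Set.range e)) : ∃ η : boundaryOf (Set.range e),
      ∀ c c' : Ray X, (∀ t, c.toFun t ∈ Set.range e) → c.endpoint = ξ → IsTranslate e h c c' →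
        c'.endpoint = η := by
  obtain ⟨c, hc, hξ⟩ := ξ.2
  obtain ⟨c', hc', hm⟩ := exists_isTranslate hiso h hc
  refine ⟨⟨c'.endpoint, c', hm, rfl⟩, fun c₁ c₁' h1 h2 h3 => ?_⟩
  exact h3.endpoint_eq hiso hc' h1 hc (h2.trans hξ.symm)

/-- The action on the boundary of the range of `e` induced by an isometric action. -/
@[reducible] noncomputable def boundaryOfMulAction
    (hiso : ∀ (h : H) (m m' : M), dist (e (h • m)) (e (h • m')) = dist (e m) (e m')) :
    MulAction H (boundaryOf (Set.range e)) where
  smul h ξ := (exists_translate_boundary hiso h ξ).choose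
  one_smul ξ := by
    obtain ⟨c, hc, hξ⟩ := ξ.2
    have := (exists_translate_boundary hiso (1 : H) ξ).choose_spec c c hc hξ
      fun t m hm => by rw [one_smul, hm]
    exact Subtype.ext (this.symm.trans hξ)
  mul_smul h h' ξ := by
    obtain ⟨c, hc, hξ⟩ := ξ.2
    obtain ⟨c₁, hc₁, hm₁⟩ := exists_isTranslate hiso h' hc
    obtain ⟨c₂, hc₂, hm₂⟩ := exists_isTranslate hiso h hm₁
    have e1 := (exists_translate_boundary hiso h' ξ).choose_spec c c₁ hc hξ hc₁
    have e2 := (exists_translate_boundary hiso h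
      (exists_translate_boundary hiso h' ξ).choose).choose_spec c₁ c₂ hm₁ e1 hc₂
    have e3 := (exists_translate_boundary hiso (h * h') ξ).choose_spec c c₂ hc hξ
      fun t m hm => by rw [mul_smul]; exact hc₂ t _ (hc₁ t m hm).symm
    exact Subtype.ext (e3.symm.trans e2)

/-- An isometric action on a closed convex subset that agrees with the action of `Γ` up to
bounded distance induces a continuous action on the boundary of that subset. -/
theorem IsCAT0.exists_boundary_action [ProperSpace X] (hX : IsCAT0 X) [TopologicalSpace H]
    {Γ : Type*} [Group Γ] [MulAction Γ X] [IsIsometricSMul Γ X] (p : Γ →* H)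
    (hiso : ∀ (h : H) (m m' : M), dist (e (h • m)) (e (h • m')) = dist (e m) (e m'))
    (hcl : IsClosed (Set.range e)) (hmid : hX.MidClosed (Set.range e))
    (hcont : ∀ m, Continuous fun h : H => e (h • m))
    (hunb : ¬ Bornology.IsBounded (Set.range e))
    (hp : ∀ γ : Γ, ∃ K, ∀ m, dist (γ • e m) (e (p γ • m)) ≤ K) :
    ∃ C : Set (Boundary X), C.Nonempty ∧ IsClosed C ∧ (∀ γ : Γ, ∀ ξ ∈ C, γ • ξ ∈ C) ∧
      ∃ ρ : H →* Equiv.Perm C, Continuous (fun q : H × C => ρ q.1 q.2) ∧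
        ∀ (γ : Γ) (ξ : C), (ρ (p γ) ξ : Boundary X) = γ • (ξ : Boundary X) := by
  have hne : (Set.range e).Nonempty := by
    by_contra h
    rw [Set.not_nonempty_iff_eq_empty] at h
    exact hunb (h ▸ Bornology.isBounded_empty)
  obtain ⟨_, m₀, rfl⟩ := hne
  let act : MulAction H (boundaryOf (Set.range e)) := boundaryOfMulAction hiso
  have hact : ∀ (h : H) (ξ : boundaryOf (Set.range e)) (c c' : Ray X),
      (∀ t, c.toFun t ∈ Set.range e) → c.endpoint = ξ → IsTranslate e h c c' →
        c'.endpoint = (h • ξ : boundaryOf (Set.range e)) := fun h ξ =>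
    (exists_translate_boundary hiso h ξ).choose_spec
  have hΓ : ∀ (γ : Γ) (ξ : boundaryOf (Set.range e)),
      ((p γ • ξ : boundaryOf (Set.range e)) : Boundary X) = γ • (ξ : Boundary X) := by
    intro γ ξ
    obtain ⟨c, hc, hξ⟩ := ξ.2
    obtain ⟨c', hc', -⟩ := exists_isTranslate hiso (p γ) hc
    rw [← hact (p γ) ξ c c' hc hξ hc', ← hξ, smul_endpoint, endpoint_eq_iff]
    obtain ⟨K, hK⟩ := hp γ
    refine ⟨K, fun t => ?_⟩
    obtain ⟨m, hm⟩ := hc t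
    rw [hc' t m hm, dist_comm]
    refine le_trans (le_of_eq ?_) (hK m)
    rw [hm]; rfl
  refine ⟨boundaryOf (Set.range e), ?_, hX.isClosed_boundaryOf hcl hmid ⟨_, m₀, rfl⟩, ?_,
    MulAction.toPermHom H _, ?_, hΓ⟩
  · obtain ⟨c, hc⟩ := hX.exists_ray_of_unbounded hcl hmid ⟨m₀, rfl⟩ hunb
    exact ⟨c.endpoint, c, hc, rfl⟩
  · intro γ ξ hξ
    rw [← hΓ γ ⟨ξ, hξ⟩]
    exact Subtype.coe_prop _
  -- Continuity is tested on all sets `U(c, r, ε)`; the origin of `c` need not lie in the range of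
  -- `e`, so rays from `e m₀` must be compared with rays from `c 0`.
  rw [Topology.IsEmbedding.subtypeVal.continuous_iff, continuous_generateFrom_iff]
  rintro _ ⟨c, r, ε, hε, rfl⟩
  rw [isOpen_iff_mem_nhds]
  rintro ⟨h₀, ξ₀⟩ ⟨c', hc'e, hc'0, hc'd⟩
  have hc'e : c'.endpoint = (h₀ • ξ₀ : boundaryOf (Set.range e)) := hc'e
  obtain ⟨c₀, c₀0, c₀e⟩ := hX.exists_ray_to (e m₀) (ξ₀ : Boundary X)
  have c₀A := hX.ray_mem_of_endpoint_mem hcl hmid (c := c₀) (c₀e ▸ ξ₀.2) (c₀0 ▸ ⟨m₀, rfl⟩)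
  obtain ⟨d₀, hd₀, d₀A⟩ := exists_isTranslate hiso h₀ c₀A
  have d₀e := hact h₀ ξ₀ c₀ d₀ c₀A c₀e hd₀
  have d₀0 : d₀.toFun 0 = e (h₀ • m₀) := hd₀ 0 m₀ c₀0.symm
  set D := dist (e (h₀ • m₀)) (c.toFun 0) with hD
  -- It suffices that the rays from `c 0` be within `2 * D + 1` at the late time `T = 2 ^ n * r`.
  -- Each change of origin costs `D`, and the `1` is three errors of `1 / 3`: moving `m₀`, moving
  -- `mT`, and moving `ξ`.
  obtain ⟨n, hn⟩ : ∃ n : ℕ, (1 / 2 : ℝ) ^ n * (2 * D + 1) < ε - dist (c'.toFun r) (c.toFun r) := by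
    have lim : Tendsto (fun n : ℕ => (1 / 2 : ℝ) ^ n * (2 * D + 1)) atTop
        (𝓝 (0 * (2 * D + 1))) :=
      (tendsto_pow_atTop_nhds_zero_of_lt_one (by norm_num) (by norm_num)).mul_const _
    rw [zero_mul] at lim
    exact (lim.eventually_lt_const (by linarith)).exists
  set T := 2 ^ n * r with hT
  obtain ⟨mT, hmT⟩ := c₀A T
  have n1 : ∀ m : M, {h : H | dist (e (h • m)) (e (h₀ • m)) < 1 / 3} ∈ 𝓝 h₀ := fun m =>
    (isOpen_lt ((hcont m).dist continuous_const) continuous_const).mem_nhds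
      (by simp)
  have n2 : {ξ : boundaryOf (Set.range e) | (ξ : Boundary X) ∈ coneNhd c₀ T (1 / 3)} ∈ 𝓝 ξ₀ :=
    ((isOpen_coneNhd c₀ T (by norm_num)).preimage continuous_subtype_val).mem_nhds
      (by
        have := mem_coneNhd_self c₀ T (ε := 1 / 3) (by norm_num)
        rw [c₀e] at this
        exact this)
  refine mem_of_superset (prod_mem_nhds (inter_mem (n1 m₀) (n1 mT)) n2) ?_
  rintro ⟨h, ξ⟩ ⟨⟨q1, q2⟩, ⟨c₁, c₁e, c₁0, c₁d⟩⟩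
  simp only [Set.mem_ofPred_eq] at q1 q2
  have c₁A := hX.ray_mem_of_endpoint_mem hcl hmid (c := c₁) (c₁e ▸ ξ.2)
    (by rw [c₁0, c₀0]; exact ⟨m₀, rfl⟩)
  obtain ⟨d₁, hd₁, d₁A⟩ := exists_isTranslate hiso h c₁A
  have d₁e := hact h ξ c₁ d₁ c₁A c₁e hd₁
  have d₁0 : d₁.toFun 0 = e (h • m₀) := hd₁ 0 m₀ (by rw [c₁0, c₀0])
  obtain ⟨c'', c''0, c''e⟩ := hX.exists_ray_to (c.toFun 0)
    ((h • ξ : boundaryOf (Set.range e)) : Boundary X)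
  refine ⟨c'', c''e, c''0, ?_⟩
  have k1 := hX.dist_le_of_asymptotic (endpoint_eq_iff.1 (c''e.trans d₁e.symm)) T
  have k2 := hX.dist_le_of_asymptotic (endpoint_eq_iff.1 (d₀e.trans hc'e.symm)) T
  rw [c''0, d₁0] at k1
  rw [d₀0, hc'0] at k2
  have k3 : dist (d₁.toFun T) (e (h • mT)) < 1 / 3 := by
    obtain ⟨m₁, hm₁⟩ := c₁A T
    rw [hd₁ T m₁ hm₁, hiso, hm₁, hmT]
    exact c₁d
  have k4 : d₀.toFun T = e (h₀ • mT) := hd₀ T mT hmT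
  rw [← k4] at q2
  have k5 := dist_triangle (c.toFun 0) (e (h₀ • m₀)) (e (h • m₀))
  rw [dist_comm (c.toFun 0) (e (h₀ • m₀)), dist_comm (e (h₀ • m₀)) (e (h • m₀))] at k5
  have k6 : dist (c''.toFun T) (c'.toFun T) ≤ 2 * D + 1 := by
    have a1 := dist_triangle4 (c''.toFun T) (d₁.toFun T) (e (h • mT)) (d₀.toFun T)
    have a2 := dist_triangle (c''.toFun T) (d₀.toFun T) (c'.toFun T)
    linarith
  have k7 := hX.dist_ray_le (c := c'') (c' := c') (by rw [c''0, hc'0]) r n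
  have k8 : (1 / 2 : ℝ) ^ n * dist (c''.toFun T) (c'.toFun T) ≤ (1 / 2) ^ n * (2 * D + 1) :=
    mul_le_mul_of_nonneg_left k6 (by positivity)
  have k9 := dist_triangle (c''.toFun r) (c'.toFun r) (c.toFun r)
  linarith

end BoundaryAction

/-! ### Barycenters of probability densities. -/

section Barycenter

open Filter Topology MeasureTheory

variable {X : Type*} [MetricSpace X]

/-- Continuous functions on a CAT(0) space that are as convex as the square of a distance. -/
structure IsCAT0.Quadratic (hX : IsCAT0 X) (F : X → ℝ) : Prop where
  continuous : Continuous F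
  coercive : ∃ (o : X) (a : ℝ), ∀ x, dist o x ^ 2 / 2 ≤ F x + a
  convex : ∀ x y, F (hX.mid x y) ≤ (F x + F y) / 2 - dist x y ^ 2 / 4

/-- A point where `F` is minimal, if there is one. -/
noncomputable def argmin [Nonempty X] (F : X → ℝ) : X :=
  Classical.epsilon fun b => ∀ x, F b ≤ F x

theorem IsCAT0.Quadratic.exists_min [ProperSpace X] {hX : IsCAT0 X} {F : X → ℝ}
    (hF : hX.Quadratic F) : ∃ b, ∀ x, F b ≤ F x := by
  obtain ⟨o, a, h⟩ := hF.coercive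
  -- The radius is such that coercivity makes `F` larger than `F o` outside the ball.
  set r := 2 * (|F o + a| + 1) with hr
  have hpos : 0 ≤ |F o + a| := abs_nonneg _
  obtain ⟨b, hb, hmin⟩ := (isCompact_closedBall o r).exists_isMinOn
    ⟨o, Metric.mem_closedBall_self (by positivity)⟩ hF.continuous.continuousOn
  refine ⟨b, fun x => ?_⟩
  by_cases hx : x ∈ Metric.closedBall o r
  · exact hmin hx
  · have h1 : F b ≤ F o := hmin (Metric.mem_closedBall_self (by positivity))
    rw [Metric.mem_closedBall, not_le, dist_comm] at hx
    have h2 := h x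
    have h3 : r ^ 2 ≤ dist o x ^ 2 := pow_le_pow_left₀ (by positivity) hx.le 2
    have h4 := le_abs_self (F o + a)
    nlinarith

theorem IsCAT0.Quadratic.argmin_le [ProperSpace X] [Nonempty X] {hX : IsCAT0 X} {F : X → ℝ}
    (hF : hX.Quadratic F) (x : X) : F (argmin F) ≤ F x :=
  Classical.epsilon_spec (p := fun b => ∀ x, F b ≤ F x) hF.exists_min x

/-- The variance inequality. -/
theorem IsCAT0.Quadratic.variance [ProperSpace X] [Nonempty X] {hX : IsCAT0 X} {F : X → ℝ}
    (hF : hX.Quadratic F) (z : X) : F (argmin F) + dist (argmin F) z ^ 2 ≤ F z := by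
  set b := argmin F
  -- A bound with coefficient `κ`, applied at the midpoint of `b` and `z`, yields by convexity the
  -- coefficient `(1 + κ) / 2`.
  have key : ∀ n : ℕ, ∀ z, F b + (1 - (1 / 2) ^ n) * dist b z ^ 2 ≤ F z := by
    intro n
    induction n with
    | zero => intro z; simpa using hF.argmin_le z
    | succ n ih =>
      intro z
      have h1 := ih (hX.mid b z)
      have h2 := hF.convex b z
      rw [dist_comm b (hX.mid b z), hX.dist_mid_left] at h1
      rw [pow_succ]
      nlinarith
  have lim : Tendsto (fun n : ℕ => F b + (1 - (1 / 2 : ℝ) ^ n) * dist b z ^ 2) atTop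
      (𝓝 (F b + (1 - 0) * dist b z ^ 2)) :=
    (((tendsto_pow_atTop_nhds_zero_of_lt_one (by norm_num) (by norm_num)).const_sub
      1).mul_const _).const_add _
  have := le_of_tendsto' lim fun n => key n z
  linarith

theorem IsCAT0.Quadratic.eq_argmin [ProperSpace X] [Nonempty X] {hX : IsCAT0 X} {F : X → ℝ}
    (hF : hX.Quadratic F) {b : X} (hb : ∀ x, F b ≤ F x) : b = argmin F := by
  have h1 := hF.variance b
  have h2 := hb (argmin F)
  have h3 : dist (argmin F) b ^ 2 ≤ 0 := by linarith
  have h4 : dist (argmin F) b = 0 :=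
    (pow_eq_zero_iff two_ne_zero).1 (le_antisymm h3 (sq_nonneg _))
  exact (dist_eq_zero.1 h4).symm

variable {Ω : Type*} [MeasurableSpace Ω] {μ : Measure Ω}

/-- A probability density together with a map into `X` with finite second moments. -/
structure BaryData (μ : Measure Ω) (ρ : Ω → ℝ) (p : Ω → X) : Prop where
  nonneg : ∀ ω, 0 ≤ ρ ω
  integral_eq_one : ∫ ω, ρ ω ∂μ = 1
  integrable_sq : ∀ x, Integrable (fun ω => ρ ω * dist (p ω) x ^ 2) μ

/-- The barycenter of the image of the probability measure `ρ μ` under `p`. -/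
noncomputable def bary [Nonempty X] (μ : Measure Ω) (ρ : Ω → ℝ) (p : Ω → X) : X :=
  argmin fun x => ∫ ω, ρ ω * dist (p ω) x ^ 2 ∂μ

theorem BaryData.integrable {ρ : Ω → ℝ} {p : Ω → X} (h : BaryData μ ρ p) : Integrable ρ μ := by
  by_contra hcon
  have := h.integral_eq_one
  rw [integral_undef hcon] at this
  exact zero_ne_one this

theorem sq_dist_le_two_mul (a b c : X) : dist a c ^ 2 ≤ 2 * dist a b ^ 2 + 2 * dist b c ^ 2 := by
  have h := pow_le_pow_left₀ dist_nonneg (dist_triangle a b c) 2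
  nlinarith [sq_nonneg (dist a b - dist b c)]

theorem BaryData.quadratic (hX : IsCAT0 X) [Nonempty X] {ρ : Ω → ℝ} {p : Ω → X}
    (h : BaryData μ ρ p) :
    hX.Quadratic fun x => ∫ ω, ρ ω * dist (p ω) x ^ 2 ∂μ where
  continuous := by
    rw [continuous_iff_continuousAt]
    intro x₀
    refine continuousAt_of_dominated (bound := fun ω => 2 * (ρ ω * dist (p ω) x₀ ^ 2) + 2 * ρ ω)
      (Eventually.of_forall fun x => (h.integrable_sq x).aestronglyMeasurable) ?_
      (((h.integrable_sq x₀).const_mul 2).add (h.integrable.const_mul 2)) ?_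
    · filter_upwards [Metric.ball_mem_nhds x₀ one_pos] with x hx
      refine Eventually.of_forall fun ω => ?_
      rw [Real.norm_of_nonneg (mul_nonneg (h.nonneg ω) (sq_nonneg _))]
      have h1 := sq_dist_le_two_mul (p ω) x₀ x
      rw [Metric.mem_ball, dist_comm] at hx
      have h2 : dist x₀ x ^ 2 ≤ 1 := pow_le_one₀ dist_nonneg hx.le
      have h3 : dist (p ω) x ^ 2 ≤ 2 * dist (p ω) x₀ ^ 2 + 2 := by linarith
      have := mul_le_mul_of_nonneg_left h3 (h.nonneg ω)
      linarith
    · refine Eventually.of_forall fun ω => ?_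
      exact (continuous_const.mul ((continuous_const.dist continuous_id).pow 2)).continuousAt
  coercive := by
    obtain ⟨o⟩ := ‹Nonempty X›
    refine ⟨o, ∫ ω, ρ ω * dist (p ω) o ^ 2 ∂μ, fun x => ?_⟩
    rw [← integral_add (h.integrable_sq x) (h.integrable_sq o)]
    calc dist o x ^ 2 / 2 = ∫ ω, ρ ω * (dist o x ^ 2 / 2) ∂μ := by
          rw [integral_mul_const, h.integral_eq_one, one_mul]
      _ ≤ _ := by
          refine integral_mono (h.integrable.mul_const _)
            ((h.integrable_sq x).add (h.integrable_sq o)) fun ω => ?_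
          have h1 := sq_dist_le_two_mul o (p ω) x
          rw [dist_comm o (p ω)] at h1
          have h2 : dist o x ^ 2 / 2 ≤ dist (p ω) x ^ 2 + dist (p ω) o ^ 2 := by linarith
          have := mul_le_mul_of_nonneg_left h2 (h.nonneg ω)
          simp only
          linarith
  convex x y := by
    calc _ ≤ ∫ ω, ((ρ ω * dist (p ω) x ^ 2 + ρ ω * dist (p ω) y ^ 2) / 2
            - ρ ω * (dist x y ^ 2 / 4)) ∂μ := by
          refine integral_mono (h.integrable_sq _) ((((h.integrable_sq x).add
            (h.integrable_sq y)).div_const 2).sub (h.integrable.mul_const _)) fun ω => ?_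
          have h1 := hX.cn_mid x y (p ω)
          rw [dist_comm, dist_comm x (p ω), dist_comm y (p ω)] at h1
          have := mul_le_mul_of_nonneg_left h1 (h.nonneg ω)
          simp only
          linarith
      _ = _ := by
          have hi : Integrable (fun ω => (ρ ω * dist (p ω) x ^ 2 + ρ ω * dist (p ω) y ^ 2) / 2) μ :=
            ((h.integrable_sq x).add (h.integrable_sq y)).div_const 2
          rw [integral_sub hi (h.integrable.mul_const _), integral_div, integral_add (h.integrable_sq x)
            (h.integrable_sq y), integral_mul_const, h.integral_eq_one, one_mul]

variable [ProperSpace X] [Nonempty X]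

theorem IsCAT0.bary_variance (hX : IsCAT0 X) {ρ : Ω → ℝ} {p : Ω → X} (h : BaryData μ ρ p)
    (z : X) : (∫ ω, ρ ω * dist (p ω) (bary μ ρ p) ^ 2 ∂μ) + dist (bary μ ρ p) z ^ 2 ≤
      ∫ ω, ρ ω * dist (p ω) z ^ 2 ∂μ :=
  (h.quadratic hX).variance z

theorem IsCAT0.sq_dist_bary_le (hX : IsCAT0 X) {ρ : Ω → ℝ} {p : Ω → X} (h : BaryData μ ρ p)
    (z : X) : dist (bary μ ρ p) z ^ 2 ≤ ∫ ω, ρ ω * dist (p ω) z ^ 2 ∂μ := by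
  have h1 := hX.bary_variance h z
  have h2 : 0 ≤ ∫ ω, ρ ω * dist (p ω) (bary μ ρ p) ^ 2 ∂μ :=
    integral_nonneg fun ω => mul_nonneg (h.nonneg ω) (sq_nonneg _)
  linarith

/-- Barycenters depend on the points in a non-expansive way. -/
theorem IsCAT0.sq_dist_bary_bary_le (hX : IsCAT0 X) {ρ : Ω → ℝ} {p p' : Ω → X}
    (h : BaryData μ ρ p) (h' : BaryData μ ρ p')
    (hi : Integrable (fun ω => ρ ω * dist (p ω) (p' ω) ^ 2) μ) :
    dist (bary μ ρ p) (bary μ ρ p') ^ 2 ≤ ∫ ω, ρ ω * dist (p ω) (p' ω) ^ 2 ∂μ := by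
  set b := bary μ ρ p with hb
  set b' := bary μ ρ p' with hb'
  have h1 := hX.bary_variance h b'
  have h2 := hX.bary_variance h' b
  rw [← hb] at h1
  rw [← hb', dist_comm b' b] at h2
  -- The two variance inequalities together gain `2 * d(b, b')²`, while the integrated quadruple
  -- inequality loses it only once.
  have h3 : (∫ ω, ρ ω * dist (p ω) b' ^ 2 ∂μ) + (∫ ω, ρ ω * dist (p' ω) b ^ 2 ∂μ) ≤
      (∫ ω, ρ ω * dist (p ω) b ^ 2 ∂μ) + (∫ ω, ρ ω * dist (p' ω) b' ^ 2 ∂μ)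
        + ((∫ ω, ρ ω * dist (p ω) (p' ω) ^ 2 ∂μ) + dist b b' ^ 2) := by
    have e : dist b b' ^ 2 = ∫ ω, ρ ω * dist b b' ^ 2 ∂μ := by
      rw [integral_mul_const, h.integral_eq_one, one_mul]
    rw [e]
    rw [← integral_add (h.integrable_sq _) (h'.integrable_sq _),
      ← integral_add (h.integrable_sq _) (h'.integrable_sq _),
      ← integral_add hi (h.integrable.mul_const _), ← integral_add]
    · refine integral_mono ((h.integrable_sq _).add (h'.integrable_sq _))
        (((h.integrable_sq _).add (h'.integrable_sq _)).add
          (hi.add (h.integrable.mul_const _))) fun ω => ?_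
      have k := hX.quadruple_sq (p ω) (p' ω) b b'
      have := mul_le_mul_of_nonneg_left k (h.nonneg ω)
      simp only
      linarith
    · exact (h.integrable_sq _).add (h'.integrable_sq _)
    · exact hi.add (h.integrable.mul_const _)
  linarith

end Barycenter

/-! ### Weights and means of `Γ`-invariant functions. -/

section Lattice

set_option linter.unusedSectionVars false

open Filter Topology MeasureTheory

variable {G : Type*} [Group G] [TopologicalSpace G] [IsTopologicalGroup G]

theorem IsUniformLattice.exists_compact [LocallyCompactSpace G] {Γ : Subgroup G}
    (hΓ : IsUniformLattice Γ) :
    ∃ F : Set G, IsCompact F ∧ ∀ g : G, ∃ γ : Γ, (γ : G) * g ∈ F := by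
  have := hΓ.cocompact
  choose K hK hmem using fun g : G => exists_compact_mem_nhds g
  obtain ⟨t, ht⟩ := isCompact_univ.elim_finite_subcover
    (fun g : G => (QuotientGroup.mk '' interior (K g) : Set (G ⧸ Γ)))
    (fun g => QuotientGroup.isOpenMap_coe _ isOpen_interior) (by
      intro q _
      obtain ⟨g, rfl⟩ := QuotientGroup.mk_surjective q
      exact Set.mem_iUnion.2 ⟨g, g, mem_interior_iff_mem_nhds.2 (hmem g), rfl⟩)
  -- The quotient consists of cosets `g Γ`, whereas the compact set has to meet every `Γ g`; hence
  -- the inverse.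
  refine ⟨(⋃ g ∈ t, K g)⁻¹, (t.finite_toSet.isCompact_biUnion fun g _ => hK g).inv, fun g => ?_⟩
  obtain ⟨a, hat, b, hb, hab⟩ := Set.mem_iUnion₂.1 (ht (Set.mem_univ (QuotientGroup.mk g⁻¹)))
  have h1 : b⁻¹ * g⁻¹ ∈ Γ := QuotientGroup.eq.1 hab
  refine ⟨⟨b⁻¹ * g⁻¹, h1⟩, ?_⟩
  simp only [inv_mul_cancel_right, Set.mem_inv, inv_inv]
  exact Set.mem_biUnion hat (interior_subset hb)

variable [T2Space G]

theorem IsUniformLattice.finite_setOf {Γ : Subgroup G} (hΓ : IsUniformLattice Γ) {A B : Set G}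
    (hA : IsCompact A) (hB : IsCompact B) : {γ : Γ | ∃ a ∈ A, (γ : G) * a ∈ B}.Finite := by
  have := hΓ.discrete
  have h1 := Subgroup.tendsto_coe_cofinite_of_discrete Γ ⟨this⟩
  have h2 := h1 (hB.mul hA.inv).compl_mem_cocompact
  rw [mem_map, mem_cofinite] at h2
  refine h2.subset ?_
  rintro γ ⟨a, ha, hb⟩
  simp only [Set.preimage_compl, compl_compl, Set.mem_preimage]
  exact ⟨γ * a, hb, a⁻¹, by simpa using ha, by group⟩

/-- A weight on `G` whose translates by `Γ` add up to one. -/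
structure IsWeight (Γ : Subgroup G) (w : G → ℝ) : Prop where
  continuous : Continuous w
  hasCompactSupport : HasCompactSupport w
  nonneg : ∀ g, 0 ≤ w g
  sum_eq_one : ∀ g, ∑ᶠ γ : Γ, w (γ * g) = 1

variable [LocallyCompactSpace G] {Γ : Subgroup G}

/-- There is a bump function that is `1` on a given compact set. -/
theorem exists_bump {K : Set G} (hK : IsCompact K) : ∃ u : G → ℝ, Continuous u ∧
    HasCompactSupport u ∧ (∀ g, 0 ≤ u g) ∧ (∀ g, u g ≤ 1) ∧ ∀ g ∈ K, u g = 1 := by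
  obtain ⟨f, h1, h2, -, h3⟩ := exists_continuousMap_one_of_isCompact_subset_isOpen hK isOpen_univ
    (Set.subset_univ _)
  exact ⟨f, f.continuous, h2, fun g => (h3 g).1, fun g => (h3 g).2, fun g hg => h1 hg⟩

theorem IsUniformLattice.locallyFinite (hΓ : IsUniformLattice Γ) {u : G → ℝ}
    (hu : HasCompactSupport u) :
    LocallyFinite fun γ : Γ => Function.support fun g => u ((γ : G) * g) := by
  intro g
  obtain ⟨K, hK, hg⟩ := exists_compact_mem_nhds g
  refine ⟨K, hg, (hΓ.finite_setOf hK hu).subset ?_⟩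
  rintro γ ⟨a, ha, haK⟩
  exact ⟨a, haK, subset_tsupport _ ha⟩

/-- A bump function equal to `1` on a compact set meeting every orbit, divided by the sum of its
`Γ`-translates. -/
theorem IsUniformLattice.exists_weight (hΓ : IsUniformLattice Γ) : ∃ w : G → ℝ, IsWeight Γ w := by
  obtain ⟨F, hF, hFΓ⟩ := hΓ.exists_compact
  obtain ⟨u, uc, us, u0, -, u1⟩ := exists_bump hF
  set U : G → ℝ := fun g => ∑ᶠ γ : Γ, u (γ * g) with hU
  have Uc : Continuous U :=
    continuous_finsum (fun γ : Γ => uc.comp (continuous_const.mul continuous_id))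
      (hΓ.locallyFinite us)
  have fin : ∀ g, (Function.support fun γ : Γ => u (γ * g)).Finite := fun g =>
    (hΓ.locallyFinite us).point_finite g
  have Upos : ∀ g, 0 < U g := by
    intro g
    obtain ⟨γ, hγ⟩ := hFΓ g
    have h1 : u (γ * g) ≤ U g := single_le_finsum γ (fin g) fun γ => u0 _
    rw [u1 _ hγ] at h1
    linarith
  have Uinv : ∀ (γ : Γ) g, U (γ * g) = U g := by
    intro γ g
    simp only [hU]
    rw [← finsum_comp_equiv (Equiv.mulRight γ) (f := fun δ : Γ => u (δ * g))]
    simp [mul_assoc]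
  refine ⟨fun g => u g / U g, uc.div Uc fun g => (Upos g).ne', ?_, fun g =>
    div_nonneg (u0 g) (Upos g).le, fun g => ?_⟩
  · simp only [div_eq_mul_inv]
    exact us.mul_right
  · simp only [Uinv]
    simp only [div_eq_mul_inv]
    rw [← finsum_mul]
    exact mul_inv_cancel₀ (Upos g).ne'

variable [MeasurableSpace G] [BorelSpace G] {m : Measure G} [m.IsHaarMeasure]
  {w : G → ℝ}

theorem IsWeight.exists_pos (hw : IsWeight Γ w) (g : G) : ∃ γ : Γ, 0 < w (γ * g) := by
  by_contra! hcon
  have h := hw.sum_eq_one g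
  have : ∀ γ : Γ, w (γ * g) = 0 := fun γ => le_antisymm (hcon γ) (hw.nonneg _)
  simp [this] at h

/-- Unfolding an integral over `G`. -/
theorem IsWeight.integral_eq (hw : IsWeight Γ w) {u φ : G → ℝ} (uc : Continuous u) (us : HasCompactSupport u)
    (φc : Continuous φ) (φΓ : ∀ (γ : Γ) g, φ (γ * g) = φ g) {T : Finset Γ}
    (hT : ∀ γ : Γ, (∃ a ∈ tsupport w, (γ : G) * a ∈ tsupport u) → γ ∈ T) :
    ∫ g, u g * φ g ∂m = ∫ g, (∑ γ ∈ T, u (γ * g)) * (w g * φ g) ∂m := by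
  -- Insert the partition of unity `∑ w(γ⁻¹ g) = 1`, then substitute `γ g` for `g` in each term. `T`
  -- contains all the terms that matter, so the sums are finite.
  have h1 : ∀ g, u g * φ g = ∑ γ ∈ T, u g * φ g * w ((γ : G)⁻¹ * g) := by
    intro g
    rcases eq_or_ne (u g) 0 with h | h
    · simp [h]
    rw [← Finset.mul_sum]
    have e : ∑ γ ∈ T, w ((γ : G)⁻¹ * g) = 1 := by
      rw [← hw.sum_eq_one g, ← finsum_comp_equiv (Equiv.inv Γ)]
      symm
      simp only [Equiv.inv_apply, Subgroup.coe_inv]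
      apply finsum_eq_sum_of_support_subset
      intro γ hγ
      refine hT γ ⟨(γ : G)⁻¹ * g, subset_tsupport _ hγ, ?_⟩
      rw [mul_inv_cancel_left]
      exact subset_tsupport _ h
    rw [e, mul_one]
  calc ∫ g, u g * φ g ∂m = ∫ g, ∑ γ ∈ T, u g * φ g * w ((γ : G)⁻¹ * g) ∂m := by simp_rw [← h1]
    _ = ∑ γ ∈ T, ∫ g, u g * φ g * w ((γ : G)⁻¹ * g) ∂m := by
        apply integral_finsetSum
        intro γ _
        refine Continuous.integrable_of_hasCompactSupport ?_ ?_
        · exact (uc.mul φc).mul (hw.continuous.comp (continuous_const.mul continuous_id))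
        · exact (us.mul_right).mul_right
    _ = ∑ γ ∈ T, ∫ g, u (γ * g) * (w g * φ g) ∂m := by
        refine Finset.sum_congr rfl fun γ _ => ?_
        rw [← integral_mul_left_eq_self _ (γ : G)]
        congr 1
        ext g
        rw [φΓ, inv_mul_cancel_left]
        ring
    _ = ∫ g, ∑ γ ∈ T, u (γ * g) * (w g * φ g) ∂m := by
        symm
        apply integral_finsetSum
        intro γ _
        refine Continuous.integrable_of_hasCompactSupport ?_ ?_
        · exact (uc.comp (continuous_const.mul continuous_id)).mul (hw.continuous.mul φc)
        · exact (hw.hasCompactSupport.mul_right).mul_left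
    _ = _ := by simp_rw [Finset.sum_mul]

theorem IsWeight.integral_le (hw : IsWeight Γ w) (hΓ : IsUniformLattice Γ) {u : G → ℝ} (uc : Continuous u)
    (us : HasCompactSupport u) :
    ∃ C : ℝ, 0 ≤ C ∧ ∀ φ : G → ℝ, Continuous φ → (∀ (γ : Γ) g, φ (γ * g) = φ g) → (∀ g, 0 ≤ φ g) →
      ∫ g, u g * φ g ∂m ≤ C * ∫ g, w g * φ g ∂m := by
  set T := (hΓ.finite_setOf hw.hasCompactSupport us).toFinset with hTdef
  obtain ⟨B, hB⟩ := us.exists_bound_of_continuous uc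
  have hB0 : 0 ≤ B := (norm_nonneg _).trans (hB 1)
  refine ⟨T.card * B, by positivity, fun φ φc φΓ φ0 => ?_⟩
  rw [hw.integral_eq uc us φc φΓ (T := T) (fun γ hγ => by simpa [hTdef] using hγ),
    ← integral_const_mul]
  have hi : Continuous fun g => w g * φ g := hw.continuous.mul φc
  refine integral_mono ?_ ?_ fun g => ?_
  · refine Continuous.integrable_of_hasCompactSupport ?_ (hw.hasCompactSupport.mul_right).mul_left
    exact (continuous_finsetSum _ fun γ _ => uc.comp (continuous_const.mul continuous_id)).mul hi
  · exact (hi.integrable_of_hasCompactSupport hw.hasCompactSupport.mul_right).const_mul _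
  · refine mul_le_mul_of_nonneg_right ?_ (mul_nonneg (hw.nonneg g) (φ0 g))
    calc _ ≤ ∑ γ ∈ T, B := Finset.sum_le_sum fun γ _ => (le_abs_self _).trans (hB _)
      _ = _ := by simp

theorem IsWeight.integral_eq_of_isWeight (hw : IsWeight Γ w) (hΓ : IsUniformLattice Γ) {u : G → ℝ}
    (hu : IsWeight Γ u) {φ : G → ℝ} (φc : Continuous φ) (φΓ : ∀ (γ : Γ) g, φ (γ * g) = φ g) :
    ∫ g, u g * φ g ∂m = ∫ g, w g * φ g ∂m := by
  set T := (hΓ.finite_setOf hw.hasCompactSupport hu.hasCompactSupport).toFinset with hTdef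
  rw [hw.integral_eq hu.continuous hu.hasCompactSupport φc φΓ (T := T)
    (fun γ hγ => by simpa [hTdef] using hγ)]
  congr 1
  ext g
  rcases eq_or_ne (w g) 0 with h | h
  · simp [h]
  have : ∑ γ ∈ T, u (γ * g) = 1 := by
    rw [← hu.sum_eq_one g]
    symm
    apply finsum_eq_sum_of_support_subset
    intro γ hγ
    simp only [hTdef, Set.Finite.coe_toFinset]
    exact ⟨g, subset_tsupport _ h, subset_tsupport _ hγ⟩
  rw [this, one_mul]

theorem IsWeight.mul_right (hw : IsWeight Γ w) (h : G) : IsWeight Γ fun g => w (g * h) where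
  continuous := hw.continuous.comp (continuous_id.mul continuous_const)
  hasCompactSupport := hw.hasCompactSupport.comp_homeomorph (Homeomorph.mulRight h)
  nonneg g := hw.nonneg _
  sum_eq_one g := by simpa [mul_assoc] using hw.sum_eq_one (g * h)

theorem IsWeight.integral_pos (hw : IsWeight Γ w) : 0 < ∫ g, w g ∂m := by
  obtain ⟨γ, hγ⟩ := hw.exists_pos 1
  exact hw.continuous.integral_pos_of_hasCompactSupport_nonneg_nonzero hw.hasCompactSupport
    hw.nonneg hγ.ne'

/-- The mean of `Γ`-invariant functions is invariant under right translations. -/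
theorem IsWeight.integral_mul_right (hw : IsWeight Γ w) (hΓ : IsUniformLattice Γ) {φ : G → ℝ} (φc : Continuous φ)
    (φΓ : ∀ (γ : Γ) g, φ (γ * g) = φ g) (h : G) :
    ∫ g, w g * φ (g * h) ∂m = ∫ g, w g * φ g ∂m := by
  -- Right translation multiplies Haar measure by a constant and turns the weight into another
  -- weight, which gives the same mean. The case `φ = 1` shows that the constant is `1`: a group
  -- with a uniform lattice is unimodular.
  set c := Measure.haarScalarFactor (m.map (· * h)) m with hc
  have hm : Measurable fun g : G => g * h := measurable_mul_const h
  have key : ∀ φ : G → ℝ, Continuous φ → (∀ (γ : Γ) g, φ (γ * g) = φ g) →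
      ∫ g, w g * φ (g * h) ∂m = c * ∫ g, w g * φ g ∂m := by
    intro φ φc φΓ
    have hwh := hw.mul_right h⁻¹
    rw [← hw.integral_eq_of_isWeight hΓ hwh φc φΓ]
    have e1 : ∫ g, w g * φ (g * h) ∂m = ∫ g, w (g * h⁻¹) * φ g ∂(m.map (· * h)) := by
      have := (Homeomorph.mulRight h).measurableEmbedding.integral_map
        (μ := m) (fun g => w (g * h⁻¹) * φ g)
      simp only [Homeomorph.coe_mulRight, mul_inv_cancel_right] at this
      exact this.symm
    have := Measure.integral_isMulLeftInvariant_eq_smul_of_hasCompactSupport (m.map (· * h)) m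
      (f := fun g => w (g * h⁻¹) * φ g) (hwh.continuous.mul φc) hwh.hasCompactSupport.mul_right
    rw [e1, this, ← hc, integral_smul_nnreal_measure]
    rfl
  have h1 := key (fun _ => 1) continuous_const fun _ _ => rfl
  simp only [mul_one] at h1
  have hpos : 0 < ∫ g, w g ∂m := hw.integral_pos
  have hc1 : (c : ℝ) = 1 := by
    have : (1 - (c : ℝ)) * ∫ g, w g ∂m = 0 := by linarith
    rcases mul_eq_zero.1 this with h | h <;> linarith
  rw [key φ φc φΓ, hc1, one_mul]

theorem IsWeight.eq_zero_of_integral_eq_zero (hw : IsWeight Γ w) {φ : G → ℝ} (φc : Continuous φ)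
    (φΓ : ∀ (γ : Γ) g, φ (γ * g) = φ g) (φ0 : ∀ g, 0 ≤ φ g) (h : ∫ g, w g * φ g ∂m = 0) (g : G) :
    φ g = 0 := by
  obtain ⟨γ, hγ⟩ := hw.exists_pos g
  by_contra hne
  have := (hw.continuous.mul φc).integral_pos_of_hasCompactSupport_nonneg_nonzero (μ := m)
    hw.hasCompactSupport.mul_right (fun g => mul_nonneg (hw.nonneg g) (φ0 g))
    (x := (γ : G) * g) (mul_ne_zero hγ.ne' ((φΓ γ g).trans_ne hne))
  exact this.ne' h

variable {H : Type*} [TopologicalSpace H] [MeasurableSpace H] [OpensMeasurableSpace H]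
  {mH : Measure H} [IsFiniteMeasureOnCompacts mH] {ν : H → ℝ}

theorem continuous_integral_mul {E : Type*} [TopologicalSpace E] (νc : Continuous ν)
    (νs : HasCompactSupport ν) {Φ : E → H → ℝ} (hΦ : Continuous (Function.uncurry Φ)) :
    Continuous fun x => ∫ q, ν q * Φ x q ∂mH := by
  rw [← continuousOn_univ]
  refine continuousOn_integral_of_compact_support (k := tsupport ν) νs ?_ ?_
  · refine Continuous.continuousOn ?_
    exact (νc.comp continuous_snd).mul hΦ
  · intro x q _ hq
    rw [image_eq_zero_of_notMem_tsupport hq, zero_mul]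

variable [T2Space H]

/-- Averaging over right translations does not change the mean. -/
theorem IsWeight.integral_average (hw : IsWeight Γ w) (hΓ : IsUniformLattice Γ) {ι : H → G} (ιc : Continuous ι)
    (νc : Continuous ν) (νs : HasCompactSupport ν) {φ : G → ℝ} (φc : Continuous φ)
    (φΓ : ∀ (γ : Γ) g, φ (γ * g) = φ g) :
    ∫ g, w g * (∫ q, ν q * φ (g * ι q) ∂mH) ∂m = (∫ q, ν q ∂mH) * ∫ g, w g * φ g ∂m := by
  calc _ = ∫ g, ∫ q, w g * (ν q * φ (g * ι q)) ∂mH ∂m := by simp_rw [integral_const_mul]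
    _ = ∫ q, ∫ g, w g * (ν q * φ (g * ι q)) ∂m ∂mH := by
        apply integral_integral_swap_of_hasCompactSupport
        · exact (hw.continuous.comp continuous_fst).mul ((νc.comp continuous_snd).mul
            (φc.comp (continuous_fst.mul (ιc.comp continuous_snd))))
        · refine HasCompactSupport.intro (hw.hasCompactSupport.isCompact.prod νs.isCompact) ?_
          rintro ⟨g, q⟩ hgq
          rw [Set.mem_prod, not_and_or] at hgq
          rcases hgq with h | h
          · simp [Function.uncurry, image_eq_zero_of_notMem_tsupport h]
          · simp [Function.uncurry, image_eq_zero_of_notMem_tsupport h]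
    _ = ∫ q, ν q * ∫ g, w g * φ g ∂m ∂mH := by
        congr 1
        ext q
        rw [← hw.integral_mul_right hΓ φc φΓ (ι q), ← integral_const_mul]
        congr 1
        ext g
        ring
    _ = _ := by rw [integral_mul_const]

end Lattice

/-! ### Continuous equivariant maps and their oscillation. -/

section Equivariant

set_option linter.unusedSectionVars false

open Filter Topology MeasureTheory

variable {X : Type*} [MetricSpace X]

theorem IsCAT0.quadratic_sum (hX : IsCAT0 X) [Nonempty X] {I : Type*} (T : Finset I) {ρ : I → ℝ}
    (h0 : ∀ i ∈ T, 0 ≤ ρ i) (h1 : ∑ i ∈ T, ρ i = 1) (p : I → X) :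
    hX.Quadratic fun x => ∑ i ∈ T, ρ i * dist (p i) x ^ 2 where
  continuous := by fun_prop
  coercive := by
    obtain ⟨o⟩ := ‹Nonempty X›
    refine ⟨o, ∑ i ∈ T, ρ i * dist (p i) o ^ 2, fun x => ?_⟩
    calc dist o x ^ 2 / 2 = ∑ i ∈ T, ρ i * (dist o x ^ 2 / 2) := by
          rw [← Finset.sum_mul, h1, one_mul]
      _ ≤ ∑ i ∈ T, (ρ i * dist (p i) x ^ 2 + ρ i * dist (p i) o ^ 2) := by
          refine Finset.sum_le_sum fun i hi => ?_
          have k := sq_dist_le_two_mul o (p i) x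
          rw [dist_comm o (p i)] at k
          have := mul_le_mul_of_nonneg_left k (h0 i hi)
          linarith
      _ = _ := Finset.sum_add_distrib
  convex x y := by
    calc _ ≤ ∑ i ∈ T, ((ρ i * dist (p i) x ^ 2 + ρ i * dist (p i) y ^ 2) / 2
            - ρ i * (dist x y ^ 2 / 4)) := by
          refine Finset.sum_le_sum fun i hi => ?_
          have k := hX.cn_mid x y (p i)
          rw [dist_comm, dist_comm x (p i), dist_comm y (p i)] at k
          have := mul_le_mul_of_nonneg_left k (h0 i hi)
          linarith
      _ = _ := by
          rw [Finset.sum_sub_distrib, ← Finset.sum_div, Finset.sum_add_distrib, ← Finset.sum_mul,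
            h1, one_mul]

variable {G : Type*} [Group G] [TopologicalSpace G] {Γ : Subgroup G} [MulAction Γ X]

/-- Continuous `Γ`-equivariant maps. -/
structure IsEquivariantMap (Γ : Subgroup G) [MulAction Γ X] (f : G → X) : Prop where
  continuous : Continuous f
  map_mul : ∀ (γ : Γ) (g : G), f (γ * g) = γ • f g

variable [IsTopologicalGroup G] [IsIsometricSMul Γ X]

/-- The map sends `g` to the barycenter of the orbit points `γ⁻¹ • x₀` with masses `w (γ * g)`.
Reindexing the sum gives equivariance. -/
theorem IsCAT0.exists_isEquivariantMap [T2Space G] [LocallyCompactSpace G] [ProperSpace X]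
    [Nonempty X] (hX : IsCAT0 X)
    (hΓ : IsUniformLattice Γ) : ∃ f : G → X, IsEquivariantMap Γ f := by
  obtain ⟨w, hw⟩ := hΓ.exists_weight
  obtain ⟨x₀⟩ := ‹Nonempty X›
  have : Nonempty X := ⟨x₀⟩
  set F : G → X → ℝ := fun g x => ∑ᶠ γ : Γ, w (γ * g) * dist (γ⁻¹ • x₀) x ^ 2 with hF
  have Fsum : ∀ {K : Set G} {T : Finset Γ}, (∀ γ : Γ, (∃ a ∈ K, (γ : G) * a ∈ tsupport w) → γ ∈ T) →
      ∀ g ∈ K, F g = (fun x => ∑ γ ∈ T, w (γ * g) * dist (γ⁻¹ • x₀) x ^ 2) ∧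
        ∑ γ ∈ T, w (γ * g) = 1 := by
    intro K T hT g hg
    have hmem : ∀ γ : Γ, w (γ * g) ≠ 0 → γ ∈ T := fun γ h => hT γ ⟨g, hg, subset_tsupport _ h⟩
    constructor
    · ext x
      apply finsum_eq_sum_of_support_subset
      intro γ hγ
      exact hmem γ (left_ne_zero_of_mul hγ)
    · rw [← hw.sum_eq_one g]
      symm
      exact finsum_eq_sum_of_support_subset _ fun γ hγ => hmem γ hγ
  have Fquad : ∀ g, hX.Quadratic (F g) := by
    intro g
    obtain ⟨h1, h2⟩ := Fsum (K := {g})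
      (T := (hΓ.finite_setOf isCompact_singleton hw.hasCompactSupport).toFinset)
      (fun γ hγ => by simpa using hγ) g rfl
    rw [h1]
    exact hX.quadratic_sum _ (fun γ _ => hw.nonneg _) h2 _
  refine ⟨fun g => argmin (F g), ?_, fun γ g => ?_⟩
  · rw [continuous_iff_continuousAt]
    intro g₀
    obtain ⟨K, hK, hKg⟩ := exists_compact_mem_nhds g₀
    set T := (hΓ.finite_setOf hK hw.hasCompactSupport).toFinset
    have hT := Fsum (K := K) (T := T) (fun γ hγ => by simpa [T] using hγ)
    set R := ∑ γ ∈ T, dist (γ⁻¹ • x₀) x₀ with hR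
    have hRγ : ∀ γ ∈ T, dist (γ⁻¹ • x₀) x₀ ≤ R := fun γ hγ =>
      Finset.single_le_sum (f := fun γ : Γ => dist (γ⁻¹ • x₀) x₀) (fun _ _ => dist_nonneg) hγ
    have hR0 : 0 ≤ R := Finset.sum_nonneg fun _ _ => dist_nonneg
    have hb : ∀ g ∈ K, ∀ γ ∈ T, dist (γ⁻¹ • x₀) (argmin (F g)) ^ 2 ≤ 4 * R ^ 2 := by
      intro g hg γ hγ
      obtain ⟨h1, h2⟩ := hT g hg
      have h3 := (Fquad g).variance x₀
      have h4 : F g x₀ ≤ R ^ 2 := by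
        rw [h1]
        calc _ ≤ ∑ γ ∈ T, w (γ * g) * R ^ 2 := Finset.sum_le_sum fun γ hγ =>
              mul_le_mul_of_nonneg_left (pow_le_pow_left₀ dist_nonneg (hRγ γ hγ) 2) (hw.nonneg _)
          _ = _ := by rw [← Finset.sum_mul, h2, one_mul]
      have h5 : 0 ≤ F g (argmin (F g)) := by
        rw [h1]
        exact Finset.sum_nonneg fun γ _ => mul_nonneg (hw.nonneg _) (sq_nonneg _)
      have h6 : dist (argmin (F g)) x₀ ^ 2 ≤ R ^ 2 := by linarith
      have h7 := sq_dist_le_two_mul (γ⁻¹ • x₀) x₀ (argmin (F g))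
      rw [dist_comm x₀] at h7
      have h8 := pow_le_pow_left₀ dist_nonneg (hRγ γ hγ) 2
      linarith
    -- Apply each variance inequality at the other minimizer and add: twice the squared distance is
    -- at most the change of `F` at the two minimizers. The minimizers and the orbit points are
    -- within `R` of `x₀`, whence `4 * R ^ 2`.
    have main : ∀ g ∈ K, dist (argmin (F g)) (argmin (F g₀)) ≤
        Real.sqrt (4 * R ^ 2 * ∑ γ ∈ T, |w (γ * g) - w (γ * g₀)|) := by
      intro g hg
      have hg₀ : g₀ ∈ K := mem_of_mem_nhds hKg
      apply Real.le_sqrt_of_sq_le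
      have v1 := (Fquad g).variance (argmin (F g₀))
      have v2 := (Fquad g₀).variance (argmin (F g))
      rw [dist_comm (argmin (F g₀))] at v2
      have diff : ∀ x, (∀ γ ∈ T, dist (γ⁻¹ • x₀) x ^ 2 ≤ 4 * R ^ 2) → |F g x - F g₀ x| ≤
          4 * R ^ 2 * ∑ γ ∈ T, |w (γ * g) - w (γ * g₀)| := by
        intro x hx
        rw [(hT g hg).1, (hT g₀ hg₀).1]
        simp only
        rw [← Finset.sum_sub_distrib, Finset.mul_sum]
        refine (Finset.abs_sum_le_sum_abs _ _).trans (Finset.sum_le_sum fun γ hγ => ?_)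
        rw [← sub_mul, abs_mul, abs_of_nonneg (sq_nonneg (dist (γ⁻¹ • x₀) x)), mul_comm]
        exact mul_le_mul_of_nonneg_right (hx γ hγ) (abs_nonneg _)
      have d1 := (abs_le.1 (diff (argmin (F g₀)) (hb g₀ hg₀))).2
      have d2 := (abs_le.1 (diff (argmin (F g)) (hb g hg))).1
      linarith
    rw [ContinuousAt, tendsto_iff_dist_tendsto_zero]
    refine squeeze_zero' (Eventually.of_forall fun _ => dist_nonneg)
      (mem_of_superset hKg main) ?_
    have hc : Continuous fun g : G =>
        Real.sqrt (4 * R ^ 2 * ∑ γ ∈ T, |w (γ * g) - w (γ * g₀)|) := by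
      have := hw.continuous
      fun_prop
    have := hc.tendsto g₀
    simpa using this
  · symm
    apply (Fquad (γ * g)).eq_argmin
    have shift : ∀ x, F (γ * g) (γ • x) = F g x := by
      intro x
      simp only [hF]
      rw [← finsum_comp_equiv (Equiv.mulRight γ) (f := fun δ : Γ => w (δ * g) *
        dist (δ⁻¹ • x₀) x ^ 2)]
      congr 1
      ext δ
      simp only [Equiv.coe_mulRight, Subgroup.coe_mul, mul_assoc, mul_inv_rev, mul_smul]
      rw [← dist_smul γ (γ⁻¹ • δ⁻¹ • x₀) x, smul_inv_smul]
    intro x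
    have h1 := (Fquad g).argmin_le (γ⁻¹ • x)
    rw [shift]
    refine h1.trans (le_of_eq ?_)
    rw [← shift, smul_inv_smul]

/-- The largest displacement of a map under right translation by `x`. -/
noncomputable def osc (f : G → X) (x : G) : ℝ := ⨆ g, dist (f g) (f (g * x))

theorem IsEquivariantMap.dist_mul {f f' : G → X} (hf : IsEquivariantMap Γ f)
    (hf' : IsEquivariantMap Γ f') (γ : Γ) (g g' : G) :
    dist (f (γ * g)) (f' (γ * g')) = dist (f g) (f' g') := by
  rw [hf.map_mul, hf'.map_mul, dist_smul]

/-- The displacement is `Γ`-invariant in `g`, so cocompactness reduces it to compact sets. This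
makes the supremum in `osc` a genuine one, not the default value `0` of an unbounded supremum. -/
theorem IsEquivariantMap.exists_bound [LocallyCompactSpace G] {f : G → X}
    (hf : IsEquivariantMap Γ f) (hΓ : IsUniformLattice Γ) {Q : Set G} (hQ : IsCompact Q) :
    ∃ C : ℝ, ∀ x ∈ Q, ∀ g, dist (f g) (f (g * x)) ≤ C := by
  obtain ⟨F, hF, hFΓ⟩ := hΓ.exists_compact
  have hc := hf.continuous
  obtain ⟨C, hC⟩ := (hF.prod hQ).bddAbove_image (f := fun z : G × G => dist (f z.1) (f (z.1 * z.2)))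
    (by fun_prop)
  refine ⟨C, fun x hx g => ?_⟩
  obtain ⟨γ, hγ⟩ := hFΓ g
  rw [← hf.dist_mul hf γ g, ← mul_assoc]
  exact hC ⟨(γ * g, x), ⟨hγ, hx⟩, rfl⟩

theorem IsEquivariantMap.le_osc [LocallyCompactSpace G] {f : G → X}
    (hf : IsEquivariantMap Γ f) (hΓ : IsUniformLattice Γ) (g x : G) :
    dist (f g) (f (g * x)) ≤ osc f x := by
  obtain ⟨C, hC⟩ := hf.exists_bound hΓ (isCompact_singleton (x := x))
  exact le_ciSup (f := fun g => dist (f g) (f (g * x)))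
    ⟨C, by rintro _ ⟨g, rfl⟩; exact hC x rfl g⟩ g

theorem osc_nonneg (f : G → X) (x : G) : 0 ≤ osc f x := Real.iSup_nonneg fun _ => dist_nonneg

theorem IsEquivariantMap.osc_bounded [LocallyCompactSpace G] {f : G → X}
    (hf : IsEquivariantMap Γ f) (hΓ : IsUniformLattice Γ) {Q : Set G} (hQ : IsCompact Q) :
    ∃ C : ℝ, 0 ≤ C ∧ ∀ x ∈ Q, osc f x ≤ C := by
  obtain ⟨C, hC⟩ := hf.exists_bound hΓ hQ
  refine ⟨max C 0, le_max_right _ _, fun x hx => ciSup_le fun g => (hC x hx g).trans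
    (le_max_left _ _)⟩

theorem IsEquivariantMap.osc_small [LocallyCompactSpace G] {f : G → X}
    (hf : IsEquivariantMap Γ f) (hΓ : IsUniformLattice Γ) {ε : ℝ} (hε : 0 < ε) :
    ∀ᶠ x in 𝓝 (1 : G), osc f x ≤ ε := by
  obtain ⟨F, hF, hFΓ⟩ := hΓ.exists_compact
  have hc := hf.continuous
  have key : ∀ᶠ x in 𝓝 (1 : G), ∀ g ∈ F, dist (f g) (f (g * x)) < ε := by
    apply hF.eventually_forall_of_forall_eventually
    intro g _
    have hcont : Continuous fun z : G × G => dist (f z.2) (f (z.2 * z.1)) := by fun_prop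
    exact (isOpen_lt hcont continuous_const).mem_nhds (by simpa using hε)
  filter_upwards [key] with x hx
  refine ciSup_le fun g => ?_
  obtain ⟨γ, hγ⟩ := hFΓ g
  rw [← hf.dist_mul hf γ g, ← mul_assoc]
  exact (hx _ hγ).le

end Equivariant

/-! ### Averaging along `H`: from mean square to uniform closeness. -/

section Mollify

set_option linter.unusedSectionVars false

open Filter Topology MeasureTheory

variable {X : Type*} [MetricSpace X]
  {G : Type*} [Group G] [TopologicalSpace G] [IsTopologicalGroup G] [T2Space G]
  [LocallyCompactSpace G] [MeasurableSpace G] [BorelSpace G] {m : Measure G} [m.IsHaarMeasure]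
  {Γ : Subgroup G} [MulAction Γ X] [IsIsometricSMul Γ X]
  {H : Type*} [Group H] [TopologicalSpace H] [IsTopologicalGroup H] [T2Space H]
  [LocallyCompactSpace H] [MeasurableSpace H] [BorelSpace H] {mH : Measure H} [mH.IsHaarMeasure]
  {p : G →* H} {ι : H →* G} {w : G → ℝ} {ν : H → ℝ} {f₀ : G → X}

/-- `G` is the product of `H` and of the kernel of `p`, and `Γ` has dense projection to `H`. -/
structure IsSplitting (Γ : Subgroup G) (p : G →* H) (ι : H →* G) : Prop where
  continuous_proj : Continuous p
  continuous_incl : Continuous ι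
  proj_incl : ∀ h, p (ι h) = h
  comm : ∀ h k, p k = 1 → ι h * k = k * ι h
  dense : Dense (p '' (Γ : Set G))

/-- A continuous compactly supported probability density. -/
structure IsKernel (mH : Measure H) (ν : H → ℝ) : Prop where
  continuous : Continuous ν
  hasCompactSupport : HasCompactSupport ν
  nonneg : ∀ q, 0 ≤ ν q
  integral_eq_one : ∫ q, ν q ∂mH = 1

theorem exists_isKernel (mH : Measure H) [mH.IsHaarMeasure] : ∃ ν : H → ℝ, IsKernel mH ν := by
  obtain ⟨u, uc, us, u0, -, u1⟩ := exists_bump (isCompact_singleton (x := (1 : H)))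
  have hpos : 0 < ∫ q, u q ∂mH :=
    uc.integral_pos_of_hasCompactSupport_nonneg_nonzero us u0 (x := 1) (by simp [u1 1 rfl])
  refine ⟨fun q => u q / ∫ q, u q ∂mH, uc.div_const _, ?_, fun q => div_nonneg (u0 q) hpos.le, ?_⟩
  · simp only [div_eq_mul_inv]; exact us.mul_right
  · rw [integral_div, div_self hpos.ne']

/-- The standing data: a uniform lattice in a product, a weight for it normalised to have
integral one, a kernel on the factor and an equivariant map. -/
structure IsSetup (Γ : Subgroup G) [MulAction Γ X] (p : G →* H) (ι : H →* G) (m : Measure G)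
    (mH : Measure H) (w : G → ℝ) (ν : H → ℝ) (f₀ : G → X) : Prop where
  lattice : IsUniformLattice Γ
  split : IsSplitting Γ p ι
  weight : IsWeight Γ w
  weight_one : ∫ g, w g ∂m = 1
  kernel : IsKernel mH ν
  base : IsEquivariantMap Γ f₀

/-- Equivariant maps that oscillate along the kernel of `p` at most as much as `f₀`. -/
structure IsAdmissible (Γ : Subgroup G) [MulAction Γ X] (p : G →* H) (f₀ f : G → X) : Prop where
  equivariant : IsEquivariantMap Γ f
  dist_le : ∀ k, p k = 1 → ∀ g, dist (f g) (f (g * k)) ≤ osc f₀ k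

/-- Averaging a map along right translations by `H`. -/
noncomputable def mollify [Nonempty X] (mH : Measure H) (ν : H → ℝ) (ι : H →* G) (f : G → X)
    (g : G) : X :=
  bary mH ν fun q => f (g * ι q)

theorem integrable_kernel_mul (hν : IsKernel mH ν) {φ : H → ℝ} (hφ : Continuous φ) :
    Integrable (fun q => ν q * φ q) mH :=
  (hν.continuous.mul hφ).integrable_of_hasCompactSupport hν.hasCompactSupport.mul_right

theorem IsKernel.integral_le (hν : IsKernel mH ν) {φ : H → ℝ} (hφ : Continuous φ) {c : ℝ}
    (hc : ∀ q, φ q ≤ c) : ∫ q, ν q * φ q ∂mH ≤ c := by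
  calc _ ≤ ∫ q, ν q * c ∂mH := integral_mono (integrable_kernel_mul hν hφ)
        (integrable_kernel_mul hν continuous_const)
        fun q => mul_le_mul_of_nonneg_left (hc q) (hν.nonneg q)
    _ = c := by rw [integral_mul_const, hν.integral_eq_one, one_mul]

theorem IsKernel.baryData (hν : IsKernel mH ν) {f : H → X} (hf : Continuous f) :
    BaryData mH ν f :=
  ⟨hν.nonneg, hν.integral_eq_one, fun _ => integrable_kernel_mul hν (by fun_prop)⟩

theorem smul_bary [ProperSpace X] [Nonempty X] (hX : IsCAT0 X) {M : Type*} [Group M]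
    [MulAction M X] [IsIsometricSMul M X] {Ω : Type*} [MeasurableSpace Ω] {μ : Measure Ω}
    {ρ : Ω → ℝ} {f : Ω → X} (h : BaryData μ ρ f) (γ : M) :
    γ • bary μ ρ f = bary μ ρ fun q => γ • f q := by
  have e : ∀ q y, dist (γ • f q) y = dist (f q) (γ⁻¹ • y) := fun q y => by
    rw [← dist_smul γ (f q), smul_inv_smul]
  have h' : BaryData μ ρ fun q => γ • f q := by
    refine ⟨h.nonneg, h.integral_eq_one, fun x => ?_⟩
    simp only [e]
    exact h.integrable_sq _
  apply (h'.quadratic hX).eq_argmin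
  intro x
  simp only [e, inv_smul_smul]
  exact (h.quadratic hX).argmin_le (γ⁻¹ • x)

variable [ProperSpace X] [Nonempty X]

theorem IsCAT0.sq_dist_mollify_le (hX : IsCAT0 X) (hν : IsKernel mH ν) (hι : Continuous ι)
    {f f' : G → X} (hf : Continuous f) (hf' : Continuous f') (g g' : G) :
    dist (mollify mH ν ι f g) (mollify mH ν ι f' g') ^ 2 ≤
      ∫ q, ν q * dist (f (g * ι q)) (f' (g' * ι q)) ^ 2 ∂mH :=
  hX.sq_dist_bary_bary_le (hν.baryData (by fun_prop)) (hν.baryData (by fun_prop))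
    (integrable_kernel_mul hν (by fun_prop))

theorem IsCAT0.dist_mollify_le (hX : IsCAT0 X) (hν : IsKernel mH ν) (hι : Continuous ι)
    {f f' : G → X} (hf : Continuous f) (hf' : Continuous f') {g g' : G} {c : ℝ} (hc0 : 0 ≤ c)
    (hc : ∀ q, dist (f (g * ι q)) (f' (g' * ι q)) ≤ c) :
    dist (mollify mH ν ι f g) (mollify mH ν ι f' g') ≤ c := by
  refine le_of_sq_le_sq ((hX.sq_dist_mollify_le hν hι hf hf' g g').trans ?_) hc0
  exact hν.integral_le (by fun_prop) fun q => pow_le_pow_left₀ dist_nonneg (hc q) 2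

theorem IsCAT0.continuous_mollify (hX : IsCAT0 X) (hν : IsKernel mH ν) (hι : Continuous ι)
    {f : G → X} (hf : Continuous f) : Continuous (mollify mH ν ι f) := by
  rw [continuous_iff_continuousAt]
  intro g₀
  rw [ContinuousAt, tendsto_iff_dist_tendsto_zero]
  have hc : Continuous fun g =>
      Real.sqrt (∫ q, ν q * dist (f (g * ι q)) (f (g₀ * ι q)) ^ 2 ∂mH) := by
    refine Real.continuous_sqrt.comp (continuous_integral_mul hν.continuous hν.hasCompactSupport
      (Φ := fun g q => dist (f (g * ι q)) (f (g₀ * ι q)) ^ 2) ?_)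
    unfold Function.uncurry
    fun_prop
  have := hc.tendsto g₀
  simp only [dist_self, ne_eq, OfNat.ofNat_ne_zero, not_false_eq_true, zero_pow, mul_zero,
    integral_zero, Real.sqrt_zero] at this
  exact squeeze_zero (fun _ => dist_nonneg)
    (fun g => Real.le_sqrt_of_sq_le (hX.sq_dist_mollify_le hν hι hf hf g g₀)) this

/-- Translations by `ker p` commute with those by `H`, and barycenters are non-expansive, so the
bound on displacements survives. -/
theorem IsAdmissible.mollify (hX : IsCAT0 X) (S : IsSetup Γ p ι m mH w ν f₀) {f : G → X}
    (hf : IsAdmissible Γ p f₀ f) : IsAdmissible Γ p f₀ (mollify mH ν ι f) := by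
  have hc := hf.equivariant.continuous
  have hι := S.split.continuous_incl
  refine ⟨⟨hX.continuous_mollify S.kernel hι hc, fun γ g => ?_⟩, fun k hk g => ?_⟩
  · have h : BaryData mH ν fun q => f (g * ι q) := S.kernel.baryData (by fun_prop)
    unfold CAT0.mollify
    rw [smul_bary hX h γ]
    simp only [mul_assoc, hf.equivariant.map_mul]
  · refine hX.dist_mollify_le S.kernel hι hc hc (osc_nonneg _ _) fun q => ?_
    rw [mul_assoc, ← S.split.comm q k hk, ← mul_assoc]
    exact hf.dist_le k hk _

/-- The mean square distance of two maps. -/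
noncomputable def meanSq (m : Measure G) (w : G → ℝ) (f f' : G → X) : ℝ :=
  ∫ g, w g * dist (f g) (f' g) ^ 2 ∂m

theorem meanSq_nonneg (hw : IsWeight Γ w) (f f' : G → X) : 0 ≤ meanSq m w f f' :=
  integral_nonneg fun g => mul_nonneg (hw.nonneg g) (sq_nonneg _)

theorem IsWeight.integrable (hw : IsWeight Γ w) {φ : G → ℝ} (hφ : Continuous φ) :
    Integrable (fun g => w g * φ g) m :=
  (hw.continuous.mul hφ).integrable_of_hasCompactSupport hw.hasCompactSupport.mul_right

theorem IsAdmissible.sq_dist_le {f f' : G → X} (hf : IsAdmissible Γ p f₀ f)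
    (hf' : IsAdmissible Γ p f₀ f') {k : G} (hk : p k = 1) (g : G) :
    dist (f g) (f' g) ^ 2 ≤ 2 * dist (f (g * k)) (f' (g * k)) ^ 2 + 8 * osc f₀ k ^ 2 := by
  have h1 := hf.dist_le k hk g
  have h2 := hf'.dist_le k hk g
  rw [dist_comm] at h2
  have h3 := dist_triangle4 (f g) (f (g * k)) (f' (g * k)) (f' g)
  have h4 : dist (f g) (f' g) ≤ dist (f (g * k)) (f' (g * k)) + 2 * osc f₀ k := by linarith
  have h5 := pow_le_pow_left₀ dist_nonneg h4 2
  nlinarith [sq_nonneg (dist (f (g * k)) (f' (g * k)) - 2 * osc f₀ k)]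

/-- Maps that are close in mean square become uniformly close after averaging. -/
theorem IsSetup.exists_mollify_close (hX : IsCAT0 X) (S : IsSetup Γ p ι m mH w ν f₀) {ε : ℝ}
    (hε : 0 < ε) : ∃ δ > 0, ∀ f f' : G → X, IsAdmissible Γ p f₀ f → IsAdmissible Γ p f₀ f' →
      meanSq m w f f' ≤ δ → ∀ g, dist (mollify mH ν ι f g) (mollify mH ν ι f' g) ≤ ε := by
  have hι := S.split.continuous_incl
  have hp := S.split.continuous_proj
  obtain ⟨F, hF, hFΓ⟩ := S.lattice.exists_compact
  obtain ⟨P, hP, hP1⟩ := exists_compact_mem_nhds (1 : H)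
  -- `B * χ` dominates all translates of `ν` by elements of `P`, so it absorbs the later change of
  -- variable `q ↦ a * q`.
  obtain ⟨χ, χc, χs, χ0, -, χ1⟩ := exists_bump (hP.inv.mul S.kernel.hasCompactSupport.isCompact)
  obtain ⟨B, hB⟩ := S.kernel.hasCompactSupport.exists_bound_of_continuous S.kernel.continuous
  have hB0 : 0 ≤ B := (norm_nonneg _).trans (hB 1)
  have hνχ : ∀ a ∈ P, ∀ q, ν q ≤ B * χ (a⁻¹ * q) := by
    intro a ha q
    by_cases hq : q ∈ tsupport ν
    · rw [χ1 _ ⟨a⁻¹, Set.inv_mem_inv.2 ha, q, hq, rfl⟩, mul_one]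
      exact (le_abs_self _).trans (hB q)
    · rw [image_eq_zero_of_notMem_tsupport hq]
      exact mul_nonneg hB0 (χ0 _)
  set c := ∫ q, χ q ∂mH with hc
  have hc0 : 0 ≤ c := integral_nonneg χ0
  obtain ⟨η, hη, hηε⟩ : ∃ η > 0, 8 * B * c * η ^ 2 ≤ ε ^ 2 / 2 := by
    have lim : Tendsto (fun η : ℝ => 8 * B * c * η ^ 2) (𝓝 0) (𝓝 (8 * B * c * 0 ^ 2)) :=
      Continuous.tendsto (by fun_prop) 0
    have h1 : ∀ᶠ η in 𝓝 (0 : ℝ), 8 * B * c * η ^ 2 < ε ^ 2 / 2 := by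
      apply lim.eventually_lt_const
      simp only [ne_eq, OfNat.ofNat_ne_zero, not_false_eq_true, zero_pow, mul_zero]
      positivity
    obtain ⟨r, hr, h2⟩ := Metric.eventually_nhds_iff.1 h1
    refine ⟨r / 2, by positivity, (h2 ?_).le⟩
    rw [Real.dist_eq, sub_zero, abs_of_pos (by positivity)]
    linarith
  -- a neighbourhood of the identity on which the oscillation is small
  have hW : ∀ᶠ x in 𝓝 (1 : G), p x ∈ P ∧ osc f₀ ((ι (p x))⁻¹ * x) ≤ η := by
    refine Eventually.and ?_ ?_
    · have : Tendsto p (𝓝 1) (𝓝 1) := by simpa using hp.tendsto 1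
      exact this hP1
    · have : Tendsto (fun x : G => (ι (p x))⁻¹ * x) (𝓝 1) (𝓝 1) := by
        have h : Continuous fun x : G => (ι (p x))⁻¹ * x := by fun_prop
        simpa using h.tendsto 1
      exact this.eventually (S.base.osc_small S.lattice hη)
  obtain ⟨W, hWsub, hWo, hW1⟩ := mem_nhds_iff.1 hW
  obtain ⟨β, β1, βs, βW, β01⟩ := exists_continuousMap_one_of_isCompact_subset_isOpen
    (isCompact_singleton (x := (1 : G))) hWo (by simpa using hW1)
  have βs : HasCompactSupport β := βs
  have β0 : ∀ x, 0 ≤ β x := fun x => (β01 x).1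
  have hβpos : 0 < ∫ x, β x ∂m :=
    β.continuous.integral_pos_of_hasCompactSupport_nonneg_nonzero βs β0 (x := 1)
      (by rw [β1 rfl]; simp)
  obtain ⟨U, Uc, Us, U0, -, U1⟩ := exists_bump (hF.mul βs.isCompact)
  obtain ⟨C, hC0, hC⟩ := S.weight.integral_le (m := m) S.lattice Uc Us
  set b := ∫ x, β x ∂m with hb
  -- Half of `ε ^ 2` is reserved for the mean square term, half for the oscillation term controlled
  -- by `η`; the `+ 1` keeps the denominator positive.
  refine ⟨ε ^ 2 / 2 / (2 * B * C * c / b + 1), by positivity, fun f f' hf hf' hδ g => ?_⟩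
  have fc := hf.equivariant.continuous
  have fc' := hf'.equivariant.continuous
  set φ : G → ℝ := fun g => dist (f g) (f' g) ^ 2 with hφ
  have φc : Continuous φ := by fun_prop
  have φ0 : ∀ g, 0 ≤ φ g := fun g => sq_nonneg _
  have φΓ : ∀ (γ : Γ) g, φ (γ * g) = φ g := fun γ g => by
    simp only [hφ]; rw [hf.equivariant.dist_mul hf'.equivariant]
  set u : G → ℝ := fun y => ∫ q, χ q * φ (y * ι q) ∂mH with hu
  have uc : Continuous u := continuous_integral_mul χc χs (Φ := fun y q => φ (y * ι q))
    (by unfold Function.uncurry; fun_prop)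
  have u0 : ∀ g, 0 ≤ u g := fun g => integral_nonneg fun q => mul_nonneg (χ0 _) (φ0 _)
  have uΓ : ∀ (γ : Γ) g, u (γ * g) = u g := fun γ g => by
    simp only [hu, mul_assoc, φΓ]
  have hχi : ∀ {ψ : H → ℝ}, Continuous ψ → Integrable (fun q => χ q * ψ q) mH := fun hψ =>
    (χc.mul hψ).integrable_of_hasCompactSupport χs.mul_right
  -- pointwise comparison
  have cmp : ∀ g, ∀ x ∈ W, ∫ q, ν q * φ (g * ι q) ∂mH ≤
      2 * B * u (g * x) + 8 * B * c * η ^ 2 := by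
    intro g x hx
    obtain ⟨hxP, hxη⟩ := hWsub hx
    set a := p x with ha
    set k := (ι a)⁻¹ * x with hk
    have hpk : p k = 1 := by rw [hk, map_mul, map_inv, S.split.proj_incl, ← ha, inv_mul_cancel]
    calc ∫ q, ν q * φ (g * ι q) ∂mH ≤ ∫ q, B * χ (a⁻¹ * q) * φ (g * ι q) ∂mH := by
          refine integral_mono (integrable_kernel_mul S.kernel (by fun_prop)) ?_ fun q =>
            mul_le_mul_of_nonneg_right (hνχ a hxP q) (φ0 _)
          have hs : HasCompactSupport fun q => χ (a⁻¹ * q) :=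
            χs.comp_homeomorph (Homeomorph.mulLeft a⁻¹)
          refine Continuous.integrable_of_hasCompactSupport (by fun_prop) ?_
          exact (hs.mul_left (f := fun _ => B)).mul_right
      _ = ∫ q, B * (χ q * φ (g * ι (a * q))) ∂mH := by
          rw [← integral_mul_left_eq_self _ a]
          simp only [inv_mul_cancel_left, mul_assoc]
      _ ≤ ∫ q, B * (χ q * (2 * φ (g * x * ι q) + 8 * η ^ 2)) ∂mH := by
          refine integral_mono ((hχi (by fun_prop)).const_mul B)
            ((hχi (by fun_prop)).const_mul B) fun q => ?_
          refine mul_le_mul_of_nonneg_left (mul_le_mul_of_nonneg_left ?_ (χ0 q)) hB0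
          have h1 := hf.sq_dist_le hf' hpk (g * ι (a * q))
          have e : g * ι (a * q) * k = g * x * ι q := by
            have e2 : x = ι a * k := by rw [hk, mul_inv_cancel_left]
            rw [map_mul, e2]
            simp only [mul_assoc]
            rw [S.split.comm q k hpk]
          rw [e] at h1
          have h2 := pow_le_pow_left₀ (osc_nonneg f₀ k) hxη 2
          simp only [hφ]
          linarith
      _ = _ := by
          rw [integral_const_mul]
          simp only [mul_add]
          rw [integral_add (hχi (by fun_prop)) (hχi (by fun_prop)), integral_mul_const, ← hc]
          have : ∫ q, χ q * (2 * φ (g * x * ι q)) ∂mH = 2 * u (g * x) := by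
            rw [hu, ← integral_const_mul]
            congr 1; ext q; ring
          rw [this]
          ring
  have mean_u : ∫ g, w g * u g ∂m = c * meanSq m w f f' :=
    S.weight.integral_average S.lattice hι χc χs φc φΓ
  -- Averaging `cmp` over `x` against `β` replaces the value at `g` by an integral of `u` over a
  -- compact set, which `C` bounds by the weighted mean of `u`.
  have bound : ∀ g ∈ F, ∫ q, ν q * φ (g * ι q) ∂mH ≤ ε ^ 2 := by
    intro g hg
    set v := ∫ q, ν q * φ (g * ι q) ∂mH with hv
    have h1 : v * b ≤ 2 * B * (C * (c * meanSq m w f f')) + 8 * B * c * η ^ 2 * b := by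
      rw [← mean_u]
      calc v * b = ∫ x, β x * v ∂m := by rw [integral_mul_const, mul_comm]
        _ ≤ ∫ x, (2 * B * (U (g * x) * u (g * x)) + β x * (8 * B * c * η ^ 2)) ∂m := by
            have hs : HasCompactSupport fun x => U (g * x) :=
              Us.comp_homeomorph (Homeomorph.mulLeft g)
            refine integral_mono ((β.continuous.integrable_of_hasCompactSupport βs).mul_const _)
              ((Integrable.const_mul ?_ _).add
              ((β.continuous.integrable_of_hasCompactSupport βs).mul_const _)) fun x => ?_
            · refine Continuous.integrable_of_hasCompactSupport (by fun_prop) hs.mul_right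
            · by_cases hx : x ∈ tsupport β
              · have k1 := cmp g x (βW hx)
                have k2 := mul_le_mul_of_nonneg_left k1 (β0 x)
                have k3 := U1 (g * x) ⟨g, hg, x, hx, rfl⟩
                have k4 : β x * u (g * x) ≤ 1 * u (g * x) :=
                  mul_le_mul_of_nonneg_right (β01 x).2 (u0 _)
                simp only [k3]
                nlinarith
              · rw [image_eq_zero_of_notMem_tsupport hx]
                have := mul_nonneg (U0 (g * x)) (u0 (g * x))
                simp only [zero_mul]
                positivity
        _ = 2 * B * (∫ x, U (g * x) * u (g * x) ∂m) + 8 * B * c * η ^ 2 * b := by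
            have hs : HasCompactSupport fun x => U (g * x) :=
              Us.comp_homeomorph (Homeomorph.mulLeft g)
            rw [integral_add, integral_const_mul, integral_mul_const, mul_comm b]
            · refine Integrable.const_mul ?_ _
              exact Continuous.integrable_of_hasCompactSupport (by fun_prop) hs.mul_right
            · exact (β.continuous.integrable_of_hasCompactSupport βs).mul_const _
        _ ≤ _ := by
            rw [integral_mul_left_eq_self (fun x => U x * u x) g]
            have := hC u uc uΓ u0
            gcongr
    have h2 : v ≤ 2 * B * C * c / b * meanSq m w f f' + 8 * B * c * η ^ 2 := by
      rw [← sub_le_iff_le_add, div_mul_eq_mul_div, le_div_iff₀ hβpos]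
      linarith
    have h3 : 2 * B * C * c / b * meanSq m w f f' ≤ ε ^ 2 / 2 := by
      have hpos : 0 < 2 * B * C * c / b + 1 := by positivity
      have k1 := (le_div_iff₀ hpos).1 hδ
      have k2 := meanSq_nonneg (m := m) S.weight f f'
      nlinarith
    linarith
  obtain ⟨γ, hγ⟩ := hFΓ g
  have hmf := hf.mollify hX S
  have hmf' := hf'.mollify hX S
  rw [← hmf.equivariant.dist_mul hmf'.equivariant γ]
  refine le_of_sq_le_sq ?_ hε.le
  exact (hX.sq_dist_mollify_le S.kernel hι fc fc' _ _).trans (bound _ hγ)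

end Mollify

/-! ### Stable sets of maps and escape to infinity. -/

section Stable

set_option linter.unusedSectionVars false

open Filter Topology MeasureTheory

variable {X : Type*} [MetricSpace X] [ProperSpace X] [Nonempty X]
  {G : Type*} [Group G] [TopologicalSpace G] [IsTopologicalGroup G] [T2Space G]
  [LocallyCompactSpace G] [MeasurableSpace G] [BorelSpace G] {m : Measure G} [m.IsHaarMeasure]
  {Γ : Subgroup G} [MulAction Γ X] [IsIsometricSMul Γ X]
  {H : Type*} [Group H] [TopologicalSpace H] [IsTopologicalGroup H] [T2Space H]
  [LocallyCompactSpace H] [MeasurableSpace H] [BorelSpace H] {mH : Measure H} [mH.IsHaarMeasure]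
  {p : G →* H} {ι : H →* G} {w : G → ℝ} {ν : H → ℝ} {f₀ : G → X}

/-- The right translate of a map by an element of `H`. -/
def translate (ι : H →* G) (h : H) (f : G → X) : G → X := fun g => f (g * ι h)

theorem IsEquivariantMap.translate {f : G → X} (hf : IsEquivariantMap Γ f) (h : H) :
    IsEquivariantMap Γ (translate ι h f) := by
  have := hf.continuous
  refine ⟨by unfold CAT0.translate; fun_prop, fun γ g => ?_⟩
  simp only [CAT0.translate, mul_assoc, hf.map_mul]

theorem IsAdmissible.translate {f : G → X} (hs : IsSplitting Γ p ι)
    (hf : IsAdmissible Γ p f₀ f) (h : H) : IsAdmissible Γ p f₀ (translate ι h f) := by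
  refine ⟨hf.equivariant.translate h, fun k hk g => ?_⟩
  simp only [CAT0.translate]
  rw [mul_assoc g k, ← hs.comm h k hk, ← mul_assoc]
  exact hf.dist_le k hk _

theorem IsAdmissible.mid (hX : IsCAT0 X) {f f' : G → X} (hf : IsAdmissible Γ p f₀ f)
    (hf' : IsAdmissible Γ p f₀ f') : IsAdmissible Γ p f₀ fun g => hX.mid (f g) (f' g) := by
  refine ⟨⟨hX.continuous_mid.comp (hf.equivariant.continuous.prodMk hf'.equivariant.continuous),
    fun γ g => ?_⟩, fun k hk g => ?_⟩
  · rw [hf.equivariant.map_mul, hf'.equivariant.map_mul, hX.smul_mid]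
  · have h1 := hX.dist_mid_mid (f g) (f' g) (f (g * k)) (f' (g * k))
    have h2 := hf.dist_le k hk g
    have h3 := hf'.dist_le k hk g
    linarith

theorem IsAdmissible.of_approx {f : G → X}
    (h : ∀ ε > 0, ∃ f', IsAdmissible Γ p f₀ f' ∧ ∀ g, dist (f g) (f' g) ≤ ε) :
    IsAdmissible Γ p f₀ f := by
  refine ⟨⟨?_, fun γ g => ?_⟩, fun k hk g => ?_⟩
  · apply continuous_of_uniform_approx_of_continuous
    intro u hu
    obtain ⟨ε, hε, hεu⟩ := Metric.mem_uniformity_dist.1 hu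
    obtain ⟨f', hf', hd⟩ := h (ε / 2) (by positivity)
    exact ⟨f', hf'.equivariant.continuous, fun g => hεu ((hd g).trans_lt (by linarith))⟩
  · rw [← dist_le_zero]
    apply le_of_forall_pos_le_add
    intro ε hε
    obtain ⟨f', hf', hd⟩ := h (ε / 2) (by positivity)
    have h1 := dist_triangle (f (γ * g)) (f' (γ * g)) (γ • f g)
    rw [hf'.equivariant.map_mul, dist_smul, dist_comm (f' g)] at h1
    have h2 := hd (γ * g)
    rw [hf'.equivariant.map_mul] at h2
    linarith [hd g]
  · apply le_of_forall_pos_le_add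
    intro ε hε
    obtain ⟨f', hf', hd⟩ := h (ε / 2) (by positivity)
    have h1 := dist_triangle4 (f g) (f' g) (f' (g * k)) (f (g * k))
    rw [dist_comm (f' (g * k)) (f (g * k))] at h1
    linarith [hd g, hd (g * k), hf'.dist_le k hk g]

/-- Non-empty sets of admissible maps that are closed, convex and invariant under `H`. -/
structure IsStable (hX : IsCAT0 X) (Γ : Subgroup G) [MulAction Γ X] (p : G →* H) (ι : H →* G)
    (mH : Measure H) (ν : H → ℝ) (f₀ : G → X) (M : Set (G → X)) : Prop where
  nonempty : M.Nonempty
  admissible : ∀ f ∈ M, IsAdmissible Γ p f₀ f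
  closed : ∀ f, (∀ ε > 0, ∃ f' ∈ M, ∀ g, dist (f g) (f' g) ≤ ε) → f ∈ M
  mid : ∀ f ∈ M, ∀ f' ∈ M, (fun g => hX.mid (f g) (f' g)) ∈ M
  translate : ∀ f ∈ M, ∀ h, translate ι h f ∈ M
  mollify : ∀ f ∈ M, mollify mH ν ι f ∈ M

theorem IsSetup.isStable_admissible (hX : IsCAT0 X) (S : IsSetup Γ p ι m mH w ν f₀) :
    IsStable hX Γ p ι mH ν f₀ {f | IsAdmissible Γ p f₀ f} where
  nonempty := ⟨f₀, S.base, fun k _ g => S.base.le_osc S.lattice g k⟩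
  admissible _ hf := hf
  closed _ hf := IsAdmissible.of_approx hf
  mid _ hf _ hf' := IsAdmissible.mid hX hf hf'
  translate _ hf h := IsAdmissible.translate S.split hf h
  mollify _ hf := IsAdmissible.mollify hX S hf

theorem IsWeight.integral_mono (hw : IsWeight Γ w) {φ ψ : G → ℝ} (hφ : Continuous φ)
    (hψ : Continuous ψ) (h : ∀ g, φ g ≤ ψ g) : ∫ g, w g * φ g ∂m ≤ ∫ g, w g * ψ g ∂m :=
  MeasureTheory.integral_mono (hw.integrable hφ) (hw.integrable hψ) fun g =>
    mul_le_mul_of_nonneg_left (h g) (hw.nonneg g)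

theorem IsWeight.integral_add_mul (hw : IsWeight Γ w) {φ ψ : G → ℝ} (hφ : Continuous φ)
    (hψ : Continuous ψ) (a b : ℝ) : ∫ g, w g * (a * φ g + b * ψ g) ∂m =
      a * ∫ g, w g * φ g ∂m + b * ∫ g, w g * ψ g ∂m := by
  rw [← integral_const_mul, ← integral_const_mul, ← integral_add]
  · congr 1; ext g; ring
  · exact (hw.integrable hφ).const_mul a
  · exact (hw.integrable hψ).const_mul b

theorem meanSq_mid_le (hX : IsCAT0 X) (hw : IsWeight Γ w) {f f₁ f₂ : G → X} (hf : Continuous f)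
    (h₁ : Continuous f₁) (h₂ : Continuous f₂) :
    meanSq m w f (fun g => hX.mid (f₁ g) (f₂ g)) ≤
      (meanSq m w f f₁ + meanSq m w f f₂) / 2 - meanSq m w f₁ f₂ / 4 := by
  have hm : Continuous fun g => hX.mid (f₁ g) (f₂ g) := hX.continuous_mid.comp (h₁.prodMk h₂)
  unfold meanSq
  calc _ ≤ ∫ g, w g * (1 * (1 / 2 * dist (f g) (f₁ g) ^ 2 + 1 / 2 * dist (f g) (f₂ g) ^ 2)
          + (- 1 / 4) * dist (f₁ g) (f₂ g) ^ 2) ∂m := by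
        refine hw.integral_mono (by fun_prop) (by fun_prop) fun g => ?_
        have := hX.cn_mid (f₁ g) (f₂ g) (f g)
        rw [dist_comm, dist_comm (f₁ g) (f g), dist_comm (f₂ g) (f g)] at this
        linarith
    _ = _ := by
        rw [hw.integral_add_mul (by fun_prop) (by fun_prop),
          hw.integral_add_mul (by fun_prop) (by fun_prop)]
        ring

theorem meanSq_translate (hw : IsWeight Γ w) (hΓ : IsUniformLattice Γ) {f f' : G → X}
    (hf : IsEquivariantMap Γ f) (hf' : IsEquivariantMap Γ f') (h : H) :
    meanSq m w (translate ι h f) (translate ι h f') = meanSq m w f f' := by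
  have := hf.continuous
  have := hf'.continuous
  exact hw.integral_mul_right hΓ (φ := fun g => dist (f g) (f' g) ^ 2) (by fun_prop)
    (fun γ g => by rw [hf.dist_mul hf']) (ι h)

theorem translate_translate_inv (h : H) (f : G → X) :
    translate ι h (translate ι h⁻¹ f) = f := by
  ext g; simp [translate, mul_assoc]

/-- Near-projections of `f₀` to a stable set are displaced boundedly. -/
theorem IsStable.meanSq_translate_le {hX : IsCAT0 X} (S : IsSetup Γ p ι m mH w ν f₀)
    {M : Set (G → X)} (hM : IsStable hX Γ p ι mH ν f₀ M) {r : ℝ}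
    (hr : ∀ f ∈ M, r ≤ meanSq m w f₀ f) {f : G → X} (hf : f ∈ M)
    (hfr : meanSq m w f₀ f ≤ r + 1) (h : H) :
    meanSq m w f (CAT0.translate ι h f) ≤ 4 * meanSq m w f₀ (CAT0.translate ι h f₀) + 8 := by
  set a := f₀ with ha
  set b := CAT0.translate ι h f₀ with hb
  set q := CAT0.translate ι h f with hq
  have hqM : q ∈ M := hM.translate f hf h
  have hae := S.base
  have hbe : IsEquivariantMap Γ b := hae.translate h
  have hfe := (hM.admissible f hf).equivariant
  have hqe := (hM.admissible q hqM).equivariant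
  have ac := hae.continuous
  have bc := hbe.continuous
  have fc := hfe.continuous
  have qc := hqe.continuous
  have hmid := hM.mid f hf q hqM
  have hw := S.weight
  have i1 := (hr _ hmid).trans (meanSq_mid_le hX hw ac fc qc)
  -- Translation by `h` preserves mean square distances and `M`, so the translate `b` of `f₀` is
  -- also at mean square distance at least `r` from `M`.
  have i2 : r ≤ meanSq m w b (fun g => hX.mid (f g) (q g)) := by
    have := hr _ (hM.translate _ hmid h⁻¹)
    rw [← meanSq_translate (ι := ι) hw S.lattice hae
      (hM.admissible _ (hM.translate _ hmid h⁻¹)).equivariant h, translate_translate_inv] at this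
    exact this
  have i3 := i2.trans (meanSq_mid_le hX hw bc fc qc)
  have i4 : meanSq m w b q = meanSq m w a f := meanSq_translate hw S.lattice hae hfe h
  -- The integrated quadruple inequality with `2αβ ≤ 2α² + β²/2`. The coefficient `1 / 2` is small
  -- enough to be absorbed by the gains of the two midpoint inequalities.
  have i5 : meanSq m w a q + meanSq m w b f ≤ meanSq m w a f + meanSq m w b q +
      (2 * meanSq m w a b + 1 / 2 * meanSq m w f q) := by
    have e1 := hw.integral_add_mul (m := m) (φ := fun g => dist (a g) (q g) ^ 2)
      (ψ := fun g => dist (b g) (f g) ^ 2) (by fun_prop) (by fun_prop) 1 1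
    have e2 := hw.integral_add_mul (m := m) (φ := fun g => dist (a g) (f g) ^ 2)
      (ψ := fun g => dist (b g) (q g) ^ 2) (by fun_prop) (by fun_prop) 1 1
    have e3 := hw.integral_add_mul (m := m) (φ := fun g => dist (a g) (b g) ^ 2)
      (ψ := fun g => dist (f g) (q g) ^ 2) (by fun_prop) (by fun_prop) 2 (1 / 2)
    have e4 := hw.integral_add_mul (m := m)
      (φ := fun g => 1 * dist (a g) (f g) ^ 2 + 1 * dist (b g) (q g) ^ 2)
      (ψ := fun g => 2 * dist (a g) (b g) ^ 2 + 1 / 2 * dist (f g) (q g) ^ 2)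
      (by fun_prop) (by fun_prop) 1 1
    have e5 : ∫ g, w g * (1 * dist (a g) (q g) ^ 2 + 1 * dist (b g) (f g) ^ 2) ∂m ≤ _ :=
      (hw.integral_mono (by fun_prop) (by fun_prop) fun g => ?_).trans_eq e4
    · unfold meanSq; linarith
    · have k := hX.quadruple (a g) (b g) (f g) (q g)
      nlinarith [sq_nonneg (2 * dist (a g) (b g) - dist (f g) (q g))]
  linarith

/-- A sequence of admissible maps going to infinity with bounded displacements yields a fixed
point at infinity. -/
theorem IsSetup.exists_fixed_boundary (hX : IsCAT0 X) (S : IsSetup Γ p ι m mH w ν f₀)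
    (f : ℕ → G → X) (hf : ∀ n, IsAdmissible Γ p f₀ (f n))
    (hdisp : ∀ n h, meanSq m w (f n) (translate ι h (f n)) ≤
      4 * meanSq m w f₀ (translate ι h f₀) + 8)
    (hinf : Tendsto (fun n => meanSq m w f₀ (f n)) atTop atTop) :
    ∃ ξ : Boundary X, ∀ γ : Γ, γ • ξ = ξ := by
  have hw := S.weight
  have hι := S.split.continuous_incl
  have hp := S.split.continuous_proj
  have fc : ∀ n, Continuous (f n) := fun n => (hf n).equivariant.continuous
  have f₀c := S.base.continuous
  -- displacements by elements of a compact set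
  have disp : ∀ Q : Set G, IsCompact Q → ∃ C, ∀ x ∈ Q, ∀ n,
      ∫ g, w g * dist (f n g) (f n (g * x)) ^ 2 ∂m ≤ C := by
    intro Q hQ
    -- Write `x = ι h * k` with `k ∈ ker p`: `hdisp` controls the first factor, admissibility the
    -- second.
    obtain ⟨C₁, hC₁0, hC₁⟩ := S.base.osc_bounded S.lattice
      (hQ.image (f := fun x => ι (p x)) (by fun_prop))
    obtain ⟨C₂, hC₂0, hC₂⟩ := S.base.osc_bounded S.lattice
      (hQ.image (f := fun x => (ι (p x))⁻¹ * x) (by fun_prop))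
    refine ⟨2 * (4 * C₁ ^ 2 + 8) + 2 * C₂ ^ 2, fun x hx n => ?_⟩
    set h := p x with hh
    set k := (ι h)⁻¹ * x with hk
    have hpk : p k = 1 := by rw [hk, map_mul, map_inv, S.split.proj_incl, ← hh, inv_mul_cancel]
    have hx' : x = ι h * k := by rw [hk, mul_inv_cancel_left]
    have h1 : meanSq m w f₀ (translate ι h f₀) ≤ C₁ ^ 2 := by
      unfold meanSq
      calc _ ≤ ∫ g, w g * C₁ ^ 2 ∂m := by
            have := (S.base.translate (ι := ι) h).continuous
            refine hw.integral_mono (by fun_prop) continuous_const fun g => ?_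
            exact pow_le_pow_left₀ dist_nonneg ((S.base.le_osc S.lattice g (ι h)).trans
              (hC₁ _ ⟨x, hx, rfl⟩)) 2
        _ = _ := by rw [integral_mul_const, S.weight_one, one_mul]
    have h2 := hdisp n h
    have hc1 : Continuous fun g => dist (f n g) (f n (g * ι h)) ^ 2 := by
      have := fc n
      fun_prop
    calc ∫ g, w g * dist (f n g) (f n (g * x)) ^ 2 ∂m ≤
        ∫ g, w g * (2 * dist (f n g) (f n (g * ι h)) ^ 2 + 2 * C₂ ^ 2) ∂m := by
          have := fc n
          refine hw.integral_mono (by fun_prop) (by fun_prop) fun g => ?_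
          have k1 := sq_dist_le_two_mul (f n g) (f n (g * ι h)) (f n (g * x))
          have k2 := (hf n).dist_le k hpk (g * ι h)
          rw [mul_assoc, ← hx'] at k2
          have k3 := pow_le_pow_left₀ dist_nonneg (k2.trans (hC₂ _ ⟨x, hx, rfl⟩)) 2
          linarith
      _ = 2 * meanSq m w (f n) (translate ι h (f n)) + 2 * C₂ ^ 2 := by
          rw [hw.integral_add_mul hc1 continuous_const, integral_mul_const, S.weight_one, one_mul]
          rfl
      _ ≤ _ := by linarith
  -- averages over pairs of points
  have pairs : ∀ β : G → ℝ, Continuous β → HasCompactSupport β → ∃ C, ∀ n,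
      ∫ g, w g * (∫ g', β g' * dist (f n g) (f n g') ^ 2 ∂m) ∂m ≤ C := by
    intro β βc βs
    obtain ⟨B, hB⟩ := βs.exists_bound_of_continuous βc
    have hB0 : 0 ≤ B := (norm_nonneg _).trans (hB 1)
    -- Substituting `g' = g * x`, only `x` in the compact set where `χ = 1` contribute, and Fubini
    -- reduces to the displacements `disp`.
    obtain ⟨χ, χc, χs, χ0, -, χ1⟩ := exists_bump
      (hw.hasCompactSupport.isCompact.inv.mul βs.isCompact)
    obtain ⟨C, hC⟩ := disp (tsupport χ) χs.isCompact
    refine ⟨B * ((∫ x, χ x ∂m) * C), fun n => ?_⟩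
    have fcn := fc n
    have hχi : ∀ {ψ : G → ℝ}, Continuous ψ → Integrable (fun q => χ q * ψ q) m := fun hψ =>
      (χc.mul hψ).integrable_of_hasCompactSupport χs.mul_right
    have c1 : Continuous fun g => ∫ g', β g' * dist (f n g) (f n g') ^ 2 ∂m :=
      continuous_integral_mul βc βs (Φ := fun g g' => dist (f n g) (f n g') ^ 2)
        (by unfold Function.uncurry; fun_prop)
    have c2 : Continuous fun g => ∫ x, χ x * dist (f n g) (f n (g * x)) ^ 2 ∂m :=
      continuous_integral_mul χc χs (Φ := fun g x => dist (f n g) (f n (g * x)) ^ 2)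
        (by unfold Function.uncurry; fun_prop)
    calc _ ≤ ∫ g, w g * (B * ∫ x, χ x * dist (f n g) (f n (g * x)) ^ 2 ∂m) ∂m := by
          refine MeasureTheory.integral_mono (hw.integrable c1)
            (hw.integrable (c2.const_mul B)) fun g => ?_
          by_cases hg : g ∈ tsupport w
          · refine mul_le_mul_of_nonneg_left ?_ (hw.nonneg g)
            rw [← integral_const_mul, ← integral_mul_left_eq_self _ g]
            have hs : HasCompactSupport fun x => β (g * x) :=
              βs.comp_homeomorph (Homeomorph.mulLeft g)
            refine MeasureTheory.integral_mono
              (Continuous.integrable_of_hasCompactSupport (by fun_prop) hs.mul_right)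
              ((hχi (by fun_prop)).const_mul B) fun x => ?_
            simp only
            rw [← mul_assoc]
            refine mul_le_mul_of_nonneg_right ?_ (sq_nonneg _)
            by_cases hx : g * x ∈ tsupport β
            · rw [χ1 x ⟨g⁻¹, Set.inv_mem_inv.2 hg, g * x, hx, by simp⟩, mul_one]
              exact (le_abs_self _).trans (hB _)
            · rw [image_eq_zero_of_notMem_tsupport hx]
              exact mul_nonneg hB0 (χ0 _)
          · simp [image_eq_zero_of_notMem_tsupport hg]
      _ = B * ∫ g, ∫ x, w g * (χ x * dist (f n g) (f n (g * x)) ^ 2) ∂m ∂m := by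
          simp_rw [integral_const_mul]
          rw [← integral_const_mul]
          congr 1; ext g; ring
      _ = B * ∫ x, ∫ g, w g * (χ x * dist (f n g) (f n (g * x)) ^ 2) ∂m ∂m := by
          congr 1
          apply integral_integral_swap_of_hasCompactSupport
          · have := hw.continuous
            unfold Function.uncurry
            fun_prop
          · refine HasCompactSupport.intro (hw.hasCompactSupport.isCompact.prod χs.isCompact) ?_
            rintro ⟨g, q⟩ hgq
            rw [Set.mem_prod, not_and_or] at hgq
            rcases hgq with h | h <;>
              simp [Function.uncurry, image_eq_zero_of_notMem_tsupport h]
      _ = B * ∫ x, χ x * ∫ g, w g * dist (f n g) (f n (g * x)) ^ 2 ∂m ∂m := by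
          congr 1
          congr 1
          ext x
          rw [← integral_const_mul]
          congr 1; ext g; ring
      _ ≤ B * ∫ x, χ x * C ∂m := by
          refine mul_le_mul_of_nonneg_left ?_ hB0
          refine MeasureTheory.integral_mono (hχi ?_) (hχi continuous_const) fun x => ?_
          · exact continuous_integral_mul hw.continuous hw.hasCompactSupport
              (Φ := fun x g => dist (f n g) (f n (g * x)) ^ 2)
              (by unfold Function.uncurry; fun_prop)
          · by_cases hx : x ∈ tsupport χ
            · exact mul_le_mul_of_nonneg_left (hC x hx n) (χ0 x)
            · simp [image_eq_zero_of_notMem_tsupport hx]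
      _ = _ := by rw [integral_mul_const]
  have data : ∀ n, BaryData m w (f n) := fun n => by
    have := fc n
    exact ⟨hw.nonneg, S.weight_one, fun x => hw.integrable (by fun_prop)⟩
  -- Each map is replaced by the barycenter of its values. `pairs` with `w` keeps it at bounded mean
  -- distance from the map, so it goes to infinity; `pairs` with `w (γ⁻¹ * ·)` bounds its
  -- displacement by `γ`.
  set x : ℕ → X := fun n => bary m w (f n) with hx
  have hvar : ∀ n z, dist (x n) z ^ 2 ≤ ∫ g, w g * dist (f n g) z ^ 2 ∂m := fun n z =>
    hX.sq_dist_bary_le (data n) z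
  obtain ⟨x₀⟩ := ‹Nonempty X›
  refine hX.exists_fixed_of_bounded_displacement x₀ x ?_ fun γ => ?_
  · obtain ⟨C, hC⟩ := pairs w hw.continuous hw.hasCompactSupport
    have bound : ∀ n, meanSq m w f₀ (f n) ≤
        4 * (∫ g, w g * dist (f₀ g) x₀ ^ 2 ∂m) + 4 * dist x₀ (x n) ^ 2 + 2 * C := by
      intro n
      have fcn := fc n
      have c1 : Continuous fun g => ∫ g', w g' * dist (f n g) (f n g') ^ 2 ∂m :=
        continuous_integral_mul hw.continuous hw.hasCompactSupport
          (Φ := fun g g' => dist (f n g) (f n g') ^ 2)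
          (by unfold Function.uncurry; fun_prop)
      unfold meanSq
      calc _ ≤ ∫ g, w g * (1 * (4 * dist (f₀ g) x₀ ^ 2 + 4 * dist x₀ (x n) ^ 2)
            + 2 * ∫ g', w g' * dist (f n g) (f n g') ^ 2 ∂m) ∂m := by
            refine hw.integral_mono (by fun_prop) (by fun_prop) fun g => ?_
            have k1 := sq_dist_le_two_mul (f₀ g) (x n) (f n g)
            have k2 := sq_dist_le_two_mul (f₀ g) x₀ (x n)
            have k3 := hvar n (f n g)
            simp only [dist_comm (f n g)]
            linarith
        _ = 4 * (∫ g, w g * dist (f₀ g) x₀ ^ 2 ∂m) + 4 * dist x₀ (x n) ^ 2 +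
            2 * ∫ g, w g * ∫ g', w g' * dist (f n g) (f n g') ^ 2 ∂m ∂m := by
            rw [hw.integral_add_mul (by fun_prop) c1, hw.integral_add_mul (by fun_prop)
              continuous_const, integral_mul_const, S.weight_one]
            ring
        _ ≤ _ := by linarith [hC n]
    set K := ∫ g, w g * dist (f₀ g) x₀ ^ 2 ∂m
    rw [tendsto_atTop] at hinf ⊢
    intro b
    filter_upwards [hinf (4 * K + 4 * b ^ 2 + 2 * C)] with n hn
    have h1 : b ^ 2 ≤ dist x₀ (x n) ^ 2 := by linarith [bound n]
    exact le_of_sq_le_sq h1 dist_nonneg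
  · obtain ⟨C, hC⟩ := pairs (fun g => w ((γ : G)⁻¹ * g))
      (hw.continuous.comp (continuous_const.mul continuous_id))
      (hw.hasCompactSupport.comp_homeomorph (Homeomorph.mulLeft (γ : G)⁻¹))
    refine ⟨Real.sqrt C, fun n => Real.le_sqrt_of_sq_le (le_trans ?_ (hC n))⟩
    have fcn := fc n
    rw [dist_comm]
    refine (hvar n (γ • x n)).trans ?_
    refine hw.integral_mono (by fun_prop) (continuous_integral_mul (by
      exact hw.continuous.comp (continuous_const.mul continuous_id))
      (hw.hasCompactSupport.comp_homeomorph (Homeomorph.mulLeft (γ : G)⁻¹))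
      (Φ := fun g g' => dist (f n g) (f n g') ^ 2)
      (by unfold Function.uncurry; fun_prop)) fun g => ?_
    have k1 := hvar n (γ⁻¹ • f n g)
    rw [← dist_smul γ, smul_inv_smul, dist_comm] at k1
    refine k1.trans (le_of_eq ?_)
    rw [← integral_mul_left_eq_self (fun g' => w ((γ : G)⁻¹ * g') * dist (f n g) (f n g') ^ 2)
      (γ : G)]
    congr 1
    ext g'
    rw [inv_mul_cancel_left, (hf n).equivariant.map_mul, dist_comm (f n g),
      ← dist_smul γ (f n g') (γ⁻¹ • f n g), smul_inv_smul]

end Stable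

/-! ### Existence of minimal stable sets. -/

section Minimal

set_option linter.unusedSectionVars false

open Filter Topology MeasureTheory

variable {X : Type*} [MetricSpace X] [ProperSpace X] [Nonempty X]
  {G : Type*} [Group G] [TopologicalSpace G] [IsTopologicalGroup G] [T2Space G]
  [LocallyCompactSpace G] [MeasurableSpace G] [BorelSpace G] {m : Measure G} [m.IsHaarMeasure]
  {Γ : Subgroup G} [MulAction Γ X] [IsIsometricSMul Γ X]
  {H : Type*} [Group H] [TopologicalSpace H] [IsTopologicalGroup H] [T2Space H]
  [LocallyCompactSpace H] [MeasurableSpace H] [BorelSpace H] {mH : Measure H} [mH.IsHaarMeasure]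
  {p : G →* H} {ι : H →* G} {w : G → ℝ} {ν : H → ℝ} {f₀ : G → X} {hX : IsCAT0 X}

/-- The infimum of the mean square distance of `f₀` to the elements of `M`. -/
noncomputable def infMeanSq (m : Measure G) (w : G → ℝ) (f₀ : G → X) (M : Set (G → X)) : ℝ :=
  sInf (meanSq m w f₀ '' M)

theorem infMeanSq_le (hw : IsWeight Γ w) {M : Set (G → X)} {f : G → X} (hf : f ∈ M) :
    infMeanSq m w f₀ M ≤ meanSq m w f₀ f :=
  csInf_le ⟨0, by rintro _ ⟨f, -, rfl⟩; exact meanSq_nonneg hw _ _⟩ ⟨f, hf, rfl⟩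

theorem infMeanSq_anti (hw : IsWeight Γ w) {M M' : Set (G → X)} (h : M ⊆ M')
    (hne : M.Nonempty) : infMeanSq m w f₀ M' ≤ infMeanSq m w f₀ M :=
  csInf_le_csInf ⟨0, by rintro _ ⟨f, -, rfl⟩; exact meanSq_nonneg hw _ _⟩ (hne.image _)
    (Set.image_mono h)

theorem exists_meanSq_le {M : Set (G → X)} (hne : M.Nonempty) {ε : ℝ} (hε : 0 < ε) :
    ∃ f ∈ M, meanSq m w f₀ f ≤ infMeanSq m w f₀ M + ε := by
  obtain ⟨_, ⟨f, hf, rfl⟩, h⟩ := exists_lt_of_csInf_lt (hne.image (meanSq m w f₀))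
    (lt_add_of_pos_right (infMeanSq m w f₀ M) hε)
  exact ⟨f, hf, h.le⟩

/-- Otherwise near-projections of `f₀` to sets further and further away would satisfy
`exists_fixed_boundary`. -/
theorem IsSetup.bddAbove_infMeanSq (S : IsSetup Γ p ι m mH w ν f₀)
    (hno : ¬ ∃ ξ : Boundary X, ∀ γ : Γ, γ • ξ = ξ) {c : Set (Set (G → X))}
    (hc : ∀ M ∈ c, IsStable hX Γ p ι mH ν f₀ M) : BddAbove (infMeanSq m w f₀ '' c) := by
  by_contra hb
  apply hno
  rw [not_bddAbove_iff] at hb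
  have h1 : ∀ n : ℕ, ∃ M ∈ c, (n : ℝ) ≤ infMeanSq m w f₀ M := by
    intro n
    obtain ⟨_, ⟨M, hM, rfl⟩, h⟩ := hb n
    exact ⟨M, hM, h.le⟩
  choose M hMc hMn using h1
  choose f hf hfr using fun n => exists_meanSq_le (m := m) (w := w) (f₀ := f₀)
    (hc _ (hMc n)).nonempty one_pos
  refine S.exists_fixed_boundary hX f (fun n => (hc _ (hMc n)).admissible _ (hf n))
    (fun n h => (hc _ (hMc n)).meanSq_translate_le S
      (fun f hf => infMeanSq_le S.weight hf) (hf n) (hfr n) h) ?_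
  exact tendsto_atTop_mono (fun n => (hMn n).trans (infMeanSq_le S.weight (hf n)))
    tendsto_natCast_atTop_atTop

/-- Near-minimizers in members of a chain of stable sets are close to each other. -/
theorem IsStable.meanSq_le_of_near (S : IsSetup Γ p ι m mH w ν f₀) {M : Set (G → X)}
    (hM : IsStable hX Γ p ι mH ν f₀ M) {R ε : ℝ} (hr : R - ε ≤ infMeanSq m w f₀ M)
    {f f' : G → X} (hf : f ∈ M) (hf' : f' ∈ M) (h : meanSq m w f₀ f ≤ R + ε)
    (h' : meanSq m w f₀ f' ≤ R + ε) : meanSq m w f f' ≤ 8 * ε := by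
  have h1 := (infMeanSq_le (m := m) (f₀ := f₀) S.weight (hM.mid f hf f' hf')).trans
    (meanSq_mid_le hX S.weight S.base.continuous (hM.admissible f hf).equivariant.continuous
      (hM.admissible f' hf').equivariant.continuous)
  linarith

/-- This replaces weak compactness in Zorn's lemma: near-minimizers in sets whose infimum approaches
the supremum `R` are mean-square Cauchy, so their averages along `H` converge uniformly. -/
theorem IsSetup.exists_mem_chain (S : IsSetup Γ p ι m mH w ν f₀)
    (hno : ¬ ∃ ξ : Boundary X, ∀ γ : Γ, γ • ξ = ξ) {c : Set (Set (G → X))}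
    (hc : ∀ M ∈ c, IsStable hX Γ p ι mH ν f₀ M) (hchain : IsChain (· ⊆ ·) c)
    (hne : c.Nonempty) : ∃ F, ∀ M ∈ c, F ∈ M := by
  have hb := S.bddAbove_infMeanSq hno hc
  set R := sSup (infMeanSq m w f₀ '' c) with hR
  have hle : ∀ M ∈ c, infMeanSq m w f₀ M ≤ R := fun M hM => le_csSup hb ⟨M, hM, rfl⟩
  have hpos : ∀ n : ℕ, (0 : ℝ) < 1 / ((n : ℝ) + 1) := fun n => by positivity
  have h1 : ∀ n : ℕ, ∃ M ∈ c, R - 1 / ((n : ℝ) + 1) ≤ infMeanSq m w f₀ M := by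
    intro n
    obtain ⟨_, ⟨M, hM, rfl⟩, h⟩ := exists_lt_of_lt_csSup (hne.image (infMeanSq m w f₀))
      (sub_lt_self R (hpos n))
    exact ⟨M, hM, h.le⟩
  choose M hMc hMr using h1
  choose f hf hfr using fun n => exists_meanSq_le (m := m) (w := w) (f₀ := f₀)
    (hc _ (hMc n)).nonempty (hpos n)
  have near : ∀ {M M' : Set (G → X)} {f f' : G → X} {ε : ℝ}, M ∈ c → M' ∈ c → f ∈ M → f' ∈ M' →
      R - ε ≤ infMeanSq m w f₀ M → R - ε ≤ infMeanSq m w f₀ M' → meanSq m w f₀ f ≤ R + ε →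
      meanSq m w f₀ f' ≤ R + ε → meanSq m w f f' ≤ 8 * ε := by
    intro M M' f f' ε hM hM' hf hf' hr hr' h h'
    rcases hchain.total hM hM' with hsub | hsub
    · exact (hc M' hM').meanSq_le_of_near S hr' (hsub hf) hf' h h'
    · exact (hc M hM).meanSq_le_of_near S hr hf (hsub hf') h h'
  have hfR : ∀ n, meanSq m w f₀ (f n) ≤ R + 1 / ((n : ℝ) + 1) := fun n =>
    (hfr n).trans (by linarith [hle _ (hMc n)])
  have adm : ∀ n, IsAdmissible Γ p f₀ (f n) := fun n => (hc _ (hMc n)).admissible _ (hf n)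
  have small : ∀ δ > 0, ∃ N : ℕ, 8 * (1 / ((N : ℝ) + 1)) ≤ δ := by
    intro δ hδ
    obtain ⟨N, hN⟩ := exists_nat_one_div_lt (K := ℝ) (by positivity : 0 < δ / 8)
    exact ⟨N, by linarith⟩
  have mono : ∀ {N n : ℕ}, N ≤ n → 1 / ((n : ℝ) + 1) ≤ 1 / ((N : ℝ) + 1) := by
    intro N n h
    have : (N : ℝ) ≤ n := by exact_mod_cast h
    gcongr
  have cauchy : ∀ ε > 0, ∃ N : ℕ, ∀ n ≥ N, ∀ k ≥ N, ∀ g,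
      dist (mollify mH ν ι (f n) g) (mollify mH ν ι (f k) g) ≤ ε := by
    intro ε hε
    obtain ⟨δ, hδ, hclose⟩ := S.exists_mollify_close hX hε
    obtain ⟨N, hN⟩ := small δ hδ
    refine ⟨N, fun n hn k hk g => hclose _ _ (adm n) (adm k) (le_trans ?_ hN) g⟩
    have a1 := mono hn
    have a2 := mono hk
    exact near (hMc n) (hMc k) (hf n) (hf k) (by linarith [hMr n]) (by linarith [hMr k])
      (by linarith [hfR n]) (by linarith [hfR k])
  have lim : ∀ g, ∃ y, Tendsto (fun n => mollify mH ν ι (f n) g) atTop (𝓝 y) := by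
    intro g
    apply cauchySeq_tendsto_of_complete
    rw [Metric.cauchySeq_iff]
    intro ε hε
    obtain ⟨N, hN⟩ := cauchy (ε / 2) (by positivity)
    exact ⟨N, fun n hn k hk => (hN n hn k hk g).trans_lt (by linarith)⟩
  choose F hF using lim
  have unif : ∀ ε > 0, ∃ N : ℕ, ∀ n ≥ N, ∀ g, dist (F g) (mollify mH ν ι (f n) g) ≤ ε := by
    intro ε hε
    obtain ⟨N, hN⟩ := cauchy ε hε
    refine ⟨N, fun n hn g => le_of_tendsto ((hF g).dist tendsto_const_nhds) ?_⟩
    filter_upwards [eventually_ge_atTop N] with k hk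
    exact hN k hk n hn g
  refine ⟨F, fun M' hM' => (hc M' hM').closed F fun ε hε => ?_⟩
  obtain ⟨δ, hδ, hclose⟩ := S.exists_mollify_close hX (half_pos hε)
  obtain ⟨N₁, hN₁⟩ := small δ hδ
  obtain ⟨N₂, hN₂⟩ := unif (ε / 2) (half_pos hε)
  set n := max N₁ N₂
  have hn₂ := hN₂ n (le_max_right _ _)
  have hn₁ := mono (le_max_left N₁ N₂)
  -- If `M'` is the smaller set, its infimum is at least that of `M n`, hence as close to `R`, and a
  -- near-minimizer chosen in `M'` is close to `f n`.
  rcases hchain.total (hMc n) hM' with hsub | hsub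
  · exact ⟨_, (hc M' hM').mollify _ (hsub (hf n)), fun g => (hn₂ g).trans (by linarith)⟩
  · obtain ⟨f', hf', hfr'⟩ := exists_meanSq_le (m := m) (w := w) (f₀ := f₀)
      (hc M' hM').nonempty (hpos n)
    refine ⟨_, (hc M' hM').mollify _ hf', fun g => ?_⟩
    have hr' : R - 1 / ((n : ℝ) + 1) ≤ infMeanSq m w f₀ M' :=
      (hMr n).trans (infMeanSq_anti S.weight hsub (hc M' hM').nonempty)
    have k1 := near (hMc n) hM' (hf n) hf' (hMr n) hr' (hfR n)
      (hfr'.trans (by linarith [hle _ hM']))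
    have k2 := hclose _ _ (adm n) ((hc M' hM').admissible _ hf') (by linarith) g
    linarith [dist_triangle (F g) (mollify mH ν ι (f n) g) (mollify mH ν ι f' g), hn₂ g]

theorem IsSetup.exists_minimal (S : IsSetup Γ p ι m mH w ν f₀)
    (hno : ¬ ∃ ξ : Boundary X, ∀ γ : Γ, γ • ξ = ξ) :
    ∃ M : Set (G → X), Minimal (IsStable hX Γ p ι mH ν f₀) M := by
  obtain ⟨M, -, hM⟩ := zorn_superset_nonempty {M | IsStable hX Γ p ι mH ν f₀ M} (by
    intro c hc hchain hne
    have hc' : ∀ M ∈ c, IsStable hX Γ p ι mH ν f₀ M := fun M hM => hc hM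
    obtain ⟨F, hF⟩ := S.exists_mem_chain hno hc' hchain hne
    refine ⟨⋂₀ c, ⟨⟨F, hF⟩, ?_, ?_, ?_, ?_, ?_⟩, fun M hM => Set.sInter_subset_of_mem hM⟩
    · obtain ⟨M, hM⟩ := hne
      exact fun f hf => (hc' M hM).admissible f (hf M hM)
    · intro f hf M hM
      refine (hc' M hM).closed f fun ε hε => ?_
      obtain ⟨f', h1, h2⟩ := hf ε hε
      exact ⟨f', h1 M hM, h2⟩
    · exact fun f hf f' hf' M hM => (hc' M hM).mid f (hf M hM) f' (hf' M hM)
    · exact fun f hf h M hM => (hc' M hM).translate f (hf M hM) h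
    · exact fun f hf M hM => (hc' M hM).mollify f (hf M hM)) _ (S.isStable_admissible hX)
  exact ⟨M, hM⟩

/-! ### Rigidity of a minimal stable set. -/

section Rigidity

variable {M : Set (G → X)}

/-- The mean square displacement by an element of the kernel of `p` is the same for all elements
of a minimal stable set. -/
theorem IsSetup.meanSq_mul_le (S : IsSetup Γ p ι m mH w ν f₀)
    (hM : Minimal (IsStable hX Γ p ι mH ν f₀) M) {k : G} (hk : p k = 1) {f f₁ : G → X}
    (hf : f ∈ M) (hf₁ : f₁ ∈ M) :
    meanSq m w f (fun g => f (g * k)) ≤ meanSq m w f₁ (fun g => f₁ (g * k)) := by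
  set E : (G → X) → ℝ := fun f => meanSq m w f (fun g => f (g * k)) with hE
  have hw := S.weight
  have hι := S.split.continuous_incl
  have hMs := hM.prop
  have cont : ∀ f ∈ M, Continuous f := fun f hf => (hMs.admissible f hf).equivariant.continuous
  have φc : ∀ f ∈ M, Continuous fun g => dist (f g) (f (g * k)) ^ 2 := fun f hf => by
    have := cont f hf
    fun_prop
  have φΓ : ∀ f ∈ M, ∀ (γ : Γ) (g : G), dist (f (γ * g)) (f (γ * g * k)) ^ 2 =
      dist (f g) (f (g * k)) ^ 2 := fun f hf γ g => by
    have he := (hMs.admissible f hf).equivariant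
    rw [mul_assoc, he.dist_mul he]
  -- The displacement functional `E` is convex, `H`-invariant and not increased by averaging, so its
  -- sublevel set in `M` is stable and hence all of `M`.
  have hN : IsStable hX Γ p ι mH ν f₀ {f ∈ M | E f ≤ E f₁} := by
    refine ⟨⟨f₁, hf₁, le_rfl⟩, fun f hf => hMs.admissible f hf.1, ?_, ?_, ?_, ?_⟩
    · intro f hf
      have hfM : f ∈ M := hMs.closed f fun ε hε => by
        obtain ⟨f', h1, h2⟩ := hf ε hε
        exact ⟨f', h1.1, h2⟩
      refine ⟨hfM, ?_⟩
      apply le_of_forall_pos_le_add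
      intro ε hε
      set o := osc f₀ k with ho
      have ho0 : 0 ≤ o := osc_nonneg _ _
      -- A uniform error `η` changes a squared displacement bounded by `o²` by at most `4ηo + 4η²`,
      -- which is at most `ε` for this choice.
      set η := min 1 (ε / (4 * o + 4)) with hη
      have hη0 : 0 < η := lt_min one_pos (by positivity)
      have hη1 : η ≤ 1 := min_le_left _ _
      have hη2 : η * (4 * o + 4) ≤ ε := by
        rw [← le_div_iff₀ (by positivity)]; exact min_le_right _ _
      obtain ⟨f', ⟨hf'M, hf'E⟩, hd⟩ := hf η hη0
      refine le_trans ?_ (add_le_add_left hf'E ε)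
      calc E f ≤ ∫ g, w g * (1 * dist (f' g) (f' (g * k)) ^ 2 + 1 * ε) ∂m := by
            refine hw.integral_mono (φc f hfM) (((φc f' hf'M).const_mul 1).add
              continuous_const) fun g => ?_
            have k1 := dist_triangle4 (f g) (f' g) (f' (g * k)) (f (g * k))
            rw [dist_comm (f' (g * k)) (f (g * k))] at k1
            have k2 := (hMs.admissible f' hf'M).dist_le k hk g
            have k3 : dist (f g) (f (g * k)) ≤ dist (f' g) (f' (g * k)) + 2 * η := by
              linarith [hd g, hd (g * k)]
            have k4 := pow_le_pow_left₀ dist_nonneg k3 2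
            nlinarith
        _ = _ := by
            rw [hw.integral_add_mul (φc f' hf'M) continuous_const, integral_mul_const,
              S.weight_one]
            simp [hE, meanSq]
    · rintro f ⟨hfM, hfE⟩ f' ⟨hf'M, hf'E⟩
      have hmM := hMs.mid f hfM f' hf'M
      refine ⟨hmM, ?_⟩
      calc E _ ≤ ∫ g, w g * (1 / 2 * dist (f g) (f (g * k)) ^ 2 +
            1 / 2 * dist (f' g) (f' (g * k)) ^ 2) ∂m := by
            refine hw.integral_mono (φc _ hmM) (((φc f hfM).const_mul _).add
              ((φc f' hf'M).const_mul _)) fun g => ?_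
            have := hX.sq_dist_mid_mid (f g) (f' g) (f (g * k)) (f' (g * k))
            nlinarith [sq_nonneg (dist (f g) (f' g) - dist (f (g * k)) (f' (g * k)))]
        _ = 1 / 2 * E f + 1 / 2 * E f' := hw.integral_add_mul (φc f hfM) (φc f' hf'M) _ _
        _ ≤ E f₁ := by linarith
    · rintro f ⟨hfM, hfE⟩ h
      refine ⟨hMs.translate f hfM h, ?_⟩
      have e : E (translate ι h f) = E f := by
        refine Eq.trans ?_ (hw.integral_mul_right (m := m) S.lattice (φc f hfM) (φΓ f hfM) (ι h))
        simp only [hE, meanSq, translate]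
        congr 1
        ext g
        rw [mul_assoc g k, ← S.split.comm h k hk, ← mul_assoc]
      rw [e]
      exact hfE
    · rintro f ⟨hfM, hfE⟩
      have hBM := hMs.mollify f hfM
      refine ⟨hBM, le_trans ?_ hfE⟩
      have := cont f hfM
      calc E (mollify mH ν ι f) ≤ ∫ g, w g * (∫ q, ν q *
            dist (f (g * ι q)) (f (g * ι q * k)) ^ 2 ∂mH) ∂m := by
            refine hw.integral_mono (φc _ hBM) (continuous_integral_mul S.kernel.continuous
              S.kernel.hasCompactSupport
              (Φ := fun g q => dist (f (g * ι q)) (f (g * ι q * k)) ^ 2)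
              (by unfold Function.uncurry; fun_prop)) fun g => ?_
            refine (hX.sq_dist_mollify_le S.kernel hι (cont f hfM) (cont f hfM) g
              (g * k)).trans (le_of_eq ?_)
            congr 1
            ext q
            rw [mul_assoc g k, ← S.split.comm q k hk, ← mul_assoc]
        _ = E f := by
            rw [hw.integral_average S.lattice hι S.kernel.continuous S.kernel.hasCompactSupport
              (φc f hfM) (φΓ f hfM), S.kernel.integral_eq_one, one_mul]
            rfl
  exact (hM.le_of_le hN (fun f hf => hf.1) hf).2

/-- The mean square displacement by `k` agrees at `f`, `f'` and their midpoint, so the convexity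
defect `ψ` has mean zero. It is continuous and non-negative, hence vanishes, and it dominates the
squared difference of the two distances. -/
theorem IsSetup.dist_mul_eq (S : IsSetup Γ p ι m mH w ν f₀)
    (hM : Minimal (IsStable hX Γ p ι mH ν f₀) M) {k : G} (hk : p k = 1) {f f' : G → X}
    (hf : f ∈ M) (hf' : f' ∈ M) (g : G) :
    dist (f g) (f' g) = dist (f (g * k)) (f' (g * k)) := by
  have hw := S.weight
  have hMs := hM.prop
  have he := (hMs.admissible f hf).equivariant
  have he' := (hMs.admissible f' hf').equivariant
  have hmM := hMs.mid f hf f' hf'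
  have hem := (hMs.admissible _ hmM).equivariant
  set n : G → X := fun g => hX.mid (f g) (f' g) with hn
  have c1 := he.continuous
  have c2 := he'.continuous
  have c3 := hem.continuous
  set ψ : G → ℝ := fun g => 1 * (1 / 2 * dist (f g) (f (g * k)) ^ 2 +
    1 / 2 * dist (f' g) (f' (g * k)) ^ 2) + (-1) * dist (n g) (n (g * k)) ^ 2 with hψ
  have key : ∀ g, (dist (f g) (f' g) - dist (f (g * k)) (f' (g * k))) ^ 2 / 4 ≤ ψ g := by
    intro g
    have := hX.sq_dist_mid_mid (f g) (f' g) (f (g * k)) (f' (g * k))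
    simp only [hψ, hn]
    linarith
  have hzero := hw.eq_zero_of_integral_eq_zero (m := m) (φ := ψ) (by fun_prop) ?_ ?_ ?_ g
  · have h1 := key g
    rw [hzero] at h1
    have h2 : (dist (f g) (f' g) - dist (f (g * k)) (f' (g * k))) ^ 2 = 0 :=
      le_antisymm (by linarith) (sq_nonneg _)
    exact sub_eq_zero.1 ((pow_eq_zero_iff two_ne_zero).1 h2)
  · intro γ g
    simp only [hψ, mul_assoc]
    rw [he.dist_mul he, he'.dist_mul he', hem.dist_mul hem]
  · exact fun g => le_trans (by positivity) (key g)
  · simp only [hψ]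
    rw [hw.integral_add_mul (by fun_prop) (by fun_prop),
      hw.integral_add_mul (by fun_prop) (by fun_prop)]
    have a1 := S.meanSq_mul_le hM hk hf hmM
    have a2 := S.meanSq_mul_le hM hk hmM hf
    have a3 := S.meanSq_mul_le hM hk hf' hmM
    have a4 := S.meanSq_mul_le hM hk hmM hf'
    unfold meanSq at a1 a2 a3 a4
    linarith

/-- Elements of a minimal stable set are at constant distance from each other. -/
theorem IsSetup.dist_eq_dist_one (S : IsSetup Γ p ι m mH w ν f₀)
    (hM : Minimal (IsStable hX Γ p ι mH ν f₀) M) {f f' : G → X}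
    (hf : f ∈ M) (hf' : f' ∈ M) (g : G) : dist (f g) (f' g) = dist (f 1) (f' 1) := by
  have he := (hM.prop.admissible f hf).equivariant
  have he' := (hM.prop.admissible f' hf').equivariant
  have c1 := he.continuous
  have c2 := he'.continuous
  have hι := S.split.continuous_incl
  have red : ∀ g, dist (f g) (f' g) = dist (f (ι (p g))) (f' (ι (p g))) := by
    intro g
    have hpk : p ((ι (p g))⁻¹ * g) = 1 := by
      rw [map_mul, map_inv, S.split.proj_incl, inv_mul_cancel]
    have := S.dist_mul_eq hM hpk hf hf' (ι (p g))
    rw [mul_inv_cancel_left] at this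
    exact this.symm
  have hcl : IsClosed {h : H | dist (f (ι h)) (f' (ι h)) = dist (f 1) (f' 1)} :=
    isClosed_eq (by fun_prop) continuous_const
  -- By `red` the distance factors through `p`; by equivariance it is constant on `Γ`, whose image
  -- in `H` is dense.
  have hall : ∀ h : H, dist (f (ι h)) (f' (ι h)) = dist (f 1) (f' 1) := by
    intro h
    refine hcl.closure_subset_iff.2 ?_ (S.split.dense h)
    rintro _ ⟨γ, hγ, rfl⟩
    have h1 := he.dist_mul he' ⟨γ, hγ⟩ 1 1
    simp only [mul_one] at h1
    have h2 := red γ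
    exact h2.symm.trans h1
  rw [red, hall]

/-- A circumradius argument: the elements of `M` within `ρ` of all of `M` form a stable set,
non-empty because it contains the midpoint of `f₁` and `f₂`. Minimality gives `D ≤ ρ`, which forces
`d = 0`. -/
theorem IsSetup.subsingleton_of_bounded (S : IsSetup Γ p ι m mH w ν f₀)
    (hM : Minimal (IsStable hX Γ p ι mH ν f₀) M)
    (hb : Bornology.IsBounded ((fun f : G → X => f 1) '' M)) {f₁ f₂ : G → X}
    (h₁ : f₁ ∈ M) (h₂ : f₂ ∈ M) : f₁ = f₂ := by
  have hMs := hM.prop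
  have hι := S.split.continuous_incl
  have hdc : ∀ {f f' : G → X}, f ∈ M → f' ∈ M → ∀ g, dist (f g) (f' g) = dist (f 1) (f' 1) :=
    fun hf hf' g => S.dist_eq_dist_one hM hf hf' g
  set D := Metric.diam ((fun f : G → X => f 1) '' M) with hD
  have hle : ∀ f ∈ M, ∀ f' ∈ M, dist (f 1) (f' 1) ≤ D := fun f hf f' hf' =>
    Metric.dist_le_diam_of_mem hb ⟨f, hf, rfl⟩ ⟨f', hf', rfl⟩
  set d := dist (f₁ 1) (f₂ 1) with hd
  set ρ := Real.sqrt (D ^ 2 - d ^ 2 / 4) with hρ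
  have hD0 : 0 ≤ D := Metric.diam_nonneg
  have hd0 : 0 ≤ d := dist_nonneg
  have hdD : d ≤ D := hle f₁ h₁ f₂ h₂
  have hnn : 0 ≤ D ^ 2 - d ^ 2 / 4 := by nlinarith
  have hρ0 : 0 ≤ ρ := Real.sqrt_nonneg _
  have hN : IsStable hX Γ p ι mH ν f₀ {f ∈ M | ∀ f' ∈ M, dist (f 1) (f' 1) ≤ ρ} := by
    have htr : ∀ f ∈ M, (∀ f' ∈ M, dist (f 1) (f' 1) ≤ ρ) → ∀ h, ∀ f' ∈ M,
        dist (translate ι h f 1) (f' 1) ≤ ρ := by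
      intro f hf hfρ h f' hf'
      have hf'' := hMs.translate f' hf' h⁻¹
      have e := congrFun (translate_translate_inv (ι := ι) h f') 1
      rw [← e]
      simp only [translate]
      refine (hdc hf hf'' (1 * ι h)).trans_le (hfρ _ hf'')
    refine ⟨⟨_, hMs.mid f₁ h₁ f₂ h₂, fun f' hf' => ?_⟩, fun f hf => hMs.admissible f hf.1,
      ?_, ?_, ?_, ?_⟩
    · apply Real.le_sqrt_of_sq_le
      have k := hX.cn_mid (f₁ 1) (f₂ 1) (f' 1)
      have k1 := pow_le_pow_left₀ dist_nonneg (hle f₁ h₁ f' hf') 2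
      have k2 := pow_le_pow_left₀ dist_nonneg (hle f₂ h₂ f' hf') 2
      linarith
    · intro f hf
      refine ⟨hMs.closed f fun ε hε => ?_, fun f' hf' => ?_⟩
      · obtain ⟨f', h1, h2⟩ := hf ε hε
        exact ⟨f', h1.1, h2⟩
      · apply le_of_forall_pos_le_add
        intro ε hε
        obtain ⟨f'', h1, h2⟩ := hf ε hε
        linarith [dist_triangle (f 1) (f'' 1) (f' 1), h2 1, h1.2 f' hf']
    · rintro f ⟨hfM, hfρ⟩ f' ⟨hf'M, hf'ρ⟩
      refine ⟨hMs.mid f hfM f' hf'M, fun f'' hf'' => ?_⟩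
      have := hX.dist_mid_mid (f 1) (f' 1) (f'' 1) (f'' 1)
      rw [hX.mid_self] at this
      linarith [hfρ f'' hf'', hf'ρ f'' hf'']
    · rintro f ⟨hfM, hfρ⟩ h
      exact ⟨hMs.translate f hfM h, htr f hfM hfρ h⟩
    · rintro f ⟨hfM, hfρ⟩
      refine ⟨hMs.mollify f hfM, fun f' hf' => ?_⟩
      have := (hMs.admissible f hfM).equivariant.continuous
      refine le_of_sq_le_sq (le_trans (hX.sq_dist_bary_le (S.kernel.baryData
        (f := fun q => f (1 * ι q)) (by fun_prop)) (f' 1)) ?_) hρ0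
      exact S.kernel.integral_le (by fun_prop) fun q =>
        pow_le_pow_left₀ dist_nonneg (htr f hfM hfρ q f' hf') 2
  have hall : ∀ f ∈ M, ∀ f' ∈ M, dist (f 1) (f' 1) ≤ ρ := fun f hf =>
    (hM.le_of_le hN (fun f hf => hf.1) hf).2
  have hDρ : D ≤ ρ := by
    refine Metric.diam_le_of_forall_dist_le hρ0 ?_
    rintro _ ⟨f, hf, rfl⟩ _ ⟨f', hf', rfl⟩
    exact hall f hf f' hf'
  have h4 : D ^ 2 ≤ D ^ 2 - d ^ 2 / 4 := by
    rw [← Real.sq_sqrt hnn]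
    exact pow_le_pow_left₀ hD0 hDρ 2
  have h5 : d = 0 := by nlinarith
  ext g
  rw [← dist_eq_zero, hdc h₁ h₂ g]
  exact h5

/-- Distances in `M` are constant in `g`, so convergence at `1` implies uniform convergence, under
which `M` is closed. -/
theorem IsSetup.isClosed_eval (S : IsSetup Γ p ι m mH w ν f₀)
    (hM : Minimal (IsStable hX Γ p ι mH ν f₀) M) :
    IsClosed (Set.range fun f : M => (f : G → X) 1) := by
  refine isClosed_of_closure_subset fun a ha => ?_
  obtain ⟨x, hx, hxa⟩ := mem_closure_iff_seq_limit.1 ha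
  choose f hf using hx
  have hd : ∀ n k g, dist ((f n : G → X) g) ((f k : G → X) g) = dist (x n) (x k) := by
    intro n k g
    rw [S.dist_eq_dist_one hM (f n).2 (f k).2 g, ← hf n, ← hf k]
  have hcx := hxa.cauchySeq
  have lim : ∀ g, ∃ y, Tendsto (fun n => (f n : G → X) g) atTop (𝓝 y) := by
    intro g
    apply cauchySeq_tendsto_of_complete
    rw [Metric.cauchySeq_iff] at hcx ⊢
    simpa only [hd] using hcx
  choose F hF using lim
  have hFd : ∀ n g, dist (F g) ((f n : G → X) g) = dist a (x n) := by
    intro n g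
    refine tendsto_nhds_unique ((hF g).dist tendsto_const_nhds) ?_
    simp only [hd]
    exact hxa.dist tendsto_const_nhds
  have hFM : F ∈ M := hM.prop.closed F fun ε hε => by
    obtain ⟨n, hn⟩ := ((Metric.tendsto_nhds.1 hxa) ε hε).exists
    refine ⟨f n, (f n).2, fun g => ?_⟩
    rw [hFd, dist_comm]
    exact hn.le
  refine ⟨⟨F, hFM⟩, tendsto_nhds_unique (hF 1) ?_⟩
  refine hxa.congr fun n => (hf n).symm

/-- Either some admissible map is invariant under `H`, or the action on the boundary of a convex
subset extends to `H`. -/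
theorem IsSetup.invariant_or_boundary_action (hX : IsCAT0 X) (S : IsSetup Γ p ι m mH w ν f₀)
    (hno : ¬ ∃ ξ : Boundary X, ∀ γ : Γ, γ • ξ = ξ) :
    (∃ f, IsAdmissible Γ p f₀ f ∧ ∀ h g, f (g * ι h) = f g) ∨
    ∃ C : Set (Boundary X), C.Nonempty ∧ IsClosed C ∧ (∀ γ : Γ, ∀ ξ ∈ C, γ • ξ ∈ C) ∧
      ∃ ρ : H →* Equiv.Perm C, Continuous (fun q : H × C => ρ q.1 q.2) ∧
        ∀ (γ : Γ) (ξ : C), (ρ (p γ) ξ : Boundary X) = γ • (ξ : Boundary X) := by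
  obtain ⟨M, hM⟩ := S.exists_minimal (hX := hX) hno
  have hMs := hM.prop
  by_cases hb : Bornology.IsBounded ((fun f : G → X => f 1) '' M)
  · left
    obtain ⟨f, hf⟩ := hMs.nonempty
    refine ⟨f, hMs.admissible f hf, fun h g => ?_⟩
    exact congrFun (S.subsingleton_of_bounded hM hb (hMs.translate f hf h) hf) g
  · right
    let act : MulAction H M :=
      { smul := fun h f => ⟨translate ι h f, hMs.translate f f.2 h⟩
        one_smul := fun f => Subtype.ext (funext fun g => by
          change (f : G → X) (g * ι 1) = _
          rw [map_one, mul_one])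
        mul_smul := fun h h' f => Subtype.ext (funext fun g => by
          change (f : G → X) (g * ι (h * h')) = (f : G → X) (g * ι h * ι h')
          rw [map_mul, mul_assoc]) }
    have hι := S.split.continuous_incl
    have hsmul : ∀ (h : H) (f : M), ((h • f : M) : G → X) 1 = (f : G → X) (ι h) := fun h f => by
      change (f : G → X) (1 * ι h) = _
      rw [one_mul]
    refine hX.exists_boundary_action (e := fun f : M => (f : G → X) 1) (p.comp Γ.subtype)
      ?_ (S.isClosed_eval hM) ?_ ?_ ?_ ?_
    · intro h f f'
      simp only [hsmul]
      exact S.dist_eq_dist_one hM f.2 f'.2 _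
    · rintro _ ⟨f, rfl⟩ _ ⟨f', rfl⟩
      exact ⟨⟨_, hMs.mid f f.2 f' f'.2⟩, rfl⟩
    · intro f
      have := (hMs.admissible f f.2).equivariant.continuous
      simp only [hsmul]
      fun_prop
    · rwa [Set.image_eq_range] at hb
    · intro γ
      -- `γ • f 1 = f γ`, and `γ` differs from `ι (p γ)` by an element of `ker p`; admissibility
      -- bounds the resulting displacement uniformly in `f`.
      refine ⟨osc f₀ ((ι (p γ))⁻¹ * γ), fun f => ?_⟩
      have hadm := hMs.admissible f f.2
      have hpk : p ((ι (p γ))⁻¹ * γ) = 1 := by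
        rw [map_mul, map_inv, S.split.proj_incl, inv_mul_cancel]
      have h1 := hadm.dist_le _ hpk (ι (p γ))
      rw [mul_inv_cancel_left] at h1
      have h2 := hadm.equivariant.map_mul γ 1
      rw [mul_one] at h2
      rw [dist_comm]
      simp only [hsmul, ← h2]
      exact h1

end Rigidity

end Minimal

/-! ### The dichotomy for one factor and the choice of the factor. -/

section Main

open MeasureTheory

theorem IsUniformLattice.invariant_or_boundary_action {X : Type*} [MetricSpace X] [ProperSpace X]
    [Nonempty X] (hX : IsCAT0 X) {G : Type*} [Group G] [TopologicalSpace G] [IsTopologicalGroup G]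
    [T2Space G] [LocallyCompactSpace G] {Γ : Subgroup G} [MulAction Γ X] [IsIsometricSMul Γ X]
    {H : Type*} [Group H] [TopologicalSpace H] [IsTopologicalGroup H] [T2Space H]
    [LocallyCompactSpace H] {p : G →* H} {ι : H →* G} (hΓ : IsUniformLattice Γ)
    (hs : IsSplitting Γ p ι) {f₀ : G → X} (hf₀ : IsEquivariantMap Γ f₀)
    (hno : ¬ ∃ ξ : Boundary X, ∀ γ : Γ, γ • ξ = ξ) :
    (∃ f, IsAdmissible Γ p f₀ f ∧ ∀ h g, f (g * ι h) = f g) ∨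
    ∃ C : Set (Boundary X), C.Nonempty ∧ IsClosed C ∧ (∀ γ : Γ, ∀ ξ ∈ C, γ • ξ ∈ C) ∧
      ∃ ρ : H →* Equiv.Perm C, Continuous (fun q : H × C => ρ q.1 q.2) ∧
        ∀ (γ : Γ) (ξ : C), (ρ (p γ) ξ : Boundary X) = γ • (ξ : Boundary X) := by
  borelize G H
  obtain ⟨w, hw⟩ := hΓ.exists_weight
  obtain ⟨ν, hν⟩ := exists_isKernel (Measure.haar : Measure H)
  have hpos : 0 < ∫ g, w g ∂(Measure.haar : Measure G) := hw.integral_pos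
  set c := ∫ g, w g ∂(Measure.haar : Measure G)
  have : (ENNReal.ofReal c⁻¹ • (Measure.haar : Measure G)).IsHaarMeasure :=
    Measure.IsHaarMeasure.smul _ (by simpa using hpos) ENNReal.ofReal_ne_top
  have S : IsSetup Γ p ι (ENNReal.ofReal c⁻¹ • (Measure.haar : Measure G)) Measure.haar w ν f₀ := by
    refine ⟨hΓ, hs, hw, ?_, hν, hf₀⟩
    rw [integral_smul_measure, ENNReal.toReal_ofReal (inv_nonneg.2 hpos.le), smul_eq_mul]
    exact inv_mul_cancel₀ hpos.ne'
  exact S.invariant_or_boundary_action hX hno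

end Main

end CAT0

theorem theorem2 {n : ℕ} {G : Fin n → Type*} [∀ i, Group (G i)] [∀ i, TopologicalSpace (G i)]
    [∀ i, IsTopologicalGroup (G i)] [∀ i, T2Space (G i)] [∀ i, LocallyCompactSpace (G i)]
    [∀ i, SigmaCompactSpace (G i)]
    (Γ : Subgroup (∀ i, G i)) (hΓ : CAT0.IsUniformLattice Γ) (hirr : CAT0.IsIrreducible Γ)
    {X : Type*} [MetricSpace X] [ProperSpace X] [Nonempty X] (hX : CAT0.IsCAT0 X)
    [MulAction Γ X] [IsIsometricSMul Γ X]
    (hfix : ¬ ∃ x : X, ∀ γ : Γ, γ • x = x) :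
    ∃ C : Set (CAT0.Boundary X), C.Nonempty ∧ IsClosed C ∧
      (∀ γ : Γ, ∀ ξ ∈ C, γ • ξ ∈ C) ∧
      ∃ ρ : (∀ i, G i) →* Equiv.Perm C,
        Continuous (fun p : (∀ i, G i) × C => ρ p.1 p.2) ∧
        (∀ (γ : Γ) (ξ : C), (ρ (γ : ∀ i, G i) ξ : CAT0.Boundary X) = γ • (ξ : CAT0.Boundary X)) ∧
        ∃ (i : Fin n) (ρi : G i →* Equiv.Perm C),
          Continuous (fun p : G i × C => ρi p.1 p.2) ∧
          ρ = ρi.comp (Pi.evalMonoidHom G i) := by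
  classical
  by_cases hξ : ∃ ξ : CAT0.Boundary X, ∀ γ : Γ, γ • ξ = ξ
  · obtain ⟨ξ, hξ⟩ := hξ
    -- Without factors `Γ` would be trivial and fix every point of `X`.
    have i : Fin n := by
      rcases n with _ | n
      · exfalso
        obtain ⟨x⟩ := ‹Nonempty X›
        refine hfix ⟨x, fun γ => ?_⟩
        rw [Subsingleton.elim γ 1, one_smul]
      · exact 0
    refine ⟨{ξ}, ⟨ξ, rfl⟩, hX.isClosed_singleton_boundary ξ, ?_, 1, continuous_snd, ?_, i, 1,
      continuous_snd, rfl⟩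
    · rintro γ _ rfl
      exact hξ γ
    · rintro γ ⟨_, rfl⟩
      exact (hξ γ).symm
  -- `S` records the factors on which the equivariant map does not depend; a maximal such `S` cannot
  -- contain every factor.
  · let P : Finset (Fin n) → Prop := fun S => ∃ f : (∀ i, G i) → X,
      CAT0.IsEquivariantMap Γ f ∧ ∀ g g', (∀ i ∉ S, g i = g' i) → f g = f g'
    have hP : P ∅ := by
      obtain ⟨f, hf⟩ := hX.exists_isEquivariantMap hΓ
      exact ⟨f, hf, fun g g' h => congrArg f (funext fun i => h i (by simp))⟩
    obtain ⟨S, hS⟩ := (Set.toFinite {S | P S}).exists_maximal ⟨∅, hP⟩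
    obtain ⟨f₀, hf₀, hS₀⟩ := hS.prop
    obtain ⟨j, hj⟩ : ∃ j, j ∉ S := by
      by_contra! hcon
      refine hfix ⟨f₀ 1, fun γ => ?_⟩
      rw [← hf₀.map_mul]
      exact hS₀ _ _ fun i hi => absurd (hcon i) hi
    have hsplit : CAT0.IsSplitting Γ (Pi.evalMonoidHom G j) (MonoidHom.mulSingle G j) := by
      refine ⟨continuous_apply j, continuous_mulSingle j, fun h => by simp, fun h k hk => ?_,
        hirr j⟩
      have hk : k j = 1 := hk
      ext i
      rcases eq_or_ne i j with rfl | hij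
      · simp [hk]
      · simp [Pi.mulSingle_eq_of_ne hij]
    rcases hΓ.invariant_or_boundary_action hX hsplit hf₀ hξ with ⟨f, hf, hinv⟩ | h
    · exfalso
      have hPS : P (insert j S) := by
        refine ⟨f, hf.equivariant, fun g g' hgg' => ?_⟩
        -- Invariance under `G j` allows both `j`-coordinates to be set to `1`. The remaining
        -- difference `a⁻¹ * b` lies in `ker p` and is trivial outside `S`, so `f₀` does not
        -- oscillate along it, and neither does `f`.
        rw [← hinv (g j)⁻¹ g, ← hinv (g' j)⁻¹ g']
        set a := g * MonoidHom.mulSingle G j (g j)⁻¹ with ha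
        set b := g' * MonoidHom.mulSingle G j (g' j)⁻¹ with hb
        have haj : a j = 1 := by simp [ha]
        have hbj : b j = 1 := by simp [hb]
        have hab : ∀ i ∉ S, a i = b i := by
          intro i hi
          rcases eq_or_ne i j with rfl | hij
          · rw [haj, hbj]
          · simp [ha, hb, Pi.mulSingle_eq_of_ne hij, hgg' i (by simp [hij, hi])]
        have h1 := hf.dist_le (a⁻¹ * b) (by simp [haj, hbj]) a
        rw [mul_inv_cancel_left] at h1
        have h2 : CAT0.osc f₀ (a⁻¹ * b) ≤ 0 := ciSup_le fun x => by
          rw [hS₀ x (x * (a⁻¹ * b)) fun i hi => by simp [hab i hi], dist_self]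
        exact dist_le_zero.1 (h1.trans h2)
      have := hS.le_of_ge hPS (Finset.subset_insert j S)
      exact hj (this (Finset.mem_insert_self j S))
    · obtain ⟨C, hne, hcl, hinv, ρ, hρ, hργ⟩ := h
      exact ⟨C, hne, hcl, hinv, ρ.comp (Pi.evalMonoidHom G j),
        hρ.comp (((continuous_apply j).comp continuous_fst).prodMk continuous_snd), hργ, j, ρ, hρ,
        rfl⟩
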